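/- Let $\xi$ be a real random variable of mean zero and variance one, and let $a_1,\dots,a_n,b_1,\dots,b_n$ be i.i.d. copies of $\xi$. Put $$P_n(x)=\frac1{\sqrt n}\sum_{k=1}^n \big(a_k\cos(kx)+b_k\sin(kx)\big),\qquad \mathbf v_{P_n}=(a_1,\dots,a_n,b_1,\dots,b_n)\in\mathbb R^{2n}.$$ For a constant $C_0>0$, suppose that either $|\xi|\le C_0$ almost surely, or the law of $\xi$ satisfies the logarithmic Sobolev inequality with parameter $C_0$: for every smooth compactly supported $f:\mathbb R\to\mathbb R$, $$\mathbf E\big(f(\xi)^2\log f(\xi)^2\big)-\mathbf E\big(f(\xi)^2\big)\log \mathbf E\big(f(\xi)^2\big)\le C_0\,\mathbf E\big(f'(\xi)^2\big).$$ Let $R>0$ and cover the circle $\mathbb T=\mathbb R/2\pi\mathbb Z$ by $N$ open intervals $I_1,\dots,I_N$ of length $R/n$, where $N\le 2\pi n/R+1$ (so $N$ is $2\pi n/R$ up to rounding). Let $3I_i$ be the open interval of length $3R/n$ with the same midpoint as $I_i$. Given $\alpha,\beta>0$, call $I_i$ stable for $f$ if there is no $x\in 3I_i$ with both $|f(x)|\le\alpha$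 and $|f'(x)|\le\beta n$, and unstable otherwise. Given $\delta>0$, call $f$ exceptional if at least $\delta n$ of the intervals $I_i$ are unstable for $f$. Let $\mathcal E_e=\mathcal E_e(R,\alpha,\beta;\delta)$ be the set of the vectors $\mathbf v_{P_n}\in\mathbb R^{2n}$ for which $P_n$ is exceptional. **Theorem 4.1.** There are absolute constants $R_0>0$ and $c>0$ such that the following holds. For all $C_0>0$ and $K\ge1$ there are $\delta_0>0$ and $N_0$, depending only on $C_0$ and $K$, such that for every $\xi$ as above (with this $C_0$), every $R\ge R_0$, every $n\ge N_0$, every cover as above, and all $\alpha,\beta,\delta$ with $$K^{-1}\delta^{3/2}\le\alpha\le K\delta^{3/2},\qquad K^{-1}\delta^{3/4}\le\beta\le K\delta^{3/4},\qquad n^{-2/5}<\delta\le\delta_0,$$ we have $$\mathbf P\big(\mathbf v_{P_n}\in\mathcal E_e\big)\le e^{-c\,\delta^8 n}.$$ -/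

import Mathlib

open MeasureTheory ProbabilityTheory


namespace RandomTrig

noncomputable section

/-- The random trigonometric polynomial with (unscaled) coefficient vector
`v = (a_1, …, a_n, b_1, …, b_n)`; `a_{k+1}` is `v (Sum.inl k)` and `b_{k+1}` is `v (Sum.inr k)`. -/
def trigPoly {n : ℕ} (v : Fin n ⊕ Fin n → ℝ) (x : ℝ) : ℝ :=
  1 / Real.sqrt n *
    ∑ k : Fin n, (v (Sum.inl k) * Real.cos (((k : ℕ) + 1 : ℝ) * x) +
      v (Sum.inr k) * Real.sin (((k : ℕ) + 1 : ℝ) * x))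

/-- The open interval with midpoint `y` and length `ℓ`. -/
def openInterval (y ℓ : ℝ) : Set ℝ := Set.Ioo (y - ℓ / 2) (y + ℓ / 2)

/-- The `N` open intervals of length `R / n` with midpoints `y 0, …, y (N - 1)` cover the circle
`ℝ / 2πℤ`, and their number is `2πn / R` up to rounding (a cover has at least `2πn / R` members). -/
structure IsCover (n : ℕ) (R : ℝ) {N : ℕ} (y : Fin N → ℝ) : Prop where
  card_le : (N : ℝ) ≤ 2 * Real.pi * n / R + 1
  covers : ∀ x : ℝ, ∃ i : Fin N, ∃ k : ℤ, x + 2 * Real.pi * k ∈ openInterval (y i) (R / n)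

/-- The interval `I` with midpoint `y` and length `R / n` is stable for `f`: no point of the
concentric interval `3I`, of length `3R / n`, has both `|f| ≤ α` and `|f'| ≤ βn`. -/
def IsStableInterval (n : ℕ) (R α β : ℝ) (f : ℝ → ℝ) (y : ℝ) : Prop :=
  ¬ ∃ x ∈ openInterval y (3 * R / n), |f x| ≤ α ∧ |deriv f x| ≤ β * n

/-- `f` is exceptional: at least `δn` of the intervals with midpoints `y i` are unstable. -/
def IsExceptional (n : ℕ) (R α β δ : ℝ) {N : ℕ} (y : Fin N → ℝ) (f : ℝ → ℝ) : Prop :=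
  δ * n ≤ (Set.ncard {i : Fin N | ¬ IsStableInterval n R α β f (y i)} : ℝ)

/-- The set of the coefficient vectors of exceptional trigonometric polynomials. -/
def exceptionalSet (n : ℕ) (R α β δ : ℝ) {N : ℕ} (y : Fin N → ℝ) : Set (Fin n ⊕ Fin n → ℝ) :=
  {v | IsExceptional n R α β δ y (trigPoly v)}

/-- The entropy `E(g log g) - E(g) log E(g)` of a nonnegative function (with `0 log 0 = 0`). -/
def entropy (ν : Measure ℝ) (g : ℝ → ℝ) : ℝ :=
  (∫ x, g x * Real.log (g x) ∂ν) - (∫ x, g x ∂ν) * Real.log (∫ x, g x ∂ν)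

open scoped ContDiff in
/-- The logarithmic Sobolev inequality with parameter `C₀` for a law `ν` on the line. -/
def LogSobolev (ν : Measure ℝ) (C₀ : ℝ) : Prop :=
  ∀ f : ℝ → ℝ, ContDiff ℝ ∞ f → HasCompactSupport f →
    entropy ν (fun x => f x ^ 2) ≤ C₀ * ∫ x, (deriv f x) ^ 2 ∂ν

/-- `X ≍ Y` with implied constant `K`. -/
def Comparable (K X Y : ℝ) : Prop := X ≤ K * Y ∧ Y ≤ K * X

end

end RandomTrig

/-! Write f for the polynomial and call f, f'/n, f''/n² its normalized derivatives. The number of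
unstable intervals is not a regular function of the coefficients, so it is replaced by a smooth
functional, `detector`: the integral over a period of the product of Gaussian cut-offs of f/b² and
f'/(nb) with the weight √(1 + (f''/n²)²). It is used at the scale b = ε√δ with a small absolute ε.
Once δ is small, b² and b dominate the α and β of the theorem.

Lower bound. Near a point with |f| ≤ b² and |f'| ≤ bn, a window of length b/n contributes at least a
constant times b/n. Either |f'| stays below 2bn and the cut-offs are bounded below on the whole
window, or f' changes by bn within it and the integral of |f''| pays for the lost length. No uniform
bound on f'' is needed. Since the cover has bounded multiplicity, an exceptional polynomial has a
detector of at least κδb (`le_detector_of_isExceptional`).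

Mean. The two cut-offs confine (f, f'/n) to a region of area about b³, and the expected detector is
O(b³) plus an error. This is a Fourier argument: a Gaussian cut-off is a characteristic function,
the third moment of ξ gives decay of the characteristic functions near 0, and a Gaussian eighth
moment covers the remaining frequencies. The error is harmless because δ > n^(-2/5). As b³ = ε²δb, a
small ε puts the mean below an eighth of the lower bound (`StdLaw.integral_detector_le_threshold`).

Concentration. By orthogonality the squared gradient of the detector is O((1 + |v|²/n)/(b⁴n))
(`sum_detectorDeriv_sq_le`). The entropy method (tensorization, then Herbst) turns this into
Gaussian tails at deviation δb. Under a logarithmic Sobolev inequality it is applied to the detector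
divided by 1 + |v|²/n, whose gradient is bounded everywhere, and to a bounded function of |v|²/n;
the detector exponent has order δ⁵n. For bounded coefficients a modified inequality with
oscillations replaces the gradient, and the second-order cost of finite jumps leaves order δ⁷n. For
small δ both beat δ⁸n with room for every constant, so c does not depend on C₀ or K. When δ⁸n ≤ 1,
Markov's inequality is enough. -/

namespace RandomTrig

/-! ### Entropy on general probability spaces -/

/-- The entropy `E(g log g) - E(g) log E(g)` on an arbitrary measure space. -/
noncomputable def ent {α : Type*} [MeasurableSpace α] (μ : Measure α) (g : α → ℝ) : ℝ :=
  (∫ x, g x * Real.log (g x) ∂μ) - (∫ x, g x ∂μ) * Real.log (∫ x, g x ∂μ)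

/-- A measurable function with values in a compact subinterval of `(0, ∞)`. -/
structure BddPos {α : Type*} [MeasurableSpace α] (g : α → ℝ) (a b : ℝ) : Prop where
  meas : Measurable g
  pos : 0 < a
  lower : ∀ x, a ≤ g x
  upper : ∀ x, g x ≤ b

section
variable {α β : Type*} [MeasurableSpace α] [MeasurableSpace β]

theorem integrable_of_abs_le {μ : Measure α} [IsFiniteMeasure μ] {f : α → ℝ} (hf : Measurable f)
    {C : ℝ} (h : ∀ x, |f x| ≤ C) : Integrable f μ :=
  Integrable.of_bound hf.aestronglyMeasurable C (Filter.Eventually.of_forall h)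

namespace BddPos
variable {g : α → ℝ} {a b : ℝ}

theorem gpos (h : BddPos g a b) (x : α) : 0 < g x := h.pos.trans_le (h.lower x)

theorem abs_le (h : BddPos g a b) (x : α) : |g x| ≤ b := by
  rw [abs_of_pos (h.gpos x)]; exact h.upper x

theorem abs_log_le (h : BddPos g a b) (x : α) : |Real.log (g x)| ≤ |Real.log a| + |Real.log b| := by
  have h1 := Real.log_le_log h.pos (h.lower x)
  have h2 := Real.log_le_log (h.gpos x) (h.upper x)
  have := abs_nonneg (Real.log a); have := abs_nonneg (Real.log b)
  have := neg_abs_le (Real.log a); have := le_abs_self (Real.log b)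
  rw [_root_.abs_le]; constructor <;> linarith

theorem abs_mul_log_le (h : BddPos g a b) (x : α) :
    |g x * Real.log (g x)| ≤ b * (|Real.log a| + |Real.log b|) := by
  rw [abs_mul]
  exact mul_le_mul (h.abs_le x) (h.abs_log_le x) (abs_nonneg _) ((abs_nonneg _).trans (h.abs_le x))

theorem integrable (h : BddPos g a b) (μ : Measure α) [IsFiniteMeasure μ] : Integrable g μ :=
  integrable_of_abs_le h.meas h.abs_le

theorem integrable_mul_log (h : BddPos g a b) (μ : Measure α) [IsFiniteMeasure μ] :
    Integrable (fun x => g x * Real.log (g x)) μ :=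
  integrable_of_abs_le (h.meas.mul h.meas.log) h.abs_mul_log_le

theorem integral_mem (h : BddPos g a b) (μ : Measure α) [IsProbabilityMeasure μ] :
    a ≤ ∫ x, g x ∂μ ∧ ∫ x, g x ∂μ ≤ b := by
  constructor
  · simpa using integral_mono (integrable_const a) (h.integrable μ) h.lower
  · simpa using integral_mono (h.integrable μ) (integrable_const b) h.upper

theorem comp (h : BddPos g a b) {φ : β → α} (hφ : Measurable φ) :
    BddPos (fun y => g (φ y)) a b :=
  ⟨h.meas.comp hφ, h.pos, fun _ => h.lower _, fun _ => h.upper _⟩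

theorem exp {u : α → ℝ} (hu : Measurable u) {B : ℝ} (h : ∀ x, |u x| ≤ B) :
    BddPos (fun x => Real.exp (u x)) (Real.exp (-B)) (Real.exp B) :=
  ⟨hu.exp, Real.exp_pos _, fun x => Real.exp_le_exp.2 (_root_.abs_le.1 (h x)).1,
    fun x => Real.exp_le_exp.2 (_root_.abs_le.1 (h x)).2⟩

end BddPos

/-- Young's inequality for the conjugate pair a log a - a and exp b, which is 1 + x ≤ exp x at x = b
- log a. -/
theorem gibbs_pointwise {a b : ℝ} (ha : 0 < a) : a * b ≤ a * Real.log a - a + Real.exp b := by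
  have h := Real.add_one_le_exp (b - Real.log a)
  rw [Real.exp_sub, Real.exp_log ha, le_div_iff₀ ha] at h
  nlinarith

/-- The Gibbs variational inequality. -/
theorem integral_mul_le_ent {μ : Measure α} [IsProbabilityMeasure μ] {g k : α → ℝ} {a b B : ℝ}
    (hg : BddPos g a b) (hk : Measurable k) (hB : ∀ x, |k x| ≤ B)
    (h1 : ∫ x, Real.exp (k x) ∂μ = 1) : ∫ x, g x * k x ∂μ ≤ ent μ g := by
  set m := ∫ x, g x ∂μ with hm
  have hm0 : 0 < m := hg.pos.trans_le (hg.integral_mem μ).1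
  have he := (BddPos.exp hk hB).integrable μ
  have hgk : Integrable (fun x => g x * k x) μ := by
    refine integrable_of_abs_le (hg.meas.mul hk) (C := b * B) fun x => ?_
    rw [abs_mul]
    exact mul_le_mul (hg.abs_le x) (hB x) (abs_nonneg _) ((abs_nonneg _).trans (hg.abs_le x))
  have key : ∀ x, g x * k x ≤ (g x * Real.log (g x) - (1 + Real.log m) * g x) + m * Real.exp (k x) := by
    intro x
    have := gibbs_pointwise (b := k x + Real.log m) (hg.gpos x)
    rw [Real.exp_add, Real.exp_log hm0] at this
    nlinarith
  have i1 := hg.integrable_mul_log μ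
  have i2 := (hg.integrable μ).const_mul (1 + Real.log m)
  have := integral_mono hgk ((i1.sub i2).add (he.const_mul m)) key
  rw [integral_add' (i1.sub i2) (he.const_mul m), integral_sub' i1 i2, integral_const_mul,
    integral_const_mul, h1, ← hm] at this
  unfold ent
  rw [← hm]
  linarith

/-- The entropy is at most the relative entropy with respect to any constant. -/
theorem ent_le_integral_const {μ : Measure α} [IsProbabilityMeasure μ] {g : α → ℝ} {a b c : ℝ}
    (hg : BddPos g a b) (hc : 0 < c) :
    ent μ g ≤ ∫ x, (g x * Real.log (g x) - (1 + Real.log c) * g x + c) ∂μ := by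
  set m := ∫ x, g x ∂μ with hm
  have hm0 : 0 < m := hg.pos.trans_le (hg.integral_mem μ).1
  have i1 := hg.integrable_mul_log μ
  have i2 := (hg.integrable μ).const_mul (1 + Real.log c)
  have := gibbs_pointwise (b := Real.log c) hm0
  rw [Real.exp_log hc] at this
  rw [integral_add (f := fun x => g x * Real.log (g x) - (1 + Real.log c) * g x) (i1.sub i2)
    (integrable_const c), integral_sub i1 i2, integral_const_mul, ← hm]
  simp only [integral_const, probReal_univ, one_smul]
  unfold ent
  rw [← hm]
  linarith

theorem integrable_ent_slice {μ : Measure α} {ν : Measure β} [IsProbabilityMeasure μ]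
    [IsProbabilityMeasure ν] {h : α × β → ℝ} {a b : ℝ} (hh : BddPos h a b) :
    Integrable (fun x => ent ν (fun y => h (x, y))) μ := by
  have hx : ∀ x, BddPos (fun y => h (x, y)) a b := fun x => hh.comp (by fun_prop)
  have bG : BddPos (fun x => ∫ y, h (x, y) ∂ν) a b :=
    ⟨(hh.meas.stronglyMeasurable.integral_prod_right').measurable, hh.pos,
      fun x => ((hx x).integral_mem ν).1, fun x => ((hx x).integral_mem ν).2⟩
  exact (hh.integrable_mul_log (μ.prod ν)).integral_prod_left.sub (bG.integrable_mul_log μ)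

/-- The chain rule splits the entropy into the mean entropy of the slices in y and the entropy of
the marginal `G`. For the latter, the test function `k` = log(G/m) is optimal for `G` and admissible
for every slice in x, so the Gibbs inequality averaged over y bounds it. -/
theorem ent_prod_le {μ : Measure α} {ν : Measure β} [IsProbabilityMeasure μ]
    [IsProbabilityMeasure ν] {h : α × β → ℝ} {a b : ℝ} (hh : BddPos h a b) :
    ent (μ.prod ν) h ≤ (∫ x, ent ν (fun y => h (x, y)) ∂μ) + ∫ y, ent μ (fun x => h (x, y)) ∂ν := by
  have hx : ∀ x, BddPos (fun y => h (x, y)) a b := fun x => hh.comp (by fun_prop)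
  have hy : ∀ y, BddPos (fun x => h (x, y)) a b := fun y => hh.comp (by fun_prop)
  set G : α → ℝ := fun x => ∫ y, h (x, y) ∂ν with hG
  set G' : β → ℝ := fun y => ∫ x, h (x, y) ∂μ with hG'
  have bG : BddPos G a b :=
    ⟨(hh.meas.stronglyMeasurable.integral_prod_right').measurable, hh.pos,
      fun x => ((hx x).integral_mem ν).1, fun x => ((hx x).integral_mem ν).2⟩
  have bG' : BddPos G' a b :=
    ⟨(hh.meas.stronglyMeasurable.integral_prod_left').measurable, hh.pos,
      fun x => ((hy x).integral_mem μ).1, fun x => ((hy x).integral_mem μ).2⟩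
  have iA := hh.integrable_mul_log (μ.prod ν)
  have iH := hh.integrable (μ.prod ν)
  have e1 : ent (μ.prod ν) h = (∫ x, ent ν (fun y => h (x, y)) ∂μ) + ent μ G := by
    unfold ent
    rw [integral_prod _ iA, integral_prod _ iH, integral_sub iA.integral_prod_left
      (bG.integrable_mul_log μ)]
    ring
  rw [e1]
  gcongr
  set m := ∫ x, G x ∂μ with hm
  have hm0 : 0 < m := bG.pos.trans_le (bG.integral_mem μ).1
  set k : α → ℝ := fun x => Real.log (G x) - Real.log m with hk
  have mk : Measurable k := bG.meas.log.sub measurable_const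
  have bk : ∀ x, |k x| ≤ |Real.log a| + |Real.log b| + |Real.log m| := fun x =>
    (abs_sub _ _).trans (by gcongr; exact bG.abs_log_le x)
  have ek : ∫ x, Real.exp (k x) ∂μ = 1 := by
    have : ∀ x, Real.exp (k x) = G x / m := fun x => by
      rw [hk]; simp only; rw [Real.exp_sub, Real.exp_log (bG.gpos x), Real.exp_log hm0]
    simp_rw [this]
    rw [integral_div, ← hm, div_self hm0.ne']
  have ihk : Integrable (fun p : α × β => h p * k p.1) (μ.prod ν) := by
    refine integrable_of_abs_le (hh.meas.mul (mk.comp measurable_fst))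
      (C := b * (|Real.log a| + |Real.log b| + |Real.log m|)) fun x => ?_
    rw [abs_mul]
    exact mul_le_mul (hh.abs_le x) (bk _) (abs_nonneg _) ((abs_nonneg _).trans (hh.abs_le x))
  have e2 : ent μ G = ∫ y, ∫ x, h (x, y) * k x ∂μ ∂ν := by
    rw [← integral_prod_symm _ ihk, integral_prod _ ihk]
    simp only [integral_mul_const]
    unfold ent
    rw [← hm]
    have : ∀ x, (∫ y, h (x, y) ∂ν) * k x = G x * Real.log (G x) - G x * Real.log m := fun x => by
      rw [hk]; simp only [hG]; ring
    simp_rw [this]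
    rw [integral_sub (bG.integrable_mul_log μ) ((bG.integrable μ).mul_const _), integral_mul_const]
  rw [e2]
  refine integral_mono ihk.integral_prod_right ?_ fun y => integral_mul_le_ent (hy y) mk bk ek
  unfold ent
  exact iA.integral_prod_right.sub (bG'.integrable_mul_log ν)

theorem ent_map {μ : Measure α} {ν : Measure β} {e : α → β} (he : MeasurePreserving e μ ν)
    {g : β → ℝ} (hg : Measurable g) : ent ν g = ent μ (fun x => g (e x)) := by
  unfold ent
  have h : AEStronglyMeasurable (fun x => g x * Real.log (g x)) (Measure.map e μ) :=
    (hg.mul hg.log).aestronglyMeasurable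
  rw [← he.map_eq, integral_map he.measurable.aemeasurable h,
    integral_map he.measurable.aemeasurable hg.aestronglyMeasurable]

end

/-! ### Tensorization of the entropy and resampling of one coordinate -/

theorem ent_pi_fin_le (ν : Measure ℝ) [IsProbabilityMeasure ν] {a b : ℝ} (m : ℕ) :
    ∀ g : (Fin m → ℝ) → ℝ, BddPos g a b →
    ent (Measure.pi fun _ : Fin m => ν) g ≤
      ∑ j, ∫ v, ent ν (fun t => g (Function.update v j t)) ∂(Measure.pi fun _ : Fin m => ν) := by
  induction m with
  | zero =>
    intro g hg
    have : g = fun _ => g default := by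
      funext x; rw [Subsingleton.elim x default]
    rw [this]
    simp [ent]
  | succ m ih =>
    intro g hg
    set μ := Measure.pi fun _ : Fin m => ν with hμ
    set c : ℝ × (Fin m → ℝ) → (Fin (m + 1) → ℝ) := fun p => Fin.cons p.1 p.2 with hc
    have mp : MeasurePreserving c (ν.prod μ) (Measure.pi fun _ : Fin (m + 1) => ν) := by
      have := (measurePreserving_piFinSuccAbove (fun _ : Fin (m + 1) => ν) 0).symm
      convert this using 1
      funext p
      simp [hc, MeasurableEquiv.piFinSuccAbove, Fin.insertNthEquiv]
    have hgc : BddPos (fun p => g (c p)) a b := hg.comp mp.measurable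
    have mpi : ∀ F : (Fin (m + 1) → ℝ) → ℝ, Measurable F →
        ∫ v, F v ∂(Measure.pi fun _ : Fin (m + 1) => ν) = ∫ p, F (c p) ∂(ν.prod μ) := by
      intro F hF
      rw [← mp.map_eq, integral_map mp.measurable.aemeasurable hF.aestronglyMeasurable]
    have hent : ∀ j : Fin (m + 1), BddPos (fun q : (Fin (m + 1) → ℝ) × ℝ =>
        g (Function.update q.1 j q.2)) a b := by
      intro j
      refine hg.comp (measurable_pi_iff.2 fun i => ?_)
      by_cases h : i = j
      · subst h; simpa using measurable_snd
      · simp only [Function.update_of_ne h]; fun_prop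
    have ment : ∀ j : Fin (m + 1), Measurable fun v => ent ν (fun t => g (Function.update v j t)) := by
      intro j
      have h1 := (hent j)
      have a1 : Measurable fun v : Fin (m + 1) → ℝ => ∫ t, g (Function.update v j t) ∂ν :=
        (h1.meas.stronglyMeasurable.integral_prod_right').measurable
      have a2 : Measurable fun v : Fin (m + 1) → ℝ => ∫ t, g (Function.update v j t) *
          Real.log (g (Function.update v j t)) ∂ν :=
        ((h1.meas.mul h1.meas.log).stronglyMeasurable.integral_prod_right').measurable
      exact a2.sub (a1.mul a1.log)
    have bent : ∀ (j : Fin (m + 1)) v, |ent ν (fun t => g (Function.update v j t))| ≤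
        b * (|Real.log a| + |Real.log b|) + b * (|Real.log a| + |Real.log b|) := by
      intro j v
      have h1 : BddPos (fun t => g (Function.update v j t)) a b := (hent j).comp (φ := fun t => (v, t)) (by fun_prop)
      unfold ent
      refine (abs_sub _ _).trans (add_le_add ?_ ?_)
      · have := norm_integral_le_of_norm_le_const (μ := ν)
          (f := fun t => g (Function.update v j t) * Real.log (g (Function.update v j t)))
          (Filter.Eventually.of_forall h1.abs_mul_log_le)
        simpa using this
      · have h2 := h1.integral_mem ν
        exact BddPos.abs_mul_log_le (g := fun _ : Unit => ∫ t, g (Function.update v j t) ∂ν)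
          ⟨measurable_const, hg.pos, fun _ => h2.1, fun _ => h2.2⟩ ()
    have ient : ∀ j : Fin (m + 1), Integrable (fun p => ent ν (fun t => g (Function.update (c p) j t)))
        (ν.prod μ) := fun j => integrable_of_abs_le ((ment j).comp mp.measurable) fun p => bent j _
    rw [ent_map mp hg.meas]
    refine (ent_prod_le hgc).trans ?_
    rw [Fin.sum_univ_succ, add_comm]
    refine add_le_add ?_ ?_
    · rw [mpi _ (ment 0), integral_prod _ (ient 0)]
      simp [hc, Fin.update_cons_zero]
    · have : ∀ j : Fin m, ∫ v, ent ν (fun t => g (Function.update v j.succ t))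
          ∂(Measure.pi fun _ : Fin (m + 1) => ν) =
          ∫ x, ∫ w, ent ν (fun t => g (Fin.cons x (Function.update w j t))) ∂μ ∂ν := by
        intro j
        rw [mpi _ (ment _), integral_prod _ (ient _)]
        simp [hc, Fin.cons_update]
      simp_rw [this]
      rw [← integral_finsetSum]
      · exact integral_mono (integrable_ent_slice hgc)
          (integrable_finsetSum _ fun j _ => by
            have := (ient j.succ).integral_prod_left
            simpa [hc, ← Fin.cons_update] using this)
          fun x => ih _ (hgc.comp (φ := fun w => (x, w)) (by fun_prop))
      · intro j _
        have := (ient j.succ).integral_prod_left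
        simpa [hc, ← Fin.cons_update] using this

section
variable {ι : Type*} [Fintype ι] [DecidableEq ι]

/-- Tensorization of the entropy. -/
theorem ent_pi_le (ν : Measure ℝ) [IsProbabilityMeasure ν] {a b : ℝ} (g : (ι → ℝ) → ℝ)
    (hg : BddPos g a b) :
    ent (Measure.pi fun _ : ι => ν) g ≤
      ∑ j, ∫ v, ent ν (fun t => g (Function.update v j t)) ∂(Measure.pi fun _ : ι => ν) := by
  let e := (Fintype.equivFin ι).symm
  have mp := measurePreserving_piCongrLeft (fun _ : ι => ν) e
  set c : (Fin (Fintype.card ι) → ℝ) → (ι → ℝ) := fun w i => w (e.symm i) with hc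
  have hcc : ⇑(MeasurableEquiv.piCongrLeft (fun _ : ι => ℝ) e) = c := by
    funext w i
    simp [hc, MeasurableEquiv.coe_piCongrLeft, Equiv.piCongrLeft_apply]
  have mp' : MeasurePreserving c (Measure.pi fun _ => ν) (Measure.pi fun _ : ι => ν) := by
    rw [← hcc]; exact mp
  rw [ent_map mp' hg.meas]
  refine (ent_pi_fin_le ν _ _ (hg.comp mp'.measurable)).trans ?_
  rw [← e.sum_comp]
  refine le_of_eq (Finset.sum_congr rfl fun j _ => ?_)
  rw [← mp.integral_comp' (g := fun v => ent ν (fun t => g (Function.update v (e j) t)))]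
  refine integral_congr_ae (Filter.Eventually.of_forall fun w => ?_)
  simp only [hcc]
  congr 1
  funext t
  congr 1
  funext i
  simp only [hc, Function.update_apply]
  by_cases h : i = e j <;> simp [h, Equiv.symm_apply_eq]

/-- Replacing a coordinate by an independent copy preserves the product law. This turns the averaged
one-coordinate bounds of the tensorization back into integrals over the product space, where they
can be summed pointwise over the coordinates. -/
theorem measurePreserving_update (ν : Measure ℝ) [IsProbabilityMeasure ν] (j : ι) :
    MeasurePreserving (fun p : (ι → ℝ) × ℝ => Function.update p.1 j p.2)
      ((Measure.pi fun _ : ι => ν).prod ν) (Measure.pi fun _ : ι => ν) := by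
  have hm : Measurable (fun p : (ι → ℝ) × ℝ => Function.update p.1 j p.2) := by
    refine measurable_pi_iff.2 fun i => ?_
    by_cases h : i = j
    · subst h; simpa using measurable_snd
    · simp only [Function.update_of_ne h]; fun_prop
  refine ⟨hm, (Measure.pi_eq fun s hs => ?_).symm⟩
  rw [Measure.map_apply hm (MeasurableSet.univ_pi hs)]
  have : (fun p : (ι → ℝ) × ℝ => Function.update p.1 j p.2) ⁻¹' (Set.univ.pi s) =
      (Set.univ.pi (Function.update s j Set.univ)) ×ˢ s j := by
    ext p
    simp only [Set.mem_preimage, Set.mem_pi, Set.mem_univ, true_implies, Set.mem_prod]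
    constructor
    · intro h
      refine ⟨fun i => ?_, by simpa using h j⟩
      by_cases hi : i = j
      · subst hi; simp
      · simpa [hi] using h i
    · rintro ⟨h1, h2⟩ i
      by_cases hi : i = j
      · subst hi; simpa using h2
      · simpa [hi] using h1 i
  rw [this, Measure.prod_prod, Measure.pi_pi]
  rw [← Finset.prod_erase_mul _ _ (Finset.mem_univ j),
    ← Finset.prod_erase_mul _ (fun i => ν (s i)) (Finset.mem_univ j)]
  simp only [Function.update_self, measure_univ, mul_one]
  congr 1
  refine Finset.prod_congr rfl fun i hi => ?_
  rw [Function.update_of_ne (Finset.ne_of_mem_erase hi)]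

end

/-! ### From entropy bounds to Gaussian concentration -/

section
variable {α : Type*} [MeasurableSpace α]

/-- Herbst's argument. -/
theorem integral_exp_le_of_ent_le {μ : Measure α} [IsProbabilityMeasure μ] {Ψ : α → ℝ}
    (hΨ : Measurable Ψ) {B V : ℝ} (hB : ∀ x, |Ψ x| ≤ B)
    (h : ∀ l : ℝ, 0 < l → ent μ (fun x => Real.exp (l * Ψ x)) ≤
      l ^ 2 * V * ∫ x, Real.exp (l * Ψ x) ∂μ) {l : ℝ} (hl : 0 < l) :
    ∫ x, Real.exp (l * Ψ x) ∂μ ≤ Real.exp (l * (∫ x, Ψ x ∂μ) + l ^ 2 * V) := by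
  have hint : ∀ s : ℝ, Integrable (fun x => Real.exp (s * Ψ x)) μ := fun s =>
    (BddPos.exp (hΨ.const_mul s) (B := |s| * B) fun x => by
      rw [abs_mul]; exact mul_le_mul_of_nonneg_left (hB x) (abs_nonneg s)).integrable μ
  have hset : integrableExpSet Ψ μ = Set.univ := by
    ext s; simpa [integrableExpSet] using hint s
  have hder : ∀ s, HasDerivAt (mgf Ψ μ) (∫ x, Ψ x * Real.exp (s * Ψ x) ∂μ) s := fun s =>
    hasDerivAt_mgf (by simp [hset])
  have hpos : ∀ s, 0 < mgf Ψ μ s := fun s => mgf_pos (hint s)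
  -- The entropy hypothesis at s, divided by s² times the moment generating function, says precisely
  -- that K' ≤ 0.
  set K : ℝ → ℝ := fun s => Real.log (mgf Ψ μ s) / s - s * V with hK
  have hlog : ∀ s, HasDerivAt (fun s => Real.log (mgf Ψ μ s))
      ((∫ x, Ψ x * Real.exp (s * Ψ x) ∂μ) / mgf Ψ μ s) s := fun s => (hder s).log (hpos s).ne'
  have hKd : ∀ s, 0 < s → HasDerivAt K
      (((∫ x, Ψ x * Real.exp (s * Ψ x) ∂μ) / mgf Ψ μ s * s - Real.log (mgf Ψ μ s) * 1) / s ^ 2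
        - 1 * V) s := fun s hs =>
    ((hlog s).div (hasDerivAt_id s) hs.ne').sub ((hasDerivAt_id s).mul_const V)
  have hanti : AntitoneOn K (Set.Ioi 0) := by
    refine antitoneOn_of_deriv_nonpos (convex_Ioi 0)
      (fun s hs => (hKd s hs).continuousAt.continuousWithinAt)
      (fun s hs => (hKd s (by simpa using hs)).differentiableAt.differentiableWithinAt) fun s hs => ?_
    have hs : 0 < s := by simpa using hs
    rw [(hKd s hs).deriv]
    have h1 := h s hs
    unfold ent at h1
    simp only [Real.log_exp] at h1
    have e : ∫ x, Real.exp (s * Ψ x) * (s * Ψ x) ∂μ = s * ∫ x, Ψ x * Real.exp (s * Ψ x) ∂μ := by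
      rw [← integral_const_mul]; congr 1; funext x; ring
    rw [e] at h1
    have hp := hpos s
    have hm : mgf Ψ μ s = ∫ x, Real.exp (s * Ψ x) ∂μ := rfl
    rw [← hm] at h1
    set A := ∫ x, Ψ x * Real.exp (s * Ψ x) ∂μ
    rw [sub_nonpos, div_le_iff₀ (by positivity), sub_le_iff_le_add, div_mul_eq_mul_div,
      div_le_iff₀ hp]
    nlinarith
  -- At 0 the quotient in `K` is a difference quotient of the logarithm of the moment generating
  -- function, whose derivative there is the mean.
  have h0 : Filter.Tendsto K (nhdsWithin 0 (Set.Ioi 0)) (nhds (∫ x, Ψ x ∂μ)) := by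
    have t1 := (hlog 0).tendsto_slope_zero_right
    have t2 : Filter.Tendsto (fun s : ℝ => s * V) (nhdsWithin 0 (Set.Ioi 0)) (nhds (0 * V)) :=
      ((continuous_id.mul continuous_const).tendsto 0).mono_left nhdsWithin_le_nhds
    have t3 := t1.sub t2
    simp only [zero_add, mgf_zero', probReal_univ, Real.log_one, sub_zero, zero_mul, Real.exp_zero,
      mul_one, div_one, smul_eq_mul] at t3
    refine t3.congr fun s => ?_
    simp [hK]; ring
  have hle : K l ≤ ∫ x, Ψ x ∂μ := by
    refine ge_of_tendsto h0 ?_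
    filter_upwards [Ioc_mem_nhdsGT hl] with s hs
    exact hanti hs.1 (Set.mem_Ioi.2 hl) hs.2
  have : Real.log (mgf Ψ μ l) ≤ l * (∫ x, Ψ x ∂μ) + l ^ 2 * V := by
    simp only [hK] at hle
    rw [sub_le_iff_le_add, div_le_iff₀ hl] at hle
    linarith
  exact (Real.log_le_iff_le_exp (hpos l)).1 this

theorem measure_ge_le_of_ent_le {μ : Measure α} [IsProbabilityMeasure μ] {Ψ : α → ℝ}
    (hΨ : Measurable Ψ) {B V : ℝ} (hV : 0 < V) (hB : ∀ x, |Ψ x| ≤ B)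
    (h : ∀ l : ℝ, 0 < l → ent μ (fun x => Real.exp (l * Ψ x)) ≤
      l ^ 2 * V * ∫ x, Real.exp (l * Ψ x) ∂μ) {r : ℝ} (hr : 0 < r) :
    μ.real {x | (∫ x, Ψ x ∂μ) + r ≤ Ψ x} ≤ Real.exp (-r ^ 2 / (4 * V)) := by
  -- The minimizer of l²V - lr in the Chernoff bound.
  set l := r / (2 * V) with hl
  have hl0 : 0 < l := by positivity
  have hint : Integrable (fun x => Real.exp (l * Ψ x)) μ :=
    (BddPos.exp (hΨ.const_mul l) (B := |l| * B) fun x => by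
      rw [abs_mul]; exact mul_le_mul_of_nonneg_left (hB x) (abs_nonneg l)).integrable μ
  refine (measure_ge_le_exp_mul_mgf _ hl0.le hint).trans ?_
  have := integral_exp_le_of_ent_le hΨ hB h hl0
  calc _ ≤ Real.exp (-l * ((∫ x, Ψ x ∂μ) + r)) * Real.exp (l * (∫ x, Ψ x ∂μ) + l ^ 2 * V) := by
        gcongr; exact this
    _ = _ := by
        rw [← Real.exp_add, hl]
        congr 1
        field_simp
        ring
end

/-- Concentration on a product space from coordinatewise entropy bounds. -/
theorem measure_pi_ge_le {ι : Type*} [Fintype ι] [DecidableEq ι] {ν : Measure ℝ}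
    [IsProbabilityMeasure ν] {Ψ : (ι → ℝ) → ℝ} (hΨ : Measurable Ψ) {B V : ℝ} (hV : 0 < V)
    (hB : ∀ v, |Ψ v| ≤ B) {D : ι → (ι → ℝ) → ℝ} (hD : ∀ j, Measurable (D j))
    (hD0 : ∀ j v, 0 ≤ D j v) (hDV : ∀ v, ∑ j, D j v ≤ V)
    (h : ∀ j v, ∀ l : ℝ, 0 < l → ent ν (fun t => Real.exp (l * Ψ (Function.update v j t))) ≤
      l ^ 2 * ∫ t, D j (Function.update v j t) * Real.exp (l * Ψ (Function.update v j t)) ∂ν)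
    {r : ℝ} (hr : 0 < r) :
    (Measure.pi fun _ : ι => ν).real
      {v | (∫ v, Ψ v ∂(Measure.pi fun _ : ι => ν)) + r ≤ Ψ v} ≤ Real.exp (-r ^ 2 / (4 * V)) := by
  set μ := Measure.pi fun _ : ι => ν with hμ
  refine measure_ge_le_of_ent_le hΨ hV hB (fun l hl => ?_) hr
  have hg : BddPos (fun v => Real.exp (l * Ψ v)) _ _ :=
    BddPos.exp (hΨ.const_mul l) (B := |l| * B) fun x => by
      rw [abs_mul]; exact mul_le_mul_of_nonneg_left (hB x) (abs_nonneg l)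
  have hDle : ∀ j v, D j v ≤ V := fun j v =>
    (Finset.single_le_sum (f := fun j => D j v) (fun i _ => hD0 i v) (Finset.mem_univ j)).trans
      (hDV v)
  have mDg : ∀ j, Measurable fun v => D j v * Real.exp (l * Ψ v) := fun j => (hD j).mul hg.meas
  have hDg : ∀ j v, |D j v * Real.exp (l * Ψ v)| ≤ V * Real.exp (|l| * B) := fun j v => by
    rw [abs_mul, abs_of_nonneg (hD0 j v)]
    exact mul_le_mul (hDle j v) (hg.abs_le v) (abs_nonneg _) hV.le
  have iDg : ∀ j, Integrable (fun v => D j v * Real.exp (l * Ψ v)) μ := fun j =>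
    integrable_of_abs_le (mDg j) (hDg j)
  refine (ent_pi_le ν _ hg).trans ?_
  calc ∑ j, ∫ v, ent ν (fun t => Real.exp (l * Ψ (Function.update v j t))) ∂μ
      ≤ ∑ j, l ^ 2 * ∫ v, D j v * Real.exp (l * Ψ v) ∂μ := by
        refine Finset.sum_le_sum fun j _ => ?_
        have mp : MeasurePreserving (fun p : (ι → ℝ) × ℝ => Function.update p.1 j p.2)
            (μ.prod ν) μ := measurePreserving_update ν j
        have ip : Integrable (fun p : (ι → ℝ) × ℝ => D j (Function.update p.1 j p.2) *
            Real.exp (l * Ψ (Function.update p.1 j p.2))) (μ.prod ν) :=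
          integrable_of_abs_le ((mDg j).comp mp.measurable) fun p => hDg j _
        have e : ∫ v, D j v * Real.exp (l * Ψ v) ∂μ = ∫ v, ∫ t, D j (Function.update v j t) *
            Real.exp (l * Ψ (Function.update v j t)) ∂ν ∂μ := by
          rw [← integral_prod _ ip]
          conv_lhs => rw [← mp.map_eq]
          rw [integral_map mp.measurable.aemeasurable (mDg j).aestronglyMeasurable]
        rw [e, ← integral_const_mul]
        exact integral_mono (integrable_ent_slice (hg.comp mp.measurable))
          (ip.integral_prod_left.const_mul _) fun v => h j v l hl
    _ = l ^ 2 * ∫ v, (∑ j, D j v) * Real.exp (l * Ψ v) ∂μ := by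
        simp_rw [Finset.sum_mul]
        rw [integral_finsetSum _ fun j _ => iDg j, Finset.mul_sum]
    _ ≤ l ^ 2 * ∫ v, V * Real.exp (l * Ψ v) ∂μ := by
        refine mul_le_mul_of_nonneg_left (integral_mono ?_ ((hg.integrable μ).const_mul V) fun v =>
          mul_le_mul_of_nonneg_right (hDV v) (Real.exp_pos _).le) (sq_nonneg l)
        simp_rw [Finset.sum_mul]
        exact integrable_finsetSum _ fun j _ => iDg j
    _ = _ := by rw [integral_const_mul]; ring

/-- Modified logarithmic Sobolev inequality for an arbitrary law, with the oscillation in the place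
of the gradient. -/
theorem ent_exp_le_of_osc {ν : Measure ℝ} [IsProbabilityMeasure ν] {u D : ℝ → ℝ}
    (hu : Measurable u) {B : ℝ} (hB : ∀ x, |u x| ≤ B) (hD : Measurable D) {C : ℝ}
    (hC : ∀ x, |D x| ≤ C) (h : ∀ x y, (u x - u y) ^ 2 ≤ D x) {l : ℝ} (hl : 0 < l) :
    ent ν (fun x => Real.exp (l * u x)) ≤ l ^ 2 * ∫ x, D x * Real.exp (l * u x) ∂ν := by
  have hg : BddPos (fun v => Real.exp (l * u v)) _ _ :=
    BddPos.exp (hu.const_mul l) (B := |l| * B) fun x => by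
      rw [abs_mul]; exact mul_le_mul_of_nonneg_left (hB x) (abs_nonneg l)
  set a := sInf (Set.range u) with ha
  have hbdd : BddBelow (Set.range u) := ⟨-B, by rintro _ ⟨x, rfl⟩; exact (abs_le.1 (hB x)).1⟩
  have ha1 : ∀ x, a ≤ u x := fun x => csInf_le hbdd ⟨x, rfl⟩
  have ha2 : ∀ x, (u x - a) ^ 2 ≤ D x := fun x => by
    have hD0 : 0 ≤ D x := (sq_nonneg _).trans (h x x)
    have : u x - Real.sqrt (D x) ≤ a := by
      refine le_csInf (Set.range_nonempty u) ?_
      rintro _ ⟨y, rfl⟩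
      have := Real.le_sqrt_of_sq_le (h x y)
      linarith
    have h2 : u x - a ≤ Real.sqrt (D x) := by linarith
    calc (u x - a) ^ 2 ≤ Real.sqrt (D x) ^ 2 := by
          have := ha1 x
          gcongr
      _ = D x := Real.sq_sqrt hD0
  -- With the constant exp(la), a the infimum of u, the integrand is exp(lu)(y - 1 + exp(-y)) for y
  -- = l(u - a) ≥ 0, hence at most y² exp(lu). The squared oscillation is thus weighted at the same
  -- point as the exponential, as the summation over coordinates requires.
  refine (ent_le_integral_const hg (Real.exp_pos (l * a))).trans ?_
  rw [← integral_const_mul]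
  have iD : Integrable (fun x => D x * Real.exp (l * u x)) ν := by
    refine integrable_of_abs_le (hD.mul hg.meas) (C := C * Real.exp (|l| * B)) fun x => ?_
    rw [abs_mul]
    exact mul_le_mul (hC x) (hg.abs_le x) (abs_nonneg _) ((abs_nonneg _).trans (hC x))
  refine integral_mono ?_ (iD.const_mul _) fun x => ?_
  · exact ((hg.integrable_mul_log ν).sub ((hg.integrable ν).const_mul _)).add (integrable_const _)
  · simp only [Real.log_exp]
    set y := l * (u x - a) with hy
    have hy0 : 0 ≤ y := mul_nonneg hl.le (sub_nonneg.2 (ha1 x))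
    have e : Real.exp (l * a) = Real.exp (l * u x) * Real.exp (-y) := by
      rw [← Real.exp_add]; congr 1; rw [hy]; ring
    have hq : Real.exp (-y) ≤ 1 - y + y ^ 2 := by
      rcases le_or_gt y 1 with h1 | h1
      · have := Real.abs_exp_sub_one_sub_id_le (x := -y) (by rw [abs_neg, abs_of_nonneg hy0]; exact h1)
        have := (abs_le.1 this).2
        nlinarith
      · have : Real.exp (-y) ≤ 1 := Real.exp_le_one_iff.2 (by linarith)
        nlinarith
    have hE := Real.exp_pos (l * u x)
    have h3 := ha2 x
    calc _ = Real.exp (l * u x) * (y - 1 + Real.exp (-y)) := by rw [e, hy]; ring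
      _ ≤ Real.exp (l * u x) * y ^ 2 := by gcongr; linarith
      _ = l ^ 2 * ((u x - a) ^ 2 * Real.exp (l * u x)) := by rw [hy]; ring
      _ ≤ _ := by gcongr

/-! ### The logarithmic Sobolev inequality for bounded functions of class `C¹` -/

open Filter Topology in
-- Dominated convergence: t log t is continuous down to t = 0 and bounded on [0, C²], so uniform
-- bounds and pointwise limits of the functions and their derivatives suffice.
theorem entropy_sq_le_of_tendsto {ν : Measure ℝ} [IsProbabilityMeasure ν] {C₀ C : ℝ}
    {F G : ℕ → ℝ → ℝ} {f g : ℝ → ℝ} (hF : ∀ k, Continuous (F k)) (hG : ∀ k, Continuous (G k))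
    (bF : ∀ k x, |F k x| ≤ C) (bG : ∀ k x, |G k x| ≤ C)
    (tF : ∀ x, Tendsto (fun k => F k x) atTop (𝓝 (f x)))
    (tG : ∀ x, Tendsto (fun k => G k x) atTop (𝓝 (g x)))
    (h : ∀ k, entropy ν (fun x => F k x ^ 2) ≤ C₀ * ∫ x, G k x ^ 2 ∂ν) :
    entropy ν (fun x => f x ^ 2) ≤ C₀ * ∫ x, g x ^ 2 ∂ν := by
  have hC : 0 ≤ C := (abs_nonneg _).trans (bF 0 0)
  have sq_bd : ∀ {y : ℝ}, |y| ≤ C → y ^ 2 ≤ C ^ 2 := fun {y} hy => by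
    rw [← sq_abs y]; gcongr
  have t1 : Tendsto (fun k => ∫ x, G k x ^ 2 ∂ν) atTop (𝓝 (∫ x, g x ^ 2 ∂ν)) :=
    tendsto_integral_of_dominated_convergence (fun _ => C ^ 2)
      (fun k => ((hG k).pow 2).aestronglyMeasurable) (integrable_const _)
      (fun k => Eventually.of_forall fun x => by
        rw [Real.norm_of_nonneg (sq_nonneg _)]; exact sq_bd (bG k x))
      (Eventually.of_forall fun x => (tG x).pow 2)
  have t2 : Tendsto (fun k => ∫ x, F k x ^ 2 ∂ν) atTop (𝓝 (∫ x, f x ^ 2 ∂ν)) :=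
    tendsto_integral_of_dominated_convergence (fun _ => C ^ 2)
      (fun k => ((hF k).pow 2).aestronglyMeasurable) (integrable_const _)
      (fun k => Eventually.of_forall fun x => by
        rw [Real.norm_of_nonneg (sq_nonneg _)]; exact sq_bd (bF k x))
      (Eventually.of_forall fun x => (tF x).pow 2)
  obtain ⟨M, hM⟩ := (isCompact_Icc (a := (0 : ℝ)) (b := C ^ 2)).exists_bound_of_continuousOn
    Real.continuous_mul_log.continuousOn
  have t3 : Tendsto (fun k => ∫ x, F k x ^ 2 * Real.log (F k x ^ 2) ∂ν) atTop
      (𝓝 (∫ x, f x ^ 2 * Real.log (f x ^ 2) ∂ν)) :=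
    tendsto_integral_of_dominated_convergence (fun _ => M)
      (fun k => (Real.continuous_mul_log.comp ((hF k).pow 2)).aestronglyMeasurable)
      (integrable_const _)
      (fun k => Eventually.of_forall fun x => hM _ ⟨sq_nonneg _, sq_bd (bF k x)⟩)
      (Eventually.of_forall fun x => (Real.continuous_mul_log.tendsto _).comp ((tF x).pow 2))
  have t4 := (Real.continuous_mul_log.tendsto _).comp t2
  exact le_of_tendsto_of_tendsto' (t3.sub t4) (t1.const_mul C₀) h

open scoped Convolution ContDiff in
-- Mollification: convolution with a normalized bump commutes with the derivative and does not
-- increase uniform bounds.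
theorem LogSobolev.of_contDiff_one {ν : Measure ℝ} [IsProbabilityMeasure ν] {C₀ : ℝ}
    (h : LogSobolev ν C₀) {f : ℝ → ℝ} (hf : ContDiff ℝ 1 f) (hs : HasCompactSupport f) :
    entropy ν (fun x => f x ^ 2) ≤ C₀ * ∫ x, (deriv f x) ^ 2 ∂ν := by
  have hf' : Continuous (deriv f) := hf.continuous_deriv le_rfl
  obtain ⟨C1, hC1⟩ := hs.exists_bound_of_continuous hf.continuous
  obtain ⟨C2, hC2⟩ := hs.deriv.exists_bound_of_continuous hf'
  let φ : ℕ → ContDiffBump (0 : ℝ) := fun k =>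
    ⟨1 / (k + 1) / 2, 1 / (k + 1), by positivity, half_lt_self (by positivity)⟩
  have hφ : Filter.Tendsto (fun k => (φ k).rOut) Filter.atTop (nhds 0) :=
    tendsto_one_div_add_atTop_nhds_zero_nat
  have hbd : ∀ {g : ℝ → ℝ} {C : ℝ}, Continuous g → (∀ x, ‖g x‖ ≤ C) → ∀ k x,
      |((φ k).normed volume ⋆[ContinuousLinearMap.lsmul ℝ ℝ, volume] g) x| ≤ C := by
    intro g C hg hC k x
    rw [convolution_def]
    have hi : Integrable (fun t => (φ k).normed volume t * C) := (φ k).integrable_normed.mul_const C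
    have := norm_integral_le_of_norm_le (f := fun t =>
      (ContinuousLinearMap.lsmul ℝ ℝ) ((φ k).normed volume t) (g (x - t))) hi
      (Filter.Eventually.of_forall fun t => by
        simp only [ContinuousLinearMap.lsmul_apply, norm_smul]
        rw [Real.norm_of_nonneg ((φ k).nonneg_normed t)]
        exact mul_le_mul_of_nonneg_left (hC _) ((φ k).nonneg_normed t))
    rw [integral_mul_const, (φ k).integral_normed, one_mul] at this
    exact this
  have hder : ∀ k x, HasDerivAt ((φ k).normed volume ⋆[ContinuousLinearMap.lsmul ℝ ℝ, volume] f)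
      (((φ k).normed volume ⋆[ContinuousLinearMap.lsmul ℝ ℝ, volume] deriv f) x) x := fun k x =>
    hs.hasDerivAt_convolution_right _ (φ k).continuous_normed.locallyIntegrable hf x
  have hcd : ∀ (k : ℕ) {g : ℝ → ℝ}, Continuous g → ContDiff ℝ ∞
      ((φ k).normed volume ⋆[ContinuousLinearMap.lsmul ℝ ℝ, volume] g) := fun k g hg =>
    (φ k).hasCompactSupport_normed.contDiff_convolution_left _ (φ k).contDiff_normed
      hg.locallyIntegrable
  refine entropy_sq_le_of_tendsto (C := max C1 C2)
    (F := fun k => (φ k).normed volume ⋆[ContinuousLinearMap.lsmul ℝ ℝ, volume] f)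
    (G := fun k => (φ k).normed volume ⋆[ContinuousLinearMap.lsmul ℝ ℝ, volume] deriv f)
    (fun k => (hcd k hf.continuous).continuous) (fun k => (hcd k hf').continuous)
    (fun k x => (hbd hf.continuous hC1 k x).trans (le_max_left _ _))
    (fun k x => (hbd hf' hC2 k x).trans (le_max_right _ _))
    (fun x => ContDiffBump.convolution_tendsto_right_of_continuous hφ hf.continuous x)
    (fun x => ContDiffBump.convolution_tendsto_right_of_continuous hφ hf' x) fun k => ?_
  have := h _ (hcd k hf.continuous) (HasCompactSupport.convolution _ (φ k).hasCompactSupport_normed hs)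
  refine this.trans_eq ?_
  congr 2
  funext x
  rw [(hder k x).deriv]

/-- Multiplication by the cut-off χ(x/(k+1)). The additional term f χ'/(k+1) in the derivative is
bounded and tends to 0. Removing compact support makes exponentials of bounded functions admissible.
-/
theorem LogSobolev.of_bounded {ν : Measure ℝ} [IsProbabilityMeasure ν] {C₀ : ℝ}
    (h : LogSobolev ν C₀) {f : ℝ → ℝ} (hf : ContDiff ℝ 1 f) {C : ℝ} (hC : ∀ x, |f x| ≤ C)
    (hC' : ∀ x, |deriv f x| ≤ C) :
    entropy ν (fun x => f x ^ 2) ≤ C₀ * ∫ x, (deriv f x) ^ 2 ∂ν := by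
  let χ : ContDiffBump (0 : ℝ) := ⟨1, 2, by norm_num, by norm_num⟩
  have hχ : ContDiff ℝ 1 χ := χ.contDiff
  have hχs : HasCompactSupport χ := χ.hasCompactSupport
  have hχ' : Continuous (deriv χ) := hχ.continuous_deriv le_rfl
  obtain ⟨M, hM⟩ := hχs.deriv.exists_bound_of_continuous hχ'
  have hC0 : 0 ≤ C := (abs_nonneg _).trans (hC 0)
  have hM0 : 0 ≤ M := (norm_nonneg _).trans (hM 0)
  let c : ℕ → ℝ := fun k => 1 / ((k : ℝ) + 1)
  have hc0 : ∀ k, 0 < c k := fun k => by positivity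
  have hc1 : ∀ k, c k ≤ 1 := fun k => by
    rw [div_le_one (by positivity)]; linarith [(Nat.cast_nonneg k : (0 : ℝ) ≤ k)]
  have tc : Filter.Tendsto c Filter.atTop (nhds 0) := tendsto_one_div_add_atTop_nhds_zero_nat
  have hder : ∀ k x, HasDerivAt (fun x => f x * χ (c k * x))
      (deriv f x * χ (c k * x) + f x * (deriv χ (c k * x) * c k)) x := fun k x => by
    have h1 := (hf.differentiable one_ne_zero x).hasDerivAt
    have h2 := (hχ.differentiable one_ne_zero (c k * x)).hasDerivAt
    have h3 : HasDerivAt (fun x => c k * x) (c k) x := by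
      simpa using (hasDerivAt_id x).const_mul (c k)
    exact h1.mul (h2.comp x h3)
  have hf' : Continuous (deriv f) := hf.continuous_deriv le_rfl
  have hfc := hf.continuous
  have hχc : Continuous χ := χ.continuous
  have tcx : ∀ x, Filter.Tendsto (fun k => c k * x) Filter.atTop (nhds 0) := fun x => by
    simpa using tc.mul_const x
  have tχ : ∀ x, Filter.Tendsto (fun k => χ (c k * x)) Filter.atTop (nhds 1) := fun x => by
    have := (hχc.tendsto 0).comp (tcx x)
    rwa [χ.one_of_mem_closedBall (by simp [χ.rIn_pos.le])] at this
  have bχ : ∀ x, |χ x| ≤ 1 := fun x => by rw [abs_of_nonneg χ.nonneg]; exact χ.le_one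
  refine entropy_sq_le_of_tendsto (C := C + C * M)
    (F := fun k x => f x * χ (c k * x))
    (G := fun k x => deriv f x * χ (c k * x) + f x * (deriv χ (c k * x) * c k))
    (fun k => by fun_prop) (fun k => by fun_prop) (fun k x => ?_) (fun k x => ?_)
    (fun x => by simpa using (tχ x).const_mul (f x)) (fun x => ?_) fun k => ?_
  · rw [abs_mul]
    have := mul_le_mul (hC x) (bχ (c k * x)) (abs_nonneg _) hC0
    nlinarith [mul_nonneg hC0 hM0]
  · refine (abs_add_le _ _).trans ?_
    rw [abs_mul, abs_mul, abs_mul, abs_of_pos (hc0 k)]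
    have h1 := mul_le_mul (hC' x) (bχ (c k * x)) (abs_nonneg _) hC0
    have h2 := mul_le_mul (hM (c k * x)) (hc1 k) (hc0 k).le hM0
    have h3 := mul_le_mul (hC x) h2 (mul_nonneg (norm_nonneg _) (hc0 k).le) hC0
    rw [Real.norm_eq_abs] at h3
    linarith
  · have h1 := (tχ x).const_mul (deriv f x)
    have h2 := (((hχ'.tendsto 0).comp (tcx x)).mul tc).const_mul (f x)
    simpa using h1.add h2
  · have hcd : ContDiff ℝ 1 (fun x => f x * χ (c k * x)) :=
      hf.mul (hχ.comp (contDiff_const.mul contDiff_id))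
    have hcs : HasCompactSupport (fun x => f x * χ (c k * x)) := by
      refine HasCompactSupport.mul_left ?_
      exact hχs.comp_homeomorph (Homeomorph.mulLeft₀ (c k) (hc0 k).ne')
    refine (h.of_contDiff_one hcd hcs).trans_eq ?_
    congr 2
    funext x
    rw [(hder k x).deriv]

/-- The modified logarithmic Sobolev inequality. -/
theorem LogSobolev.ent_exp_le {ν : Measure ℝ} [IsProbabilityMeasure ν] {C₀ : ℝ}
    (h : LogSobolev ν C₀) {u u' : ℝ → ℝ} (hu : ∀ x, HasDerivAt u (u' x) x) (hu' : Continuous u')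
    {B L : ℝ} (hB : ∀ x, |u x| ≤ B) (hL : ∀ x, |u' x| ≤ L) (l : ℝ) :
    ent ν (fun x => Real.exp (l * u x)) ≤
      l ^ 2 * ∫ x, C₀ / 4 * u' x ^ 2 * Real.exp (l * u x) ∂ν := by
  -- Then f² = exp(lu) and f'² = (l²/4) u'² exp(lu), whence the factor C₀/4.
  set f : ℝ → ℝ := fun x => Real.exp (l / 2 * u x) with hf
  have hd : ∀ x, HasDerivAt f (Real.exp (l / 2 * u x) * (l / 2 * u' x)) x := fun x =>
    ((hu x).const_mul (l / 2)).exp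
  have hdf : deriv f = fun x => Real.exp (l / 2 * u x) * (l / 2 * u' x) :=
    funext fun x => (hd x).deriv
  have hcu : Continuous u := continuous_iff_continuousAt.2 fun x => (hu x).continuousAt
  have hcd : ContDiff ℝ 1 f := contDiff_one_iff_deriv.2
    ⟨fun x => (hd x).differentiableAt, by rw [hdf]; fun_prop⟩
  have hb : ∀ x, Real.exp (l / 2 * u x) ≤ Real.exp (|l / 2| * B) := fun x =>
    Real.exp_le_exp.2 ((le_abs_self _).trans
      (by rw [abs_mul]; exact mul_le_mul_of_nonneg_left (hB x) (abs_nonneg _)))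
  have hL0 : 0 ≤ L := (abs_nonneg _).trans (hL 0)
  set E := Real.exp (|l / 2| * B)
  have hE : 0 < E := Real.exp_pos _
  have key := h.of_bounded hcd (C := E + E * (|l / 2| * L)) (fun x => by
      simp only [hf, Real.abs_exp]
      have := hb x
      have : 0 ≤ E * (|l / 2| * L) := by positivity
      linarith) (fun x => by
      rw [hdf]; simp only
      rw [abs_mul, Real.abs_exp, abs_mul]
      have := mul_le_mul (hb x) (mul_le_mul_of_nonneg_left (hL x) (abs_nonneg (l / 2)))
        (by positivity) hE.le
      linarith)
  have e1 : (fun x => f x ^ 2) = fun x => Real.exp (l * u x) := by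
    funext x; simp only [hf]; rw [← Real.exp_nat_mul]; congr 1; push_cast; ring
  have e2 : ∀ x, deriv f x ^ 2 = l ^ 2 / 4 * (u' x ^ 2 * Real.exp (l * u x)) := fun x => by
    rw [hdf]; simp only; rw [mul_pow, ← Real.exp_nat_mul, show ((2 : ℕ) : ℝ) * (l / 2 * u x) = l * u x by
      push_cast; ring]; ring
  simp_rw [e2] at key
  rw [e1, integral_const_mul] at key
  have e3 : ∀ x, C₀ / 4 * u' x ^ 2 * Real.exp (l * u x) =
    C₀ / 4 * (u' x ^ 2 * Real.exp (l * u x)) := fun x => by ring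
  simp_rw [e3]
  rw [integral_const_mul]
  change entropy ν _ ≤ _
  linarith

/-- Third moments are controlled by the logarithmic Sobolev constant. -/
theorem LogSobolev.integrable_abs_cube {ν : Measure ℝ} [IsProbabilityMeasure ν] {C₀ : ℝ}
    (hC₀ : 0 < C₀) (h : LogSobolev ν C₀) (hi : Integrable (fun x : ℝ => x ^ 2) ν)
    (h1 : ∫ x, x ^ 2 ∂ν = 1) :
    Integrable (fun x : ℝ => |x| ^ 3) ν ∧ ∫ x, |x| ^ 3 ∂ν ≤ 6 * Real.exp (2 + C₀ / 4) := by
  set w : ℝ → ℝ := fun x => Real.sqrt (1 + x ^ 2) with hw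
  have hw1 : ∀ x, 1 ≤ w x := fun x => by
    rw [hw]; exact Real.one_le_sqrt.2 (by nlinarith [sq_nonneg x])
  have hwx : ∀ x, |x| ≤ w x := fun x => Real.abs_le_sqrt (by linarith)
  have hwd : ∀ x, HasDerivAt w (x / w x) x := fun x => by
    have h1 : HasDerivAt (fun x : ℝ => 1 + x ^ 2) (2 * x) x := by
      simpa using (hasDerivAt_pow 2 x).const_add 1
    have := h1.sqrt (by positivity)
    convert this using 1
    rw [hw]; field_simp
  have hwc : Continuous w := by rw [hw]; fun_prop
  have hwle : ∀ x, w x ≤ 1 + x ^ 2 := fun x =>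
    (Real.sqrt_le_iff.2 ⟨by positivity, by nlinarith [sq_nonneg x, sq_nonneg (x ^ 2)]⟩)
  let c : ℕ → ℝ := fun k => 1 / ((k : ℝ) + 1)
  have hc0 : ∀ k, 0 < c k := fun k => by positivity
  have tc : Filter.Tendsto c Filter.atTop (nhds 0) := tendsto_one_div_add_atTop_nhds_zero_nat
  -- Bounded smooth truncations of `w`, a smooth majorant of |x|. Each is 1-Lipschitz, so the same
  -- entropy bound holds for all k, and Fatou's lemma removes the truncation at the end.
  let u : ℕ → ℝ → ℝ := fun k x => w x / (1 + c k * w x)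
  have hw0 : ∀ x, 0 < w x := fun x => one_pos.trans_le (hw1 x)
  have hd0 : ∀ k x, 1 ≤ 1 + c k * w x := fun k x => by
    have := mul_pos (hc0 k) (hw0 x); linarith
  have hu0 : ∀ k x, 0 ≤ u k x := fun k x =>
    div_nonneg (hw0 x).le (zero_le_one.trans (hd0 k x))
  have huw : ∀ k x, u k x ≤ w x := fun k x => div_le_self (hw0 x).le (hd0 k x)
  have hud : ∀ k x, HasDerivAt (u k) (x / w x / (1 + c k * w x) ^ 2) x := fun k x => by
    have h0 : 1 + c k * w x ≠ 0 := (one_pos.trans_le (hd0 k x)).ne'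
    have h0' := (hw0 x).ne'
    refine ((hwd x).div (((hwd x).const_mul (c k)).const_add 1) h0).congr_deriv ?_
    field_simp
    ring
  have huc : ∀ k, Continuous (u k) := fun k =>
    continuous_iff_continuousAt.2 fun x => (hud k x).continuousAt
  have hub : ∀ k x, |u k x| ≤ 1 / c k := fun k x => by
    rw [abs_of_nonneg (hu0 k x), div_le_div_iff₀ (one_pos.trans_le (hd0 k x)) (hc0 k)]
    linarith
  -- Herbst at l = 1 with variance proxy C₀/4; the 2 bounds the mean, through w ≤ 1 + x².
  have hexp : ∀ k, ∫ x, Real.exp (u k x) ∂ν ≤ Real.exp (2 + C₀ / 4) := fun k => by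
    have hL : ∀ x, |x / w x / (1 + c k * w x) ^ 2| ≤ 1 := fun x => by
      rw [abs_div, abs_div, abs_of_pos (hw0 x), abs_of_pos (pow_pos (one_pos.trans_le (hd0 k x)) 2)]
      refine div_le_one_of_le₀ ?_ (pow_pos (one_pos.trans_le (hd0 k x)) 2).le
      have : |x| / w x ≤ 1 := div_le_one_of_le₀ (hwx x) (hw0 x).le
      nlinarith [hd0 k x]
    have hent : ∀ l : ℝ, 0 < l → ent ν (fun x => Real.exp (l * u k x)) ≤
        l ^ 2 * (C₀ / 4) * ∫ x, Real.exp (l * u k x) ∂ν := fun l _ => by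
      refine (h.ent_exp_le (hud k) ?_ (hub k) hL l).trans ?_
      · exact (continuous_id.div hwc fun x => (hw0 x).ne').div (by fun_prop)
          fun x => pow_ne_zero _ (one_pos.trans_le (hd0 k x)).ne'
      · rw [mul_assoc]
        refine mul_le_mul_of_nonneg_left ?_ (sq_nonneg _)
        rw [← integral_const_mul]
        have hbp : BddPos (fun x => Real.exp (l * u k x)) _ _ :=
          BddPos.exp ((huc k).measurable.const_mul l) (B := |l| * (1 / c k)) fun x => by
            rw [abs_mul]; exact mul_le_mul_of_nonneg_left (hub k x) (abs_nonneg l)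
        refine integral_mono_of_nonneg (Filter.Eventually.of_forall fun x => by positivity)
          ((hbp.integrable ν).const_mul _) (Filter.Eventually.of_forall fun x => ?_)
        have := (sq_le_one_iff_abs_le_one _).2 (hL x)
        refine mul_le_mul_of_nonneg_right ?_ (Real.exp_pos _).le
        nlinarith
    have := integral_exp_le_of_ent_le (huc k).measurable (hub k) hent one_pos
    simp only [one_mul, one_pow] at this
    refine this.trans (Real.exp_le_exp.2 ?_)
    have h2 : ∫ x, u k x ∂ν ≤ ∫ x, (1 + x ^ 2) ∂ν :=
      integral_mono (integrable_of_abs_le (huc k).measurable (hub k))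
        ((integrable_const 1).add hi) fun x => (huw k x).trans (hwle x)
    rw [integral_add (integrable_const 1) hi, h1] at h2
    simp at h2
    linarith
  have hcube : ∀ x : ℝ, |x| ^ 3 ≤ 6 * Real.exp (w x) := fun x => by
    have h3 := Real.pow_div_factorial_le_exp |x| (abs_nonneg x) 3
    have h4 := Real.exp_le_exp.2 (hwx x)
    norm_num [Nat.factorial] at h3
    linarith
  have htend : ∀ x, Filter.Tendsto (fun k => ENNReal.ofReal (6 * Real.exp (u k x))) Filter.atTop
      (nhds (ENNReal.ofReal (6 * Real.exp (w x)))) := fun x => by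
    refine (ENNReal.continuous_ofReal.tendsto _).comp (((Real.continuous_exp.tendsto _).comp ?_).const_mul 6)
    have : Filter.Tendsto (fun k => w x / (1 + c k * w x)) Filter.atTop
        (nhds (w x / (1 + 0 * w x))) := (tendsto_const_nhds (x := w x)).div ((tc.mul_const (w x)).const_add 1)
      (by simp : (1 + 0 * w x) ≠ 0)
    simpa using this
  have hlint : ∫⁻ x, ENNReal.ofReal (|x| ^ 3) ∂ν ≤ ENNReal.ofReal (6 * Real.exp (2 + C₀ / 4)) := by
    calc ∫⁻ x, ENNReal.ofReal (|x| ^ 3) ∂ν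
        ≤ ∫⁻ x, ENNReal.ofReal (6 * Real.exp (w x)) ∂ν :=
          lintegral_mono fun x => ENNReal.ofReal_le_ofReal (hcube x)
      _ = ∫⁻ x, Filter.liminf (fun k => ENNReal.ofReal (6 * Real.exp (u k x))) Filter.atTop ∂ν :=
          lintegral_congr fun x => (htend x).liminf_eq.symm
      _ ≤ Filter.liminf (fun k => ∫⁻ x, ENNReal.ofReal (6 * Real.exp (u k x)) ∂ν) Filter.atTop :=
          lintegral_liminf_le fun k => ((huc k).measurable.exp.const_mul 6).ennreal_ofReal
      _ ≤ ENNReal.ofReal (6 * Real.exp (2 + C₀ / 4)) := by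
          refine Filter.liminf_le_of_le (by isBoundedDefault) fun b hb => ?_
          obtain ⟨k, hk⟩ := hb.exists
          refine hk.trans ?_
          have hbp := (BddPos.exp (huc k).measurable (hub k)).integrable ν
          rw [← ofReal_integral_eq_lintegral_ofReal (hbp.const_mul 6)
            (Filter.Eventually.of_forall fun x => by positivity), integral_const_mul]
          exact ENNReal.ofReal_le_ofReal (by linarith [hexp k])
  have hm : AEStronglyMeasurable (fun x : ℝ => |x| ^ 3) ν :=
    (by fun_prop : Continuous fun x : ℝ => |x| ^ 3).aestronglyMeasurable
  have hn : 0 ≤ᵐ[ν] fun x : ℝ => |x| ^ 3 := Filter.Eventually.of_forall fun x => by positivity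
  constructor
  · refine ⟨hm, ?_⟩
    rw [hasFiniteIntegral_iff_ofReal hn]
    exact hlint.trans_lt ENNReal.ofReal_lt_top
  · rw [integral_eq_lintegral_of_nonneg_ae hn hm]
    exact ENNReal.toReal_le_of_le_ofReal (by positivity) hlint

/-! ### Trigonometric polynomials and their normalized derivatives -/

/-- The `p`-th derivative of the function multiplying the `j`-th coefficient, divided by `n ^ p`. -/
noncomputable def trigBasis {n : ℕ} (p : ℕ) : Fin n ⊕ Fin n → ℝ → ℝ
  | Sum.inl k, x => 1 / Real.sqrt n * ((((k : ℕ) + 1 : ℝ) / n) ^ p *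
      Real.cos (((k : ℕ) + 1 : ℝ) * x + p * (Real.pi / 2)))
  | Sum.inr k, x => 1 / Real.sqrt n * ((((k : ℕ) + 1 : ℝ) / n) ^ p *
      Real.sin (((k : ℕ) + 1 : ℝ) * x + p * (Real.pi / 2)))

/-- The `p`-th derivative of `trigPoly v`, divided by `n ^ p`. -/
noncomputable def trigDeriv {n : ℕ} (p : ℕ) (v : Fin n ⊕ Fin n → ℝ) (x : ℝ) : ℝ :=
  ∑ j, v j * trigBasis p j x

section
variable {n : ℕ}

theorem ratio_mem (k : Fin n) : 0 ≤ (((k : ℕ) + 1 : ℝ) / n) ∧ (((k : ℕ) + 1 : ℝ) / n) ≤ 1 := by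
  have hn : (0 : ℝ) < n := by exact_mod_cast k.pos
  refine ⟨by positivity, ?_⟩
  rw [div_le_one hn]
  exact_mod_cast k.isLt

theorem ratio_pow_le (k : Fin n) (p : ℕ) : |(((k : ℕ) + 1 : ℝ) / n) ^ p| ≤ 1 := by
  rw [abs_of_nonneg (pow_nonneg (ratio_mem k).1 p)]
  exact pow_le_one₀ (ratio_mem k).1 (ratio_mem k).2

theorem abs_trigBasis_le (p : ℕ) (j : Fin n ⊕ Fin n) (x : ℝ) :
    |trigBasis p j x| ≤ 1 / Real.sqrt n := by
  have h0 : 0 ≤ 1 / Real.sqrt n := by positivity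
  rcases j with k | k
  · rw [trigBasis, abs_mul, abs_of_nonneg h0, abs_mul]
    exact mul_le_of_le_one_right h0
      (mul_le_one₀ (ratio_pow_le k p) (abs_nonneg _) (Real.abs_cos_le_one _))
  · rw [trigBasis, abs_mul, abs_of_nonneg h0, abs_mul]
    exact mul_le_of_le_one_right h0
      (mul_le_one₀ (ratio_pow_le k p) (abs_nonneg _) (Real.abs_sin_le_one _))

theorem continuous_trigBasis (p : ℕ) (j : Fin n ⊕ Fin n) : Continuous (trigBasis p j) := by
  rcases j with k | k
  · unfold trigBasis; fun_prop
  · unfold trigBasis; fun_prop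

theorem hasDerivAt_trigBasis (p : ℕ) (j : Fin n ⊕ Fin n) (x : ℝ) :
    HasDerivAt (trigBasis p j) (n * trigBasis (p + 1) j x) x := by
  have hlin : ∀ k : Fin n, HasDerivAt (fun x : ℝ => ((k : ℕ) + 1 : ℝ) * x + p * (Real.pi / 2))
      ((k : ℕ) + 1 : ℝ) x := fun k => by
    simpa using ((hasDerivAt_id x).const_mul ((k : ℕ) + 1 : ℝ)).add_const (p * (Real.pi / 2))
  have hsplit : ∀ k : Fin n, ((k : ℕ) + 1 : ℝ) * x + ((p + 1 : ℕ) : ℝ) * (Real.pi / 2) =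
      ((k : ℕ) + 1 : ℝ) * x + p * (Real.pi / 2) + Real.pi / 2 := fun k => by push_cast; ring
  rcases j with k | k
  · have hn : (n : ℝ) ≠ 0 := by have := k.pos; positivity
    have := (((hlin k).cos).const_mul ((((k : ℕ) + 1 : ℝ) / n) ^ p)).const_mul (1 / Real.sqrt n)
    refine this.congr_deriv ?_
    simp only [trigBasis]
    rw [hsplit, Real.cos_add_pi_div_two, pow_succ]
    field_simp
  · have hn : (n : ℝ) ≠ 0 := by have := k.pos; positivity
    have := (((hlin k).sin).const_mul ((((k : ℕ) + 1 : ℝ) / n) ^ p)).const_mul (1 / Real.sqrt n)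
    refine this.congr_deriv ?_
    simp only [trigBasis]
    rw [hsplit, Real.sin_add_pi_div_two, pow_succ]
    field_simp

theorem trigBasis_periodic (p : ℕ) (j : Fin n ⊕ Fin n) :
    Function.Periodic (trigBasis p j) (2 * Real.pi) := by
  intro x
  have hsplit : ∀ k : Fin n, ((k : ℕ) + 1 : ℝ) * (x + 2 * Real.pi) + p * (Real.pi / 2) =
      ((k : ℕ) + 1 : ℝ) * x + p * (Real.pi / 2) + ((k + 1 : ℕ) : ℝ) * (2 * Real.pi) := fun k => by
    push_cast; ring
  rcases j with k | k
  · simp only [trigBasis]; rw [hsplit, Real.cos_add_nat_mul_two_pi]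
  · simp only [trigBasis]; rw [hsplit, Real.sin_add_nat_mul_two_pi]

theorem hasDerivAt_trigDeriv (p : ℕ) (v : Fin n ⊕ Fin n → ℝ) (x : ℝ) :
    HasDerivAt (trigDeriv p v) (n * trigDeriv (p + 1) v x) x := by
  have : HasDerivAt (fun x => ∑ j, v j * trigBasis p j x)
      (∑ j, v j * (n * trigBasis (p + 1) j x)) x :=
    HasDerivAt.fun_sum fun j _ => (hasDerivAt_trigBasis p j x).const_mul (v j)
  refine this.congr_deriv ?_
  rw [trigDeriv, Finset.mul_sum]
  exact Finset.sum_congr rfl fun j _ => by ring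

theorem continuous_trigDeriv (p : ℕ) :
    Continuous fun q : (Fin n ⊕ Fin n → ℝ) × ℝ => trigDeriv p q.1 q.2 := by
  unfold trigDeriv
  have := fun j => continuous_trigBasis (n := n) p j
  fun_prop

@[fun_prop]
theorem Continuous.trigDeriv {α : Type*} [TopologicalSpace α] {p : ℕ}
    {v : α → Fin n ⊕ Fin n → ℝ} {x : α → ℝ} (hv : Continuous v) (hx : Continuous x) :
    Continuous fun a => RandomTrig.trigDeriv p (v a) (x a) :=
  (continuous_trigDeriv p).comp (hv.prodMk hx)

theorem trigDeriv_periodic (p : ℕ) (v : Fin n ⊕ Fin n → ℝ) :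
    Function.Periodic (trigDeriv p v) (2 * Real.pi) := fun x => by
  unfold trigDeriv
  exact Finset.sum_congr rfl fun j _ => by rw [trigBasis_periodic p j x]

theorem trigPoly_eq (v : Fin n ⊕ Fin n → ℝ) : trigPoly v = trigDeriv 0 v := by
  funext x
  simp only [trigPoly, trigDeriv, trigBasis, Fintype.sum_sum_type, Finset.mul_sum, pow_zero,
    Nat.cast_zero, zero_mul, add_zero, one_mul, ← Finset.sum_add_distrib]
  exact Finset.sum_congr rfl fun k _ => by ring

theorem deriv_trigPoly (v : Fin n ⊕ Fin n → ℝ) (x : ℝ) :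
    deriv (trigPoly v) x = n * trigDeriv 1 v x := by
  rw [trigPoly_eq, (hasDerivAt_trigDeriv 0 v x).deriv]

theorem trigDeriv_add_smul (p : ℕ) (v w : Fin n ⊕ Fin n → ℝ) (t x : ℝ) :
    trigDeriv p (v + t • w) x = trigDeriv p v x + t * trigDeriv p w x := by
  simp only [trigDeriv, Finset.mul_sum, ← Finset.sum_add_distrib, Pi.add_apply, Pi.smul_apply,
    smul_eq_mul]
  exact Finset.sum_congr rfl fun j _ => by ring

open Complex in
theorem integral_normSq_trig_sum (c : Fin n → ℂ) :
    ∫ x in (0 : ℝ)..(2 * Real.pi), ‖∑ k, c k * cexp ((((k : ℕ) + 1 : ℝ) * x : ℝ) * I)‖ ^ 2 =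
      2 * Real.pi * ∑ k, ‖c k‖ ^ 2 := by
  have horth : ∀ k l : Fin n, ∫ x in (0 : ℝ)..(2 * Real.pi),
      cexp ((((k : ℕ) + 1 : ℝ) * x : ℝ) * I) * (starRingEnd ℂ) (cexp ((((l : ℕ) + 1 : ℝ) * x : ℝ) * I))
      = if k = l then 2 * Real.pi else 0 := by
    intro k l
    have e : ∀ x : ℝ, cexp ((((k : ℕ) + 1 : ℝ) * x : ℝ) * I) *
        (starRingEnd ℂ) (cexp ((((l : ℕ) + 1 : ℝ) * x : ℝ) * I)) =
        cexp ((((k : ℕ) : ℂ) - ((l : ℕ) : ℂ)) * I * x) := fun x => by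
      rw [← Complex.exp_conj, ← Complex.exp_add]
      congr 1
      simp only [map_mul, Complex.conj_ofReal, Complex.conj_I]
      push_cast
      ring
    simp_rw [e]
    split_ifs with h
    · subst h; simp
    · have hne : (((k : ℕ) : ℂ) - ((l : ℕ) : ℂ)) ≠ 0 := by
        rw [sub_ne_zero]
        exact_mod_cast fun h' => h (Fin.ext h')
      rw [integral_exp_mul_complex (mul_ne_zero hne Complex.I_ne_zero)]
      have : cexp ((((k : ℕ) : ℂ) - ((l : ℕ) : ℂ)) * I * ((2 * Real.pi : ℝ) : ℂ)) = 1 := by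
        rw [Complex.exp_eq_one_iff]
        exact ⟨(k : ℕ) - (l : ℕ), by push_cast; ring⟩
      rw [this]; simp
  have hcomplex : ((∫ x in (0 : ℝ)..(2 * Real.pi),
      ‖∑ k, c k * cexp ((((k : ℕ) + 1 : ℝ) * x : ℝ) * I)‖ ^ 2 : ℝ) : ℂ) =
      ((2 * Real.pi * ∑ k, ‖c k‖ ^ 2 : ℝ) : ℂ) := by
    rw [← intervalIntegral.integral_ofReal]
    have e : ∀ x : ℝ, ((‖∑ k, c k * cexp ((((k : ℕ) + 1 : ℝ) * x : ℝ) * I)‖ ^ 2 : ℝ) : ℂ) =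
        ∑ k, ∑ l, c k * (starRingEnd ℂ) (c l) * (cexp ((((k : ℕ) + 1 : ℝ) * x : ℝ) * I) *
          (starRingEnd ℂ) (cexp ((((l : ℕ) + 1 : ℝ) * x : ℝ) * I))) := fun x => by
      rw [Complex.ofReal_pow, ← Complex.mul_conj', map_sum, Finset.sum_mul_sum]
      refine Finset.sum_congr rfl fun k _ => Finset.sum_congr rfl fun l _ => ?_
      rw [map_mul]; ring
    simp_rw [e]
    have hi : ∀ k l : Fin n, IntervalIntegrable (fun x : ℝ => c k * (starRingEnd ℂ) (c l) *
        (cexp ((((k : ℕ) + 1 : ℝ) * x : ℝ) * I) *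
          (starRingEnd ℂ) (cexp ((((l : ℕ) + 1 : ℝ) * x : ℝ) * I)))) volume 0 (2 * Real.pi) :=
      fun k l => Continuous.intervalIntegrable (by fun_prop) _ _
    rw [intervalIntegral.integral_finsetSum fun k _ =>
      Continuous.intervalIntegrable (by fun_prop) _ _]
    have hR : ((2 * Real.pi * ∑ k, ‖c k‖ ^ 2 : ℝ) : ℂ) =
        ∑ k, (2 * Real.pi : ℂ) * (‖c k‖ : ℂ) ^ 2 := by
      push_cast; rw [Finset.mul_sum]
    rw [hR]
    refine Finset.sum_congr rfl fun k _ => ?_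
    rw [intervalIntegral.integral_finsetSum fun l _ => hi k l]
    have : ∀ l : Fin n, ∫ x in (0 : ℝ)..(2 * Real.pi), c k * (starRingEnd ℂ) (c l) *
        (cexp ((((k : ℕ) + 1 : ℝ) * x : ℝ) * I) *
          (starRingEnd ℂ) (cexp ((((l : ℕ) + 1 : ℝ) * x : ℝ) * I))) =
        if k = l then c k * (starRingEnd ℂ) (c l) * (2 * Real.pi) else 0 := fun l => by
      rw [intervalIntegral.integral_const_mul, horth]; split_ifs <;> simp
    rw [Finset.sum_congr rfl fun l _ => this l, Finset.sum_ite_eq, if_pos (Finset.mem_univ k)]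
    rw [Complex.mul_conj']; ring
  exact_mod_cast hcomplex

open Complex in
-- The sum is the real part of a complex trigonometric sum with distinct frequencies, so
-- orthogonality applies, and the factors ((k+1)/n)^p are at most 1. The gain of 1/n comes from the
-- normalization and is the source of concentration.
theorem integral_trigDeriv_sq_le (p : ℕ) (w : Fin n ⊕ Fin n → ℝ) :
    ∫ x in (0 : ℝ)..(2 * Real.pi), trigDeriv p w x ^ 2 ≤ 2 * Real.pi / n * ∑ j, w j ^ 2 := by
  set c : Fin n → ℂ := fun k => ((1 / Real.sqrt n * (((k : ℕ) + 1 : ℝ) / n) ^ p : ℝ) : ℂ) *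
    ((w (Sum.inl k) : ℂ) - (w (Sum.inr k) : ℂ) * I) * cexp ((p * (Real.pi / 2) : ℝ) * I) with hc
  have hre : ∀ x, trigDeriv p w x =
      (∑ k, c k * cexp ((((k : ℕ) + 1 : ℝ) * x : ℝ) * I)).re := fun x => by
    rw [Complex.re_sum, trigDeriv, Fintype.sum_sum_type, ← Finset.sum_add_distrib]
    refine Finset.sum_congr rfl fun k _ => ?_
    have : c k * cexp ((((k : ℕ) + 1 : ℝ) * x : ℝ) * I) =
        ((1 / Real.sqrt n * (((k : ℕ) + 1 : ℝ) / n) ^ p : ℝ) : ℂ) *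
        (((w (Sum.inl k) : ℂ) - (w (Sum.inr k) : ℂ) * I) *
          cexp ((((k : ℕ) + 1 : ℝ) * x + p * (Real.pi / 2) : ℝ) * I)) := by
      have h2 : ((((k : ℕ) + 1 : ℝ) * x + p * (Real.pi / 2) : ℝ) : ℂ) * I =
          ((((k : ℕ) + 1 : ℝ) * x : ℝ) : ℂ) * I + ((p * (Real.pi / 2) : ℝ) : ℂ) * I := by
        push_cast; ring
      rw [hc, h2, Complex.exp_add]; ring
    rw [this, Complex.re_ofReal_mul, Complex.mul_re, Complex.exp_ofReal_mul_I_re,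
      Complex.exp_ofReal_mul_I_im]
    simp [trigBasis]
    ring
  have hnorm : ∀ k, ‖c k‖ ^ 2 ≤ 1 / n * (w (Sum.inl k) ^ 2 + w (Sum.inr k) ^ 2) := fun k => by
    have h1 : ‖(w (Sum.inl k) : ℂ) - (w (Sum.inr k) : ℂ) * I‖ ^ 2 =
        w (Sum.inl k) ^ 2 + w (Sum.inr k) ^ 2 := by
      rw [← Complex.normSq_eq_norm_sq, Complex.normSq_apply]; simp; ring
    rw [hc]; simp only
    rw [norm_mul, norm_mul, Complex.norm_exp_ofReal_mul_I, mul_one, mul_pow, h1, Complex.norm_real,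
      Real.norm_eq_abs, abs_mul, mul_pow, abs_of_nonneg (by positivity : 0 ≤ 1 / Real.sqrt n),
      div_pow, one_pow, Real.sq_sqrt (Nat.cast_nonneg n)]
    refine mul_le_mul_of_nonneg_right ?_ (by positivity)
    refine mul_le_of_le_one_right (by positivity) ?_
    exact pow_le_one₀ (abs_nonneg _) (ratio_pow_le k p)
  calc ∫ x in (0 : ℝ)..(2 * Real.pi), trigDeriv p w x ^ 2
      ≤ ∫ x in (0 : ℝ)..(2 * Real.pi), ‖∑ k, c k * cexp ((((k : ℕ) + 1 : ℝ) * x : ℝ) * I)‖ ^ 2 := by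
        refine intervalIntegral.integral_mono_on (by positivity)
          (Continuous.intervalIntegrable (by fun_prop) _ _)
          (Continuous.intervalIntegrable (by fun_prop) _ _) fun x _ => ?_
        rw [hre x, ← sq_abs]
        gcongr
        exact Complex.abs_re_le_norm _
    _ = 2 * Real.pi * ∑ k, ‖c k‖ ^ 2 := integral_normSq_trig_sum c
    _ ≤ 2 * Real.pi * ∑ k, 1 / n * (w (Sum.inl k) ^ 2 + w (Sum.inr k) ^ 2) := by
        gcongr with k; exact hnorm k
    _ = 2 * Real.pi / n * ∑ j, w j ^ 2 := by
        rw [← Finset.mul_sum, Fintype.sum_sum_type, Finset.sum_add_distrib]; ring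

/-- The sum of the squares of the values of the basis functions, tested against a pair `(t, s)`. -/
theorem trigBasis_quadratic (k : Fin n) (x t s : ℝ) :
    (t * trigBasis 0 (Sum.inl k) x + s * trigBasis 1 (Sum.inl k) x) ^ 2 +
      (t * trigBasis 0 (Sum.inr k) x + s * trigBasis 1 (Sum.inr k) x) ^ 2 =
      1 / n * (t ^ 2 + (((k : ℕ) + 1 : ℝ) / n) ^ 2 * s ^ 2) := by
  have hs : (1 / Real.sqrt n) ^ 2 = 1 / n := by
    rw [div_pow, one_pow, Real.sq_sqrt (Nat.cast_nonneg n)]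
  simp only [trigBasis, pow_zero, pow_one, Nat.cast_zero, zero_mul, add_zero, one_mul, Nat.cast_one,
    Real.cos_add_pi_div_two, Real.sin_add_pi_div_two]
  have := Real.sin_sq_add_cos_sq (((k : ℕ) + 1 : ℝ) * x)
  rw [← hs]
  linear_combination ((1 / Real.sqrt n) ^ 2 * (t ^ 2 + (((k : ℕ) + 1 : ℝ) / n) ^ 2 * s ^ 2)) * this

end
/-! ### A smooth functional detecting exceptional polynomials -/

/-- This normalization makes the cut-off equal to the characteristic function of the standard normal
law, as used in the estimate of the mean. -/
noncomputable def gauss (y : ℝ) : ℝ := Real.exp (-y ^ 2 / 2)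

/-- A smooth weight that dominates both 1 and |z| and has first and second derivatives bounded by 1.
-/
noncomputable def japanese (z : ℝ) : ℝ := Real.sqrt (1 + z ^ 2)

theorem gauss_pos (y : ℝ) : 0 < gauss y := Real.exp_pos _

theorem gauss_le_one (y : ℝ) : gauss y ≤ 1 :=
  Real.exp_le_one_iff.2 (by nlinarith [sq_nonneg y])

@[fun_prop]
theorem continuous_gauss : Continuous gauss := by unfold gauss; fun_prop

@[fun_prop]
theorem continuous_japanese : Continuous japanese := by unfold japanese; fun_prop

theorem one_le_japanese (z : ℝ) : 1 ≤ japanese z :=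
  Real.one_le_sqrt.2 (by nlinarith [sq_nonneg z])

theorem japanese_pos (z : ℝ) : 0 < japanese z := one_pos.trans_le (one_le_japanese z)

theorem abs_le_japanese (z : ℝ) : |z| ≤ japanese z := Real.abs_le_sqrt (by linarith)

theorem japanese_sq (z : ℝ) : japanese z ^ 2 = 1 + z ^ 2 := Real.sq_sqrt (by positivity)

theorem japanese_le (z : ℝ) : japanese z ≤ 1 + z ^ 2 := by
  nlinarith [japanese_sq z, one_le_japanese z]

theorem exp_le_gauss {y c : ℝ} (h : |y| ≤ c) : Real.exp (-c ^ 2 / 2) ≤ gauss y := by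
  refine Real.exp_le_exp.2 ?_
  have : y ^ 2 ≤ c ^ 2 := by rw [← sq_abs]; gcongr
  linarith

section
variable {f₀ f₁ f₂ : ℝ → ℝ} {n β x₀ : ℝ}

/-- Over a length β/n the function moves by at most 2β², so it stays within 3β² while its normalized
derivative stays within 2β; 13/2 = (3² + 2²)/2. -/
theorem gauss_mul_gauss_ge (hn : 0 < n) (hβ : 0 < β) (h0 : ∀ x, HasDerivAt f₀ (n * f₁ x) x)
    (a0 : |f₀ x₀| ≤ β ^ 2) {x : ℝ} (hx : x₀ ≤ x) (hx' : x ≤ x₀ + β / n)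
    (hb : ∀ y, x₀ ≤ y → y < x → |f₁ y| ≤ 2 * β) (hbx : |f₁ x| ≤ 2 * β) :
    Real.exp (-13 / 2) ≤ gauss (f₀ x / β ^ 2) * gauss (f₁ x / β) := by
  have h1 := norm_image_sub_le_of_norm_deriv_le_segment' (f := f₀) (a := x₀) (b := x)
    (C := n * (2 * β)) (fun y _ => (h0 y).hasDerivWithinAt) (fun y hy => by
      rw [Real.norm_eq_abs, abs_mul, abs_of_pos hn]
      exact mul_le_mul_of_nonneg_left (hb y hy.1 hy.2) hn.le) x ⟨hx, le_rfl⟩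
  have h2 : n * (2 * β) * (x - x₀) ≤ 2 * β ^ 2 := by
    have : x - x₀ ≤ β / n := by linarith
    calc n * (2 * β) * (x - x₀) ≤ n * (2 * β) * (β / n) := by gcongr
      _ = 2 * β ^ 2 := by field_simp
  have h3 : |f₀ x / β ^ 2| ≤ 3 := by
    rw [abs_div, abs_of_pos (by positivity : 0 < β ^ 2), div_le_iff₀ (by positivity)]
    rw [Real.norm_eq_abs] at h1
    have := abs_sub_abs_le_abs_sub (f₀ x) (f₀ x₀)
    linarith
  have h4 : |f₁ x / β| ≤ 2 := by
    rw [abs_div, abs_of_pos hβ, div_le_iff₀ hβ]; exact hbx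
  calc Real.exp (-13 / 2) = Real.exp (-3 ^ 2 / 2) * Real.exp (-2 ^ 2 / 2) := by
        rw [← Real.exp_add]; norm_num
    _ ≤ _ := mul_le_mul (exp_le_gauss h3) (exp_le_gauss h4) (Real.exp_pos _).le (gauss_pos _).le

/-- Near a point where a function and its derivative are small, the functional is large. -/
theorem le_integral_near_unstable (hn : 0 < n) (hβ : 0 < β)
    (h0 : ∀ x, HasDerivAt f₀ (n * f₁ x) x) (h1 : ∀ x, HasDerivAt f₁ (n * f₂ x) x)
    (h2 : Continuous f₂) (a0 : |f₀ x₀| ≤ β ^ 2) (a1 : |f₁ x₀| ≤ β) :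
    Real.exp (-13 / 2) * (β / n) ≤ ∫ x in x₀..(x₀ + β / n),
      gauss (f₀ x / β ^ 2) * gauss (f₁ x / β) * japanese (f₂ x) := by
  have c0 : Continuous f₀ := continuous_iff_continuousAt.2 fun x => (h0 x).continuousAt
  have c1 : Continuous f₁ := continuous_iff_continuousAt.2 fun x => (h1 x).continuousAt
  have hβn : 0 < β / n := by positivity
  have hF : Continuous fun x => gauss (f₀ x / β ^ 2) * gauss (f₁ x / β) * japanese (f₂ x) := by
    fun_prop
  -- If the normalized derivative stays below 2β, the cut-offs alone give the bound. Otherwise let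
  -- x₁ be the first point where it reaches 2β: it has gained β on the way, so ∫ |f₂| over [x₀, x₁]
  -- is at least β/n, and the weight makes up for the shorter window.
  by_cases hA : ∀ x ∈ Set.Icc x₀ (x₀ + β / n), |f₁ x| < 2 * β
  · have : ∫ x in x₀..(x₀ + β / n), Real.exp (-13 / 2) ≤ ∫ x in x₀..(x₀ + β / n),
        gauss (f₀ x / β ^ 2) * gauss (f₁ x / β) * japanese (f₂ x) := by
      refine intervalIntegral.integral_mono_on (by linarith) (by simp) (hF.intervalIntegrable _ _)
        fun x hx => ?_
      have := gauss_mul_gauss_ge hn hβ h0 a0 hx.1 hx.2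
        (fun y hy hy' => (hA y ⟨hy, hy'.le.trans hx.2⟩).le) (hA x hx).le
      exact this.trans (le_mul_of_one_le_right (mul_pos (gauss_pos _) (gauss_pos _)).le
        (one_le_japanese _))
    rw [intervalIntegral.integral_const, add_sub_cancel_left, smul_eq_mul, mul_comm] at this
    exact this
  · push Not at hA
    have hK : IsCompact (Set.Icc x₀ (x₀ + β / n) ∩ {x | 2 * β ≤ |f₁ x|}) :=
      isCompact_Icc.inter_right (isClosed_le continuous_const c1.abs)
    obtain ⟨x₁, ⟨hx₁, hx₁'⟩, hmin⟩ := hK.exists_isLeast hA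
    have hlt : ∀ y, x₀ ≤ y → y < x₁ → |f₁ y| < 2 * β := fun y hy hy' => by
      by_contra hcon
      exact absurd (hmin ⟨⟨hy, hy'.le.trans hx₁.2⟩, not_lt.1 hcon⟩) (not_le.2 hy')
    have hint : β / n ≤ ∫ x in x₀..x₁, |f₂ x| := by
      have e := intervalIntegral.integral_eq_sub_of_hasDerivAt (a := x₀) (b := x₁)
        (fun x _ => h1 x) ((continuous_const.mul h2).intervalIntegrable _ _)
      rw [intervalIntegral.integral_const_mul] at e
      have h3 := intervalIntegral.abs_integral_le_integral_abs (f := f₂) (μ := volume) hx₁.1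
      have h4 : β ≤ |f₁ x₁ - f₁ x₀| := by
        have := abs_sub_abs_le_abs_sub (f₁ x₁) (f₁ x₀)
        have : 2 * β ≤ |f₁ x₁| := hx₁'
        linarith
      rw [← e, abs_mul, abs_of_pos hn] at h4
      rw [div_le_iff₀ hn]
      nlinarith
    calc Real.exp (-13 / 2) * (β / n) ≤ Real.exp (-13 / 2) * ∫ x in x₀..x₁, |f₂ x| := by gcongr
      _ = ∫ x in x₀..x₁, Real.exp (-13 / 2) * |f₂ x| := by
          rw [intervalIntegral.integral_const_mul]
      _ ≤ ∫ x in x₀..x₁, gauss (f₀ x / β ^ 2) * gauss (f₁ x / β) * japanese (f₂ x) := by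
          refine intervalIntegral.integral_mono_on_of_le_Ioo hx₁.1
            (Continuous.intervalIntegrable (by fun_prop) _ _) (hF.intervalIntegrable _ _)
            fun x hx => ?_
          exact mul_le_mul (gauss_mul_gauss_ge hn hβ h0 a0 hx.1.le (hx.2.le.trans hx₁.2)
            (fun y hy hy' => (hlt y hy (hy'.trans hx.2)).le) (hlt x hx.1.le hx.2).le)
            (abs_le_japanese _) (abs_nonneg _) (mul_pos (gauss_pos _) (gauss_pos _)).le
      _ ≤ _ := by
          refine intervalIntegral.integral_mono_interval le_rfl hx₁.1 hx₁.2
            (Filter.Eventually.of_forall fun x => ?_) (hF.intervalIntegrable _ _)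
          exact (mul_pos (mul_pos (gauss_pos _) (gauss_pos _)) (japanese_pos _)).le

end

/-! ### Multiplicity of a cover -/

open Set in
/-- Every point lies close to few of the intervals of a cover of the circle. -/
theorem IsCover.card_near_le {n : ℕ} {R : ℝ} {N : ℕ} {y : Fin N → ℝ} (h : IsCover n R y)
    (hn : 0 < n) (hR : 0 < R) (p : ℝ) (S : Finset (Fin N))
    (hS : ∀ i ∈ S, ∃ k : ℤ, |y i + 2 * Real.pi * k - p| < 2 * R / n) : S.card ≤ 6 := by
  have hn' : (0 : ℝ) < n := by exact_mod_cast hn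
  have hp : (0 : ℝ) < 2 * Real.pi := Real.two_pi_pos
  -- A period starting at p, without the arc of radius 5R/(2n) about p: an interval of length R/n
  -- centred within 2R/n of p lies in that arc, so `J` must be covered by the other members.
  set J : Set ℝ := Icc (p + 5 * R / (2 * n)) (p + 2 * Real.pi - 5 * R / (2 * n)) with hJ
  have h5 : (0 : ℝ) < 5 * R / (2 * n) := by positivity
  -- the translates of a member of the cover meet a fundamental domain in a set of small measure
  have hvol : ∀ i : Fin N, volume (⋃ k : ℤ,
      ((fun x => x + 2 * Real.pi * k) ⁻¹' openInterval (y i) (R / n) ∩ Ioc p (p + 2 * Real.pi))) ≤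
      ENNReal.ofReal (R / n) := by
    intro i
    have hdisj := pairwise_disjoint_Ioc_add_zsmul p (2 * Real.pi)
    calc _ ≤ ∑' k : ℤ, volume ((fun x => x + 2 * Real.pi * k) ⁻¹' openInterval (y i) (R / n) ∩
          Ioc p (p + 2 * Real.pi)) := measure_iUnion_le _
      _ = ∑' k : ℤ, volume (openInterval (y i) (R / n) ∩
          Ioc (p + k • (2 * Real.pi)) (p + (k + 1) • (2 * Real.pi))) := by
          congr 1; funext k
          rw [← measure_preimage_add_right volume (2 * Real.pi * k)
            (openInterval (y i) (R / n) ∩ _)]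
          congr 1
          ext x
          simp only [mem_inter_iff, mem_preimage, mem_Ioc, zsmul_eq_mul]
          push_cast
          constructor
          · rintro ⟨h1, h2, h3⟩; exact ⟨h1, by linarith, by linarith⟩
          · rintro ⟨h1, h2, h3⟩; exact ⟨h1, by linarith, by linarith⟩
      _ = volume (⋃ k : ℤ, openInterval (y i) (R / n) ∩
          Ioc (p + k • (2 * Real.pi)) (p + (k + 1) • (2 * Real.pi))) := by
          rw [measure_iUnion]
          · intro k l hkl
            exact (hdisj hkl).mono inter_subset_right inter_subset_right
          · intro k; exact measurableSet_Ioo.inter measurableSet_Ioc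
      _ ≤ volume (openInterval (y i) (R / n)) :=
          measure_mono (iUnion_subset fun k => inter_subset_left)
      _ = ENNReal.ofReal (R / n) := by
          rw [openInterval, Real.volume_Ioo]; congr 1; ring
  have hcov : J ⊆ ⋃ i ∈ Sᶜ, ⋃ k : ℤ,
      ((fun x => x + 2 * Real.pi * k) ⁻¹' openInterval (y i) (R / n) ∩ Ioc p (p + 2 * Real.pi)) := by
    intro x hx
    obtain ⟨i, k, hk⟩ := h.covers x
    have hx1 := hx.1
    have hx2 := hx.2
    have hiS : i ∉ S := fun hi => by
      obtain ⟨l, hl⟩ := hS i hi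
      rw [abs_lt] at hl
      simp only [openInterval, mem_Ioo] at hk
      have e1 : 2 * R / n + R / n / 2 = 5 * R / (2 * n) := by field_simp; norm_num
      set m : ℤ := k + l
      have hm : (m : ℝ) = k + l := by simp [m]
      have b1 : x - p + 2 * Real.pi * m < 5 * R / (2 * n) := by rw [hm]; linarith
      have b2 : -(5 * R / (2 * n)) < x - p + 2 * Real.pi * m := by rw [hm]; linarith
      rcases lt_or_ge m 0 with h0 | h0
      · have : (m : ℝ) ≤ -1 := by exact_mod_cast (by omega : m ≤ -1)
        nlinarith
      · have : (0 : ℝ) ≤ m := by exact_mod_cast h0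
        nlinarith
    simp only [mem_iUnion, Finset.mem_compl]
    exact ⟨i, hiS, k, hk, by linarith, by linarith⟩
  have hle : ENNReal.ofReal (2 * Real.pi - 5 * R / n) ≤ (Sᶜ.card : ENNReal) * ENNReal.ofReal (R / n) := by
    calc ENNReal.ofReal (2 * Real.pi - 5 * R / n) = volume J := by
          rw [hJ, Real.volume_Icc]; congr 1; field_simp; ring
      _ ≤ _ := measure_mono hcov
      _ ≤ ∑ i ∈ Sᶜ, volume (⋃ k : ℤ, ((fun x => x + 2 * Real.pi * k) ⁻¹'
          openInterval (y i) (R / n) ∩ Ioc p (p + 2 * Real.pi))) := measure_biUnion_finset_le _ _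
      _ ≤ ∑ i ∈ Sᶜ, ENNReal.ofReal (R / n) := Finset.sum_le_sum fun i _ => hvol i
      _ = _ := by rw [Finset.sum_const, nsmul_eq_mul]
  -- In units of R/n, the members outside `S` number at least 2πn/R - 5, while there are at most
  -- 2πn/R + 1 members in all; hence the 6.
  have hle' : 2 * Real.pi - 5 * R / n ≤ (N - S.card : ℝ) * (R / n) := by
    have hc : ((Sᶜ.card : ℕ) : ℝ) = N - S.card := by
      rw [Finset.card_compl, Fintype.card_fin, Nat.cast_sub]
      simpa using S.card_le_univ
    rw [← hc]
    rw [← ENNReal.ofReal_natCast, ← ENNReal.ofReal_mul (Nat.cast_nonneg _)] at hle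
    exact (ENNReal.ofReal_le_ofReal_iff (by positivity)).1 hle
  have hfin : (S.card : ℝ) ≤ 6 := by
    have hRn : 0 < R / n := by positivity
    have h6 := h.card_le
    have e2 : 2 * Real.pi = 2 * Real.pi * n / R * (R / n) := by field_simp
    have e3 : 5 * R / n = 5 * (R / n) := by ring
    rw [e2, e3] at hle'
    have : (2 * Real.pi * n / R - 5) * (R / n) ≤ (N - S.card : ℝ) * (R / n) := by linarith
    have := le_of_mul_le_mul_right this hRn
    linarith
  exact_mod_cast hfin

/-! ### The detector and its size at exceptional polynomials -/

section
variable {n : ℕ}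

/-- The scales β² and β fit together: a derivative of size βn moves the polynomial by β² over a
length β/n. -/
noncomputable def density (β : ℝ) (v : Fin n ⊕ Fin n → ℝ) (x : ℝ) : ℝ :=
  gauss (trigDeriv 0 v x / β ^ 2) * gauss (trigDeriv 1 v x / β) * japanese (trigDeriv 2 v x)

/-- The functional detecting exceptional polynomials. -/
noncomputable def detector (β : ℝ) (v : Fin n ⊕ Fin n → ℝ) : ℝ :=
  ∫ x in (0 : ℝ)..(2 * Real.pi), density β v x

theorem density_pos (β : ℝ) (v : Fin n ⊕ Fin n → ℝ) (x : ℝ) : 0 < density β v x :=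
  mul_pos (mul_pos (gauss_pos _) (gauss_pos _)) (japanese_pos _)

theorem density_le (β : ℝ) (v : Fin n ⊕ Fin n → ℝ) (x : ℝ) :
    density β v x ≤ japanese (trigDeriv 2 v x) :=
  mul_le_of_le_one_left (japanese_pos _).le
    (mul_le_one₀ (gauss_le_one _) (gauss_pos _).le (gauss_le_one _))

theorem continuous_density (β : ℝ) :
    Continuous fun q : (Fin n ⊕ Fin n → ℝ) × ℝ => density β q.1 q.2 := by
  unfold density; fun_prop

theorem continuous_density_right (β : ℝ) (v : Fin n ⊕ Fin n → ℝ) : Continuous (density β v) := by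
  unfold density; fun_prop

theorem density_periodic (β : ℝ) (v : Fin n ⊕ Fin n → ℝ) :
    Function.Periodic (density β v) (2 * Real.pi) := fun x => by
  simp only [density, trigDeriv_periodic _ v x]

theorem detector_nonneg (β : ℝ) (v : Fin n ⊕ Fin n → ℝ) : 0 ≤ detector β v :=
  intervalIntegral.integral_nonneg Real.two_pi_pos.le fun x _ => (density_pos β v x).le

theorem continuous_detector (β : ℝ) : Continuous (detector (n := n) β) :=
  intervalIntegral.continuous_parametric_intervalIntegral_of_continuous' (continuous_density β) _ _

open Set in
-- Each unstable interval supplies a window of length β/n with mass at least exp(-13/2) β/n. No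
-- point lies in more than six windows, and the windows fit into (0, 4π], which counts the circle
-- twice; hence the 12.
theorem le_detector_of_isExceptional {R α b β δ : ℝ} {N : ℕ} {y : Fin N → ℝ}
    (hn : 0 < n) (hR : 1 ≤ R) (hy : IsCover n R y) (hβ : 0 < β) (hβ2 : β ≤ 1 / 2)
    (hα : α ≤ β ^ 2) (hb : b ≤ β) {v : Fin n ⊕ Fin n → ℝ}
    (hv : IsExceptional n R α b δ y (trigPoly v)) :
    Real.exp (-13 / 2) * (δ * β) / 12 ≤ detector β v := by
  classical
  have hn' : (0 : ℝ) < n := by exact_mod_cast hn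
  have hn1 : (1 : ℝ) ≤ n := by exact_mod_cast hn
  set S : Finset (Fin N) := Finset.univ.filter
    fun i => ¬ IsStableInterval n R α b (trigPoly v) (y i) with hS
  have hcard : δ * n ≤ S.card := by
    have : ({i : Fin N | ¬ IsStableInterval n R α b (trigPoly v) (y i)} : Set (Fin N)) = S := by
      ext i; simp [hS]
    rw [IsExceptional, this, ncard_coe_finset] at hv
    exact hv
  have hex : ∀ i, ∃ x : ℝ, i ∈ S → x ∈ openInterval (y i) (3 * R / n) ∧
      |trigDeriv 0 v x| ≤ β ^ 2 ∧ |trigDeriv 1 v x| ≤ β := by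
    intro i
    by_cases hi : i ∈ S
    · simp only [hS, Finset.mem_filter, IsStableInterval, not_not] at hi
      obtain ⟨x, hx, h1, h2⟩ := hi.2
      refine ⟨x, fun _ => ⟨hx, ?_, ?_⟩⟩
      · rw [trigPoly_eq] at h1; exact h1.trans hα
      · rw [deriv_trigPoly, abs_mul, abs_of_pos hn', mul_comm] at h2
        exact (le_of_mul_le_mul_right h2 hn').trans hb
    · exact ⟨0, fun h => absurd h hi⟩
  choose x hx using hex
  -- Midpoints are given only modulo 2π, so the bad points are moved into [0, 2π). The windows may
  -- run past 2π, which is why the integrals below extend to 4π.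
  set x' : Fin N → ℝ := fun i => toIcoMod Real.two_pi_pos 0 (x i) with hx'
  have hmem : ∀ i, x' i ∈ Ico (0 : ℝ) (2 * Real.pi) := fun i => by
    simpa using toIcoMod_mem_Ico Real.two_pi_pos 0 (x i)
  have hred : ∀ i, x' i = x i - toIcoDiv Real.two_pi_pos 0 (x i) * (2 * Real.pi) := fun i => by
    simp only [hx', toIcoMod, zsmul_eq_mul]
  have hper : ∀ p i, trigDeriv p v (x' i) = trigDeriv p v (x i) := fun p i => by
    rw [hred]; exact (trigDeriv_periodic p v).sub_int_mul_eq _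
  have hloc : ∀ i ∈ S, Real.exp (-13 / 2) * (β / n) ≤
      ∫ t in (x' i)..(x' i + β / n), density β v t := fun i hi => by
    obtain ⟨-, h1, h2⟩ := hx i hi
    rw [← hper] at h1 h2
    exact le_integral_near_unstable hn' hβ (hasDerivAt_trigDeriv 0 v) (hasDerivAt_trigDeriv 1 v)
      (by fun_prop) h1 h2
  have hβn : 0 < β / n := by positivity
  have hβn2 : β / n ≤ 1 / 2 := (div_le_self hβ.le hn1).trans hβ2
  have hpi := Real.pi_gt_three
  set I : Fin N → Set ℝ := fun i => Ioc (x' i) (x' i + β / n) with hI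
  have hint : ∀ i, ∫ t in (x' i)..(x' i + β / n), density β v t =
      ∫ t in Ioc 0 (4 * Real.pi), (I i).indicator (density β v) t := fun i => by
    rw [setIntegral_indicator measurableSet_Ioc, intervalIntegral.integral_of_le (by linarith),
      inter_eq_self_of_subset_right]
    have := hmem i
    exact Ioc_subset_Ioc this.1 (by linarith [this.2])
  have hDc := continuous_density_right β v
  have hDi : IntegrableOn (density β v) (Ioc 0 (4 * Real.pi)) :=
    (hDc.integrableOn_Icc).mono_set Ioc_subset_Icc_self
  have hpt : ∀ t, ∑ i ∈ S, (I i).indicator (density β v) t ≤ 6 * density β v t := by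
    intro t
    have e : ∑ i ∈ S, (I i).indicator (density β v) t =
        ((S.filter fun i => t ∈ I i).card : ℝ) * density β v t := by
      simp_rw [indicator_apply]
      rw [← Finset.sum_filter, Finset.sum_const, nsmul_eq_mul]
    rw [e]
    refine mul_le_mul_of_nonneg_right ?_ (density_pos β v t).le
    have : (S.filter fun i => t ∈ I i).card ≤ 6 := by
      refine hy.card_near_le hn (by linarith) t _ fun i hi => ?_
      rw [Finset.mem_filter] at hi
      obtain ⟨h1, -, -⟩ := hx i hi.1
      have h2 := hi.2
      simp only [openInterval, mem_Ioo] at h1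
      simp only [hI, mem_Ioc] at h2
      refine ⟨-toIcoDiv Real.two_pi_pos 0 (x i), ?_⟩
      have h3 := hred i
      -- Here R ≥ 1 and β ≤ 1/2 enter: a bad point is within 3R/(2n) of the midpoint, its window
      -- adds at most R/(2n), and the total 2R/n is the radius in the multiplicity bound.
      have h4 : β / n ≤ R / n / 2 := by
        rw [div_div, mul_comm (n : ℝ) 2, ← div_div]; gcongr; linarith
      have h5 : 3 * R / n / 2 + R / n / 2 = 2 * R / n := by ring
      push_cast
      rw [abs_lt]
      constructor <;> linarith
    exact_mod_cast this
  have hsum : Real.exp (-13 / 2) * (β / n) * S.card ≤ 6 * ∫ t in Ioc 0 (4 * Real.pi), density β v t := by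
    calc Real.exp (-13 / 2) * (β / n) * S.card
        = ∑ i ∈ S, Real.exp (-13 / 2) * (β / n) := by rw [Finset.sum_const, nsmul_eq_mul, mul_comm]
      _ ≤ ∑ i ∈ S, ∫ t in Ioc 0 (4 * Real.pi), (I i).indicator (density β v) t :=
          Finset.sum_le_sum fun i hi => (hloc i hi).trans_eq (hint i)
      _ = ∫ t in Ioc 0 (4 * Real.pi), ∑ i ∈ S, (I i).indicator (density β v) t := by
          rw [integral_finsetSum _ fun i _ => hDi.indicator measurableSet_Ioc]
      _ ≤ ∫ t in Ioc 0 (4 * Real.pi), 6 * density β v t :=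
          integral_mono (integrable_finsetSum _ fun i _ => hDi.indicator measurableSet_Ioc)
            (hDi.const_mul 6) hpt
      _ = _ := integral_const_mul _ _
  have hdouble : ∫ t in Ioc 0 (4 * Real.pi), density β v t = 2 * detector β v := by
    rw [← intervalIntegral.integral_of_le (by positivity), ← intervalIntegral.integral_add_adjacent_intervals
      (hDc.intervalIntegrable 0 (2 * Real.pi)) (hDc.intervalIntegrable _ _)]
    have := (density_periodic β v).intervalIntegral_add_eq (2 * Real.pi) 0
    rw [zero_add, show 2 * Real.pi + 2 * Real.pi = 4 * Real.pi by ring] at this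
    rw [this, detector]; ring
  rw [hdouble] at hsum
  have h7 : Real.exp (-13 / 2) * (β / n) * (δ * n) ≤ Real.exp (-13 / 2) * (β / n) * S.card := by
    gcongr
  have h8 : Real.exp (-13 / 2) * (β / n) * (δ * n) = Real.exp (-13 / 2) * (δ * β) := by
    field_simp
  linarith

end
/-! ### Derivatives of the functional -/

theorem hasDerivAt_gauss (y : ℝ) : HasDerivAt gauss (-y * gauss y) y := by
  have h : HasDerivAt (fun y : ℝ => -y ^ 2 / 2) (-y) y := by
    have := ((hasDerivAt_pow 2 y).neg).div_const 2
    refine this.congr_deriv ?_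
    simp only [Nat.add_one_sub_one, pow_one]
    push_cast
    ring
  refine h.exp.congr_deriv ?_
  rw [gauss]; ring

theorem hasDerivAt_neg_mul_gauss (y : ℝ) :
    HasDerivAt (fun y => -y * gauss y) ((y ^ 2 - 1) * gauss y) y := by
  refine ((hasDerivAt_id y).neg.mul (hasDerivAt_gauss y)).congr_deriv ?_
  simp; ring

/-- From exp t ≥ 1 + t + t²/2 at t = y²/2; bounds on the derivatives of the cut-off thus become
polynomial inequalities. -/
theorem gauss_mul_le {y P : ℝ} (h : P ≤ 1 + y ^ 2 / 2 + (y ^ 2 / 2) ^ 2 / 2) : P * gauss y ≤ 1 := by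
  have h1 := Real.quadratic_le_exp_of_nonneg (x := y ^ 2 / 2) (by positivity)
  have h2 : gauss y = (Real.exp (y ^ 2 / 2))⁻¹ := by rw [gauss, ← Real.exp_neg]; congr 1; ring
  rw [h2, ← div_eq_mul_inv, div_le_one (Real.exp_pos _)]
  linarith

theorem abs_neg_mul_gauss_le (y : ℝ) : |-y * gauss y| ≤ 1 := by
  rw [abs_mul, abs_neg, abs_of_pos (gauss_pos y)]
  refine gauss_mul_le ?_
  rw [← sq_abs y]
  nlinarith [sq_nonneg (|y| - 1), sq_nonneg (|y| ^ 2)]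

theorem abs_sq_sub_one_mul_gauss_le (y : ℝ) : |(y ^ 2 - 1) * gauss y| ≤ 1 := by
  rw [abs_mul, abs_of_pos (gauss_pos y)]
  refine gauss_mul_le ?_
  rw [abs_le']
  constructor <;> nlinarith [sq_nonneg (y ^ 2 - 2), sq_nonneg y]

theorem hasDerivAt_japanese (z : ℝ) : HasDerivAt japanese (z / japanese z) z := by
  have h1 : HasDerivAt (fun x : ℝ => 1 + x ^ 2) (2 * z) z := by
    simpa using (hasDerivAt_pow 2 z).const_add 1
  refine (h1.sqrt (by positivity)).congr_deriv ?_
  rw [japanese]; field_simp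

theorem hasDerivAt_div_japanese (z : ℝ) :
    HasDerivAt (fun z => z / japanese z) (1 / japanese z ^ 3) z := by
  have h := (japanese_pos z).ne'
  refine ((hasDerivAt_id z).div (hasDerivAt_japanese z) h).congr_deriv ?_
  have := japanese_sq z
  simp only [id]
  field_simp
  linear_combination this

theorem abs_div_japanese_le (z : ℝ) : |z / japanese z| ≤ 1 := by
  rw [abs_div, abs_of_pos (japanese_pos z)]
  exact div_le_one_of_le₀ (abs_le_japanese z) (japanese_pos z).le

theorem abs_one_div_japanese_cube_le (z : ℝ) : |1 / japanese z ^ 3| ≤ 1 := by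
  rw [abs_of_pos (by have := japanese_pos z; positivity)]
  exact div_le_one_of_le₀ (one_le_pow₀ (one_le_japanese z)) (by have := japanese_pos z; positivity)

theorem japanese_add_le (y z : ℝ) : japanese (y + z) ≤ japanese y + |z| := by
  refine Real.sqrt_le_iff.2 ⟨by have := japanese_pos y; positivity, ?_⟩
  have h1 := abs_le_japanese y
  have h2 : y * z ≤ japanese y * |z| := (le_abs_self _).trans (by rw [abs_mul]; gcongr)
  nlinarith [japanese_sq y, sq_abs z]

section
/-! The integrand along a line, as a function of one real variable. -/

variable (a p b q c r : ℝ)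

noncomputable def lineFun (t : ℝ) : ℝ :=
  gauss (a + t * p) * gauss (b + t * q) * japanese (c + t * r)

noncomputable def lineFunDeriv (t : ℝ) : ℝ :=
  -(a + t * p) * gauss (a + t * p) * p * gauss (b + t * q) * japanese (c + t * r) +
  gauss (a + t * p) * (-(b + t * q) * gauss (b + t * q) * q) * japanese (c + t * r) +
  gauss (a + t * p) * gauss (b + t * q) * ((c + t * r) / japanese (c + t * r) * r)

noncomputable def lineFunDeriv2 (t : ℝ) : ℝ :=
  (((a + t * p) ^ 2 - 1) * gauss (a + t * p)) * gauss (b + t * q) * japanese (c + t * r) * (p * p) +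
  gauss (a + t * p) * (((b + t * q) ^ 2 - 1) * gauss (b + t * q)) * japanese (c + t * r) * (q * q) +
  gauss (a + t * p) * gauss (b + t * q) * (1 / japanese (c + t * r) ^ 3) * (r * r) +
  2 * ((-(a + t * p) * gauss (a + t * p)) * (-(b + t * q) * gauss (b + t * q)) *
    japanese (c + t * r) * (p * q)) +
  2 * ((-(a + t * p) * gauss (a + t * p)) * gauss (b + t * q) *
    ((c + t * r) / japanese (c + t * r)) * (p * r)) +
  2 * (gauss (a + t * p) * (-(b + t * q) * gauss (b + t * q)) *
    ((c + t * r) / japanese (c + t * r)) * (q * r))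

theorem hasDerivAt_line (a p t : ℝ) : HasDerivAt (fun t => a + t * p) p t := by
  simpa using ((hasDerivAt_id t).mul_const p).const_add a

theorem hasDerivAt_lineFun (t : ℝ) :
    HasDerivAt (lineFun a p b q c r) (lineFunDeriv a p b q c r t) t := by
  have h1 := (hasDerivAt_gauss (a + t * p)).comp t (hasDerivAt_line a p t)
  have h2 := (hasDerivAt_gauss (b + t * q)).comp t (hasDerivAt_line b q t)
  have h3 := (hasDerivAt_japanese (c + t * r)).comp t (hasDerivAt_line c r t)
  refine ((h1.mul h2).mul h3).congr_deriv ?_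
  simp only [lineFunDeriv, Function.comp_def, Pi.mul_apply]
  ring

theorem hasDerivAt_lineFunDeriv (t : ℝ) :
    HasDerivAt (lineFunDeriv a p b q c r) (lineFunDeriv2 a p b q c r t) t := by
  have h1 := (hasDerivAt_gauss (a + t * p)).comp t (hasDerivAt_line a p t)
  have h2 := (hasDerivAt_gauss (b + t * q)).comp t (hasDerivAt_line b q t)
  have h3 := (hasDerivAt_japanese (c + t * r)).comp t (hasDerivAt_line c r t)
  have k1 := (hasDerivAt_neg_mul_gauss (a + t * p)).comp t (hasDerivAt_line a p t)
  have k2 := (hasDerivAt_neg_mul_gauss (b + t * q)).comp t (hasDerivAt_line b q t)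
  have k3 := (hasDerivAt_div_japanese (c + t * r)).comp t (hasDerivAt_line c r t)
  refine ((((k1.mul_const p).mul h2).mul h3).add ((h1.mul (k2.mul_const q)).mul h3) |>.add
    ((h1.mul h2).mul (k3.mul_const r))).congr_deriv ?_
  simp only [lineFunDeriv2, Function.comp_def, Pi.mul_apply]
  ring

variable {a p b q c r}

theorem abs_mul₄_le {A B C K : ℝ} (hA : |A| ≤ 1) (hB : |B| ≤ 1) (hC : |C| ≤ K) (d : ℝ) :
    |A * B * C * d| ≤ K * |d| := by
  rw [abs_mul, abs_mul, abs_mul]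
  refine mul_le_mul_of_nonneg_right ?_ (abs_nonneg d)
  calc |A| * |B| * |C| ≤ 1 * |C| := by
        gcongr; exact mul_le_one₀ hA (abs_nonneg _) hB
    _ ≤ K := by rwa [one_mul]

theorem abs_gauss_le (y : ℝ) : |gauss y| ≤ 1 := by rw [abs_of_pos (gauss_pos y)]; exact gauss_le_one y

theorem abs_japanese (y : ℝ) : |japanese y| = japanese y := abs_of_pos (japanese_pos y)

theorem abs_lineFunDeriv_le (t : ℝ) :
    |lineFunDeriv a p b q c r t| ≤ japanese (c + t * r) * (|p| + |q| + |r|) := by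
  have e : lineFunDeriv a p b q c r t =
      (-(a + t * p) * gauss (a + t * p)) * gauss (b + t * q) * japanese (c + t * r) * p +
      gauss (a + t * p) * (-(b + t * q) * gauss (b + t * q)) * japanese (c + t * r) * q +
      gauss (a + t * p) * gauss (b + t * q) * ((c + t * r) / japanese (c + t * r)) * r := by
    rw [lineFunDeriv]; ring
  rw [e]
  refine (abs_add_three _ _ _).trans ?_
  have h1 := abs_mul₄_le (abs_neg_mul_gauss_le (a + t * p)) (abs_gauss_le (b + t * q))
    (abs_japanese (c + t * r)).le p
  have h2 := abs_mul₄_le (abs_gauss_le (a + t * p)) (abs_neg_mul_gauss_le (b + t * q))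
    (abs_japanese (c + t * r)).le q
  have h3 := abs_mul₄_le (abs_gauss_le (a + t * p)) (abs_gauss_le (b + t * q))
    ((abs_div_japanese_le (c + t * r)).trans (one_le_japanese (c + t * r))) r
  linarith

/-- Every factor other than the weight has modulus at most 1, and the six terms of the product rule
carry exactly the coefficients of the expanded square. -/
theorem abs_lineFunDeriv2_le (t : ℝ) :
    |lineFunDeriv2 a p b q c r t| ≤ japanese (c + t * r) * (|p| + |q| + |r|) ^ 2 := by
  have hj := (abs_japanese (c + t * r)).le
  have h1 := abs_mul₄_le (abs_sq_sub_one_mul_gauss_le (a + t * p)) (abs_gauss_le (b + t * q)) hj (p * p)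
  have h2 := abs_mul₄_le (abs_gauss_le (a + t * p)) (abs_sq_sub_one_mul_gauss_le (b + t * q)) hj (q * q)
  have h3 := abs_mul₄_le (abs_gauss_le (a + t * p)) (abs_gauss_le (b + t * q))
    ((abs_one_div_japanese_cube_le (c + t * r)).trans (one_le_japanese (c + t * r))) (r * r)
  have h4 := abs_mul₄_le (abs_neg_mul_gauss_le (a + t * p)) (abs_neg_mul_gauss_le (b + t * q)) hj (p * q)
  have hd := (abs_div_japanese_le (c + t * r)).trans (one_le_japanese (c + t * r))
  have h5 := abs_mul₄_le (abs_neg_mul_gauss_le (a + t * p)) (abs_gauss_le (b + t * q)) hd (p * r)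
  have h6 := abs_mul₄_le (abs_gauss_le (a + t * p)) (abs_neg_mul_gauss_le (b + t * q)) hd (q * r)
  rw [lineFunDeriv2]
  have two : ∀ x : ℝ, |2 * x| = 2 * |x| := fun x => by rw [abs_mul, abs_two]
  refine (abs_add_le _ _).trans ?_
  refine (add_le_add_left ((abs_add_le _ _).trans (add_le_add_left ((abs_add_le _ _).trans
    (add_le_add_left (abs_add_three _ _ _) _)) _)) _).trans ?_
  rw [two, two, two]
  have e : japanese (c + t * r) * (|p| + |q| + |r|) ^ 2 =
    japanese (c + t * r) * (|p| * |p|) + japanese (c + t * r) * (|q| * |q|) +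
    japanese (c + t * r) * (|r| * |r|) + 2 * (japanese (c + t * r) * (|p| * |q|)) +
    2 * (japanese (c + t * r) * (|p| * |r|)) + 2 * (japanese (c + t * r) * (|q| * |r|)) := by ring
  simp only [← abs_mul] at e
  rw [e]
  linarith

end

open Set in
theorem hasDerivAt_intervalIntegral_of_continuous {F F' : ℝ → ℝ → ℝ}
    (hF : ∀ t x, HasDerivAt (fun t => F t x) (F' t x) t) (cF : ∀ t, Continuous (F t))
    (cF' : Continuous (Function.uncurry F')) (a b t₀ : ℝ) :
    HasDerivAt (fun t => ∫ x in a..b, F t x) (∫ x in a..b, F' t₀ x) t₀ := by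
  obtain ⟨C, hC⟩ := ((isCompact_closedBall t₀ 1).prod (isCompact_uIcc (a := a) (b := b))).exists_bound_of_continuousOn
    cF'.continuousOn
  refine (intervalIntegral.hasDerivAt_integral_of_dominated_loc_of_deriv_le (bound := fun _ => C)
    (Metric.ball_mem_nhds t₀ one_pos) (Filter.Eventually.of_forall fun t => (cF t).aestronglyMeasurable)
    ((cF t₀).intervalIntegrable _ _) ?_ ?_ (by simp) ?_).2
  · exact (cF'.comp (by fun_prop : Continuous fun x => (t₀, x))).aestronglyMeasurable
  · refine Filter.Eventually.of_forall fun x hx t ht => ?_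
    exact hC (t, x) ⟨Metric.ball_subset_closedBall ht, uIoc_subset_uIcc hx⟩
  · exact Filter.Eventually.of_forall fun x _ t _ => hF t x

/-! ### Gradient and second-order bounds for the detector -/

section
variable {n : ℕ}

/-- The derivative of the functional at `v` in the direction `w`. -/
noncomputable def detectorDeriv (β : ℝ) (v w : Fin n ⊕ Fin n → ℝ) : ℝ :=
  ∫ x in (0 : ℝ)..(2 * Real.pi), lineFunDeriv (trigDeriv 0 v x / β ^ 2) (trigDeriv 0 w x / β ^ 2)
    (trigDeriv 1 v x / β) (trigDeriv 1 w x / β) (trigDeriv 2 v x) (trigDeriv 2 w x) 0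

/-- The normalized square of the Euclidean norm of a coefficient vector. -/
noncomputable def energy (v : Fin n ⊕ Fin n → ℝ) : ℝ := 1 / n * ∑ j, v j ^ 2

theorem energy_nonneg (v : Fin n ⊕ Fin n → ℝ) : 0 ≤ energy v := by
  unfold energy; positivity

theorem continuous_energy : Continuous (energy (n := n)) := by unfold energy; fun_prop

theorem trigDeriv_single (p : ℕ) (j : Fin n ⊕ Fin n) (x : ℝ) :
    trigDeriv p (Pi.single j 1) x = trigBasis p j x := by
  simp [trigDeriv, Pi.single_apply]

theorem density_add_smul (β : ℝ) (v w : Fin n ⊕ Fin n → ℝ) (t x : ℝ) :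
    density β (v + t • w) x = lineFun (trigDeriv 0 v x / β ^ 2) (trigDeriv 0 w x / β ^ 2)
      (trigDeriv 1 v x / β) (trigDeriv 1 w x / β) (trigDeriv 2 v x) (trigDeriv 2 w x) t := by
  simp only [density, lineFun, trigDeriv_add_smul, add_div, mul_div_assoc]

theorem lineFunDeriv_shift (a p b q c r t : ℝ) : lineFunDeriv (a + t * p) p (b + t * q) q (c + t * r) r 0 =
    lineFunDeriv a p b q c r t := by
  simp [lineFunDeriv]

theorem continuous_lineFunDeriv {α : Type*} [TopologicalSpace α] {a p b q c r t : α → ℝ}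
    (ha : Continuous a) (hp : Continuous p) (hb : Continuous b) (hq : Continuous q)
    (hc : Continuous c) (hr : Continuous r) (ht : Continuous t) :
    Continuous fun x => lineFunDeriv (a x) (p x) (b x) (q x) (c x) (r x) (t x) := by
  unfold lineFunDeriv
  have h : Continuous fun x => (c x + t x * r x) / japanese (c x + t x * r x) :=
    Continuous.div (by fun_prop) (by fun_prop) fun x => (japanese_pos _).ne'
  fun_prop

theorem detectorDeriv_add_smul (β : ℝ) (v w : Fin n ⊕ Fin n → ℝ) (t : ℝ) :
    detectorDeriv β (v + t • w) w = ∫ x in (0 : ℝ)..(2 * Real.pi),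
      lineFunDeriv (trigDeriv 0 v x / β ^ 2) (trigDeriv 0 w x / β ^ 2)
      (trigDeriv 1 v x / β) (trigDeriv 1 w x / β) (trigDeriv 2 v x) (trigDeriv 2 w x) t := by
  unfold detectorDeriv
  congr 1; funext x
  simp only [trigDeriv_add_smul, add_div, mul_div_assoc]
  exact lineFunDeriv_shift _ _ _ _ _ _ _

theorem hasDerivAt_detector (β : ℝ) (v w : Fin n ⊕ Fin n → ℝ) (t : ℝ) :
    HasDerivAt (fun t => detector β (v + t • w)) (detectorDeriv β (v + t • w) w) t := by
  rw [detectorDeriv_add_smul]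
  simp only [detector, density_add_smul]
  refine hasDerivAt_intervalIntegral_of_continuous (fun t x => hasDerivAt_lineFun _ _ _ _ _ _ t)
    (fun t => ?_) ?_ _ _ t
  · unfold lineFun; fun_prop
  · exact continuous_lineFunDeriv (by fun_prop) (by fun_prop) (by fun_prop) (by fun_prop)
      (by fun_prop) (by fun_prop) (by fun_prop)

theorem continuous_detectorDeriv (β : ℝ) (w : Fin n ⊕ Fin n → ℝ) :
    Continuous fun v => detectorDeriv β v w :=
  intervalIntegral.continuous_parametric_intervalIntegral_of_continuous'
    (continuous_lineFunDeriv (by fun_prop) (by fun_prop) (by fun_prop) (by fun_prop)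
      (by fun_prop) (by fun_prop) (by fun_prop)) _ _

/-- The derivative of the integrand at 0 is linear in the direction. Pairing the gradient with
itself therefore gives its squared norm as a single directional derivative. -/
theorem detectorDeriv_eq_sum (β : ℝ) (v w : Fin n ⊕ Fin n → ℝ) :
    detectorDeriv β v w = ∑ j, w j * detectorDeriv β v (Pi.single j 1) := by
  unfold detectorDeriv
  simp_rw [← intervalIntegral.integral_const_mul]
  have hi : ∀ j, IntervalIntegrable (fun x => w j * lineFunDeriv (trigDeriv 0 v x / β ^ 2)
      (trigDeriv 0 (Pi.single j 1) x / β ^ 2) (trigDeriv 1 v x / β)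
      (trigDeriv 1 (Pi.single j 1) x / β) (trigDeriv 2 v x) (trigDeriv 2 (Pi.single j 1) x) 0)
      volume 0 (2 * Real.pi) := fun j => Continuous.intervalIntegrable
    (continuous_const.mul (continuous_lineFunDeriv (by fun_prop) (by fun_prop) (by fun_prop)
      (by fun_prop) (by fun_prop) (by fun_prop) (by fun_prop))) _ _
  rw [← intervalIntegral.integral_finsetSum fun j _ => hi j]
  congr 1; funext x
  simp only [trigDeriv_single]
  have lin : ∀ a p b q c r : ℝ, lineFunDeriv a p b q c r 0 =
      (-a * gauss a * gauss b * japanese c) * p + (gauss a * (-b * gauss b) * japanese c) * q +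
      (gauss a * gauss b * (c / japanese c)) * r := fun a p b q c r => by
    simp only [lineFunDeriv, zero_mul, add_zero]; ring
  simp only [lin]
  simp only [mul_add, Finset.sum_add_distrib]
  have e : ∀ (A : ℝ) (f : Fin n ⊕ Fin n → ℝ), ∑ j, w j * (A * f j) = A * ∑ j, w j * f j := fun A f => by
    rw [Finset.mul_sum]; exact Finset.sum_congr rfl fun j _ => by ring
  rw [e, e, e]
  have e2 : ∀ (p : ℕ) (B : ℝ), ∑ j, w j * (trigBasis p j x / B) = trigDeriv p w x / B := fun p B => by
    rw [trigDeriv, Finset.sum_div]; exact Finset.sum_congr rfl fun j _ => by ring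
  rw [e2, e2]
  rfl

theorem integral_japanese_sq_le (v : Fin n ⊕ Fin n → ℝ) :
    ∫ x in (0 : ℝ)..(2 * Real.pi), japanese (trigDeriv 2 v x) ^ 2 ≤ 2 * Real.pi * (1 + energy v) := by
  simp only [japanese_sq]
  rw [intervalIntegral.integral_add (by simp) (Continuous.intervalIntegrable (by fun_prop) _ _)]
  have := integral_trigDeriv_sq_le 2 v
  simp only [intervalIntegral.integral_const, sub_zero, smul_eq_mul, mul_one]
  unfold energy
  have e : 2 * Real.pi * (1 + 1 / n * ∑ j, v j ^ 2) = 2 * Real.pi + 2 * Real.pi / n * ∑ j, v j ^ 2 := by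
    ring
  rw [e]
  linarith

theorem integral_japanese_le (v : Fin n ⊕ Fin n → ℝ) :
    ∫ x in (0 : ℝ)..(2 * Real.pi), japanese (trigDeriv 2 v x) ≤ 2 * Real.pi * (1 + energy v) := by
  refine le_trans ?_ (integral_japanese_sq_le v)
  refine intervalIntegral.integral_mono_on Real.two_pi_pos.le
    (Continuous.intervalIntegrable (by fun_prop) _ _)
    (Continuous.intervalIntegrable (by fun_prop) _ _) fun x _ => ?_
  nlinarith [one_le_japanese (trigDeriv 2 v x)]

theorem detector_le (β : ℝ) (v : Fin n ⊕ Fin n → ℝ) : detector β v ≤ 2 * Real.pi * (1 + energy v) := by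
  refine le_trans ?_ (integral_japanese_le v)
  exact intervalIntegral.integral_mono_on Real.two_pi_pos.le
    ((continuous_density_right β v).intervalIntegrable _ _)
    (Continuous.intervalIntegrable (by fun_prop) _ _) fun x _ => density_le β v x

theorem div_add_div_add_le {β : ℝ} (hβ : 0 < β) (hβ1 : β ≤ 1) (A B C : ℝ) :
    |A / β ^ 2| + |B / β| + |C| ≤ (|A| + |B| + |C|) / β ^ 2 := by
  have h1 : β ^ 2 ≤ β := by nlinarith
  have h2 : β ^ 2 ≤ 1 := by nlinarith
  have h3 : 0 < β ^ 2 := by positivity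
  rw [add_div, add_div, abs_div, abs_div, abs_of_pos h3, abs_of_pos hβ]
  gcongr
  rw [le_div_iff₀ h3]
  exact mul_le_of_le_one_right (abs_nonneg _) h2

/-- The square of the Euclidean norm of the gradient. -/
theorem sum_detectorDeriv_sq_le {β : ℝ} (hβ : 0 < β) (hβ1 : β ≤ 1) (hn : 0 < n)
    (v : Fin n ⊕ Fin n → ℝ) :
    ∑ j, detectorDeriv β v (Pi.single j 1) ^ 2 ≤ 36 * Real.pi ^ 2 * (1 + energy v) / (β ^ 4 * n) := by
  have hn' : (0 : ℝ) < n := by exact_mod_cast hn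
  -- Duality: the direction is the gradient itself, and orthogonality bounds the mean squares of the
  -- derivatives of the resulting polynomial by the very sum `S` to be estimated.
  set w : Fin n ⊕ Fin n → ℝ := fun j => detectorDeriv β v (Pi.single j 1) with hw
  set S := ∑ j, w j ^ 2 with hS
  have hSw : S = detectorDeriv β v w := by
    rw [detectorDeriv_eq_sum]; exact Finset.sum_congr rfl fun j _ => by rw [sq]
  -- The Young parameter for which the terms containing `S` on the right add up to S/2 and can be
  -- absorbed.
  set s : ℝ := 6 * Real.pi / (β ^ 2 * n) with hs
  have hs0 : 0 < s := by positivity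
  have hJ := integral_japanese_sq_le v
  have hT := fun p => integral_trigDeriv_sq_le p w
  set J := ∫ x in (0 : ℝ)..(2 * Real.pi), japanese (trigDeriv 2 v x) ^ 2 with hJdef
  have hint : ∀ p, IntervalIntegrable (fun x => trigDeriv p w x ^ 2) volume 0 (2 * Real.pi) :=
    fun p => Continuous.intervalIntegrable (by fun_prop) _ _
  have hintJ : IntervalIntegrable (fun x => japanese (trigDeriv 2 v x) ^ 2) volume 0 (2 * Real.pi) :=
    Continuous.intervalIntegrable (by fun_prop) _ _
  have key : S ≤ 1 / β ^ 2 * (3 * s / 2 * J + 1 / (2 * s) *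
      ((∫ x in (0 : ℝ)..(2 * Real.pi), trigDeriv 0 w x ^ 2) +
      (∫ x in (0 : ℝ)..(2 * Real.pi), trigDeriv 1 w x ^ 2) +
      ∫ x in (0 : ℝ)..(2 * Real.pi), trigDeriv 2 w x ^ 2)) := by
    rw [hSw, hJdef, ← intervalIntegral.integral_add (hint 0) (hint 1),
      ← intervalIntegral.integral_add ((hint 0).add (hint 1)) (hint 2),
      ← intervalIntegral.integral_const_mul, ← intervalIntegral.integral_const_mul,
      ← intervalIntegral.integral_add (hintJ.const_mul _) ((((hint 0).add (hint 1)).add (hint 2)).const_mul _),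
      ← intervalIntegral.integral_const_mul]
    refine intervalIntegral.integral_mono_on Real.two_pi_pos.le
      (Continuous.intervalIntegrable (continuous_lineFunDeriv (by fun_prop) (by fun_prop)
        (by fun_prop) (by fun_prop) (by fun_prop) (by fun_prop) (by fun_prop)) _ _)
      (Continuous.intervalIntegrable (by fun_prop) _ _) fun x _ => ?_
    refine (le_abs_self _).trans ((abs_lineFunDeriv_le 0).trans ?_)
    rw [zero_mul, add_zero]
    set ω := japanese (trigDeriv 2 v x) with hω
    have hω0 : 0 < ω := japanese_pos _
    have hyoung : ∀ y : ℝ, ω * |y| ≤ s / 2 * ω ^ 2 + 1 / (2 * s) * y ^ 2 := fun y => by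
      have : 0 ≤ (s * ω - |y|) ^ 2 / (2 * s) := by positivity
      have e : (s * ω - |y|) ^ 2 / (2 * s) = s / 2 * ω ^ 2 + 1 / (2 * s) * |y| ^ 2 - ω * |y| := by
        field_simp; ring
      rw [sq_abs] at e
      linarith
    calc _ ≤ ω * ((|trigDeriv 0 w x| + |trigDeriv 1 w x| + |trigDeriv 2 w x|) / β ^ 2) := by
          gcongr; exact div_add_div_add_le hβ hβ1 _ _ _
      _ = 1 / β ^ 2 * (ω * |trigDeriv 0 w x| + ω * |trigDeriv 1 w x| + ω * |trigDeriv 2 w x|) := by ring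
      _ ≤ _ := by
          refine mul_le_mul_of_nonneg_left ?_ (by positivity)
          linarith [hyoung (trigDeriv 0 w x), hyoung (trigDeriv 1 w x), hyoung (trigDeriv 2 w x)]
  have h2 : S ≤ 1 / β ^ 2 * (3 * s / 2 * (2 * Real.pi * (1 + energy v)) + 1 / (2 * s) *
      (2 * Real.pi / n * S + 2 * Real.pi / n * S + 2 * Real.pi / n * S)) := by
    refine key.trans ?_
    gcongr
    · exact hT 0
    · exact hT 1
    · exact hT 2
  have h3 : 1 / β ^ 2 * (3 * s / 2 * (2 * Real.pi * (1 + energy v)) + 1 / (2 * s) *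
      (2 * Real.pi / n * S + 2 * Real.pi / n * S + 2 * Real.pi / n * S)) =
      18 * Real.pi ^ 2 * (1 + energy v) / (β ^ 4 * n) + S / 2 := by
    rw [hs]; field_simp; ring
  rw [h3] at h2
  have h4 : 36 * Real.pi ^ 2 * (1 + energy v) / (β ^ 4 * n) =
    2 * (18 * Real.pi ^ 2 * (1 + energy v) / (β ^ 4 * n)) := by ring
  rw [h4]
  linarith

/-- A Lipschitz bound for the partial derivatives. -/
theorem abs_detectorDeriv_sub_le {β : ℝ} (hβ : 0 < β) (hβ1 : β ≤ 1) (v : Fin n ⊕ Fin n → ℝ)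
    (j : Fin n ⊕ Fin n) (t : ℝ) :
    |detectorDeriv β (v + t • Pi.single j 1) (Pi.single j 1) - detectorDeriv β v (Pi.single j 1)| ≤
      |t| * (9 / (β ^ 4 * n) * (2 * Real.pi * (1 + energy v) + 2 * Real.pi * |t|)) := by
  have hn : 0 < n := by rcases j with k | k <;> exact k.pos
  have hn' : (0 : ℝ) < n := by exact_mod_cast hn
  have hn1 : (1 : ℝ) ≤ n := by exact_mod_cast hn
  have hB : ∀ p x, |trigDeriv p (Pi.single j 1) x| ≤ 1 / Real.sqrt n := fun p x => by
    rw [trigDeriv_single]; exact abs_trigBasis_le p j x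
  have hs1 : 1 / Real.sqrt n ≤ 1 := by
    rw [div_le_one (by positivity)]; exact Real.one_le_sqrt.2 hn1
  rw [detectorDeriv_add_smul]
  unfold detectorDeriv
  have hci : ∀ t : ℝ, IntervalIntegrable (fun x => lineFunDeriv (trigDeriv 0 v x / β ^ 2)
      (trigDeriv 0 (Pi.single j 1) x / β ^ 2) (trigDeriv 1 v x / β)
      (trigDeriv 1 (Pi.single j 1) x / β) (trigDeriv 2 v x) (trigDeriv 2 (Pi.single j 1) x) t)
      volume 0 (2 * Real.pi) := fun t =>
    Continuous.intervalIntegrable (continuous_lineFunDeriv (by fun_prop) (by fun_prop)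
        (by fun_prop) (by fun_prop) (by fun_prop) (by fun_prop) (by fun_prop)) _ _
  rw [← intervalIntegral.integral_sub (hci t) (hci 0)]
  have hpt : ∀ x, ‖lineFunDeriv (trigDeriv 0 v x / β ^ 2)
      (trigDeriv 0 (Pi.single j 1) x / β ^ 2) (trigDeriv 1 v x / β)
      (trigDeriv 1 (Pi.single j 1) x / β) (trigDeriv 2 v x) (trigDeriv 2 (Pi.single j 1) x) t -
      lineFunDeriv (trigDeriv 0 v x / β ^ 2)
      (trigDeriv 0 (Pi.single j 1) x / β ^ 2) (trigDeriv 1 v x / β)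
      (trigDeriv 1 (Pi.single j 1) x / β) (trigDeriv 2 v x) (trigDeriv 2 (Pi.single j 1) x) 0‖ ≤
      |t| * (9 / (β ^ 4 * n)) * (japanese (trigDeriv 2 v x) + |t|) := fun x => by
    have hmv := Convex.norm_image_sub_le_of_norm_hasDerivWithin_le
      (f := lineFunDeriv (trigDeriv 0 v x / β ^ 2)
      (trigDeriv 0 (Pi.single j 1) x / β ^ 2) (trigDeriv 1 v x / β)
      (trigDeriv 1 (Pi.single j 1) x / β) (trigDeriv 2 v x) (trigDeriv 2 (Pi.single j 1) x))
      (s := Set.Icc (-|t|) |t|) (x := 0) (y := t)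
      (C := (japanese (trigDeriv 2 v x) + |t|) * (9 / (β ^ 4 * n)))
      (fun s _ => (hasDerivAt_lineFunDeriv _ _ _ _ _ _ s).hasDerivWithinAt) (fun s hs => ?_)
      (convex_Icc _ _) ⟨by simp, by simp⟩ ⟨neg_abs_le t, le_abs_self t⟩
    · rw [sub_zero, Real.norm_eq_abs t] at hmv
      calc _ ≤ _ := hmv
        _ = _ := by ring
    · rw [Real.norm_eq_abs]
      refine (abs_lineFunDeriv2_le s).trans ?_
      have hs' : |s| ≤ |t| := abs_le.2 hs
      have hj : japanese (trigDeriv 2 v x + s * trigDeriv 2 (Pi.single j 1) x) ≤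
          japanese (trigDeriv 2 v x) + |t| := by
        refine (japanese_add_le _ _).trans ?_
        rw [abs_mul]
        gcongr
        calc |s| * |trigDeriv 2 (Pi.single j 1) x| ≤ |t| * 1 := by
              gcongr; exact (hB 2 x).trans hs1
          _ = |t| := mul_one _
      -- Along a coordinate each normalized derivative of the direction is at most 1/√n, and
      -- dividing by β² at worst gives (3/(β²√n))².
      have hsq : (|trigDeriv 0 (Pi.single j 1) x / β ^ 2| + |trigDeriv 1 (Pi.single j 1) x / β| +
          |trigDeriv 2 (Pi.single j 1) x|) ^ 2 ≤ 9 / (β ^ 4 * n) := by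
        calc _ ≤ ((1 / Real.sqrt n + 1 / Real.sqrt n + 1 / Real.sqrt n) / β ^ 2) ^ 2 := by
              gcongr
              refine (div_add_div_add_le hβ hβ1 _ _ _).trans ?_
              gcongr
              · exact hB 0 x
              · exact hB 1 x
              · exact hB 2 x
          _ = 9 * (1 / Real.sqrt n) ^ 2 / β ^ 4 := by ring
          _ = 9 / (β ^ 4 * n) := by
              rw [div_pow, Real.sq_sqrt hn'.le]; field_simp
      exact mul_le_mul hj hsq (by positivity) (by have := japanese_pos (trigDeriv 2 v x); positivity)
  have hcJ : IntervalIntegrable (fun x => japanese (trigDeriv 2 v x)) volume 0 (2 * Real.pi) :=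
    Continuous.intervalIntegrable (by fun_prop) _ _
  have h1 := intervalIntegral.norm_integral_le_of_norm_le Real.two_pi_pos.le
    (Filter.Eventually.of_forall fun x _ => hpt x)
    ((hcJ.add intervalIntegrable_const).const_mul _)
  rw [Real.norm_eq_abs, intervalIntegral.integral_const_mul,
    intervalIntegral.integral_add hcJ intervalIntegrable_const, intervalIntegral.integral_const, sub_zero,
    smul_eq_mul] at h1
  refine h1.trans ?_
  rw [mul_assoc |t|]
  gcongr
  exact integral_japanese_le v

end
/-! ### Concentration of the functional -/

/-- The entropy method asks for bounds at every vector, not almost every one. Clamping the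
coordinates to the support bound provides them and almost surely changes nothing. -/
noncomputable def clamp (c x : ℝ) : ℝ := max (-c) (min c x)

theorem continuous_clamp (c : ℝ) : Continuous (clamp c) := by unfold clamp; fun_prop

theorem abs_clamp_le {c : ℝ} (hc : 0 ≤ c) (x : ℝ) : |clamp c x| ≤ c :=
  abs_le.2 ⟨le_max_left _ _, max_le (by linarith) (min_le_left _ _)⟩

theorem clamp_eq_self {c x : ℝ} (h : |x| ≤ c) : clamp c x = x := by
  rw [abs_le] at h
  rw [clamp, min_eq_right h.2, max_eq_right h.1]

theorem update_eq_add_smul {ι : Type*} [DecidableEq ι] (v : ι → ℝ) (j : ι) (t : ℝ) :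
    Function.update v j t = Function.update v j 0 + t • Pi.single j 1 := by
  funext i
  by_cases h : i = j
  · subst h; simp
  · simp [h]

section
variable {n : ℕ}

theorem energy_le_of_abs_le {c : ℝ} {v : Fin n ⊕ Fin n → ℝ} (hn : 0 < n) (h : ∀ j, |v j| ≤ c) :
    energy v ≤ 2 * c ^ 2 := by
  have hn' : (0 : ℝ) < n := by exact_mod_cast hn
  have : ∑ j, v j ^ 2 ≤ ∑ _j : Fin n ⊕ Fin n, c ^ 2 := Finset.sum_le_sum fun j _ => by
    rw [← sq_abs]; exact pow_le_pow_left₀ (abs_nonneg _) (h j) 2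
  rw [Finset.sum_const, Finset.card_univ, Fintype.card_sum, Fintype.card_fin, nsmul_eq_mul] at this
  push_cast at this
  rw [energy, one_div, inv_mul_le_iff₀ hn']
  linarith

/-- The constant governing the concentration for bounded coefficients. -/
noncomputable def boundedConst (c : ℝ) : ℝ :=
  8 * c ^ 2 * (36 * Real.pi ^ 2 * (1 + 2 * c ^ 2) +
    648 * c ^ 2 * (2 * Real.pi * (1 + 2 * c ^ 2) + 4 * Real.pi * c) ^ 2)

theorem boundedConst_pos {c : ℝ} (hc : 0 < c) : 0 < boundedConst c := by
  unfold boundedConst; positivity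

theorem abs_sub_le_mul_of_hasDerivAt {f f' : ℝ → ℝ} (hf : ∀ t, HasDerivAt f (f' t) t) {M h : ℝ}
    (hM : ∀ s, |s| ≤ |h| → |f' s| ≤ M) : |f h - f 0| ≤ |h| * M := by
  have := Convex.norm_image_sub_le_of_norm_hasDerivWithin_le (s := Set.Icc (-|h|) |h|) (x := 0)
    (y := h) (C := M) (fun s _ => (hf s).hasDerivWithinAt) (fun s hs => hM s (abs_le.2 hs))
    (convex_Icc _ _) ⟨by simp, by simp⟩ ⟨neg_abs_le h, le_abs_self h⟩
  rw [sub_zero, Real.norm_eq_abs, Real.norm_eq_abs, mul_comm] at this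
  exact this

/-- A first-order expansion for a jump of at most 2c, with the derivative taken at the starting
point; the squares then sum to the squared gradient at that one vector, up to the second-order
remainder. -/
theorem abs_detector_sub_le {β c : ℝ} (hβ : 0 < β) (hβ1 : β ≤ 1) (hn : 0 < n) (hc : 0 < c)
    {v : Fin n ⊕ Fin n → ℝ} (hv : ∀ j, |v j| ≤ c) (j : Fin n ⊕ Fin n) {h : ℝ} (hh : |h| ≤ 2 * c) :
    |detector β (v + h • Pi.single j 1) - detector β (v + (0 : ℝ) • Pi.single j 1)| ≤ 2 * c *
      (|detectorDeriv β v (Pi.single j 1)| + 2 * c * (9 / (β ^ 4 * n) *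
        (2 * Real.pi * (1 + 2 * c ^ 2) + 4 * Real.pi * c))) := by
  have hen := energy_le_of_abs_le hn hv
  have h2c : (0 : ℝ) ≤ 2 * c := by linarith
  refine (abs_sub_le_mul_of_hasDerivAt (fun t => hasDerivAt_detector β v (Pi.single j 1) t)
    (M := |detectorDeriv β v (Pi.single j 1)| + 2 * c * (9 / (β ^ 4 * n) *
      (2 * Real.pi * (1 + 2 * c ^ 2) + 4 * Real.pi * c))) (h := h) fun s hs => ?_).trans
    (mul_le_mul_of_nonneg_right hh (by positivity))
  have hs' : |s| ≤ 2 * c := hs.trans hh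
  have h1 := abs_detectorDeriv_sub_le hβ hβ1 v j s
  have h2 : |s| * (9 / (β ^ 4 * n) * (2 * Real.pi * (1 + energy v) + 2 * Real.pi * |s|)) ≤
      2 * c * (9 / (β ^ 4 * n) * (2 * Real.pi * (1 + 2 * c ^ 2) + 4 * Real.pi * c)) := by
    have h3 : 2 * Real.pi * |s| ≤ 4 * Real.pi * c := by nlinarith [Real.pi_pos]
    have := energy_nonneg v
    have h9 : 0 ≤ 9 / (β ^ 4 * n) := by positivity
    have h4 : 2 * Real.pi * (1 + energy v) ≤ 2 * Real.pi * (1 + 2 * c ^ 2) :=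
      mul_le_mul_of_nonneg_left (by linarith) Real.two_pi_pos.le
    exact mul_le_mul hs' (mul_le_mul_of_nonneg_left (by linarith) h9) (by positivity) h2c
  have h3 := abs_sub_abs_le_abs_sub (detectorDeriv β (v + s • Pi.single j 1) (Pi.single j 1))
    (detectorDeriv β v (Pi.single j 1))
  linarith

theorem detector_tail_of_bounded {ν : Measure ℝ} [IsProbabilityMeasure ν] {β c r : ℝ} (hβ : 0 < β)
    (hβ1 : β ≤ 1) (hn : 0 < n) (hc : 0 < c) (hν : ∀ᵐ x ∂ν, |x| ≤ c) (hr : 0 < r) :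
    (Measure.pi fun _ : Fin n ⊕ Fin n => ν).real {v | (∫ v, detector β v
      ∂(Measure.pi fun _ : Fin n ⊕ Fin n => ν)) + r ≤ detector β v} ≤
      Real.exp (-r ^ 2 * (β ^ 8 * n) / (4 * boundedConst c)) := by
  have hn' : (0 : ℝ) < n := by exact_mod_cast hn
  set μ := Measure.pi fun _ : Fin n ⊕ Fin n => ν with hμ
  set K : (Fin n ⊕ Fin n → ℝ) → (Fin n ⊕ Fin n → ℝ) := fun v i => clamp c (v i) with hK
  have hKc : Continuous K := by
    have := continuous_clamp c
    rw [hK]; fun_prop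
  have hKb : ∀ v j, |K v j| ≤ c := fun v j => abs_clamp_le hc.le _
  have hKae : ∀ᵐ v ∂μ, K v = v := by
    have : ∀ᵐ v ∂μ, ∀ i, |v i| ≤ c := ae_all_iff.2 fun i =>
      (measurePreserving_eval (fun _ : Fin n ⊕ Fin n => ν) i).quasiMeasurePreserving.ae hν
    filter_upwards [this] with v hv
    funext i
    exact clamp_eq_self (hv i)
  set b := 9 / (β ^ 4 * n) * (2 * Real.pi * (1 + 2 * c ^ 2) + 4 * Real.pi * c) with hb
  set D : Fin n ⊕ Fin n → (Fin n ⊕ Fin n → ℝ) → ℝ := fun j v =>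
    (2 * c * (|detectorDeriv β (K v) (Pi.single j 1)| + 2 * c * b)) ^ 2 with hD
  have hDc : ∀ j, Continuous (D j) := fun j => by
    have := (continuous_detectorDeriv β (Pi.single j 1)).comp hKc
    simp only [Function.comp_def] at this
    rw [hD]; fun_prop
  have hgrad : ∀ v, ∑ j, detectorDeriv β (K v) (Pi.single j 1) ^ 2 ≤
      36 * Real.pi ^ 2 * (1 + 2 * c ^ 2) / (β ^ 4 * n) := fun v => by
    refine (sum_detectorDeriv_sq_le hβ hβ1 hn (K v)).trans ?_
    gcongr
    exact energy_le_of_abs_le hn (hKb v)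
  set V := boundedConst c / (β ^ 8 * n) with hV
  have hV0 : 0 < V := div_pos (boundedConst_pos hc) (by positivity)
  have hDV : ∀ v, ∑ j, D j v ≤ V := fun v => by
    have h1 : ∀ j, D j v ≤ 8 * c ^ 2 * detectorDeriv β (K v) (Pi.single j 1) ^ 2 + 32 * c ^ 4 * b ^ 2 :=
      fun j => by
        simp only [hD]
        rw [← sq_abs (detectorDeriv β (K v) (Pi.single j 1))]
        nlinarith [mul_nonneg (sq_nonneg c) (sq_nonneg (|detectorDeriv β (K v) (Pi.single j 1)| - 2 * c * b))]
    calc ∑ j, D j v ≤ ∑ j, (8 * c ^ 2 * detectorDeriv β (K v) (Pi.single j 1) ^ 2 + 32 * c ^ 4 * b ^ 2) :=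
          Finset.sum_le_sum fun j _ => h1 j
      _ = 8 * c ^ 2 * ∑ j, detectorDeriv β (K v) (Pi.single j 1) ^ 2 + 2 * n * (32 * c ^ 4 * b ^ 2) := by
          rw [Finset.sum_add_distrib, ← Finset.mul_sum, Finset.sum_const, Finset.card_univ,
            Fintype.card_sum, Fintype.card_fin, nsmul_eq_mul]
          push_cast; ring
      -- The remainders contribute 2n terms of size b², of total order 1/(β⁸n). The gradient part is
      -- weakened from β⁴ to the same power.
      _ ≤ 8 * c ^ 2 * (36 * Real.pi ^ 2 * (1 + 2 * c ^ 2) / (β ^ 8 * n)) +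
          2 * n * (32 * c ^ 4 * b ^ 2) := by
          gcongr
          have h8 : β ^ 8 ≤ β ^ 4 := pow_le_pow_of_le_one hβ.le hβ1 (by norm_num)
          refine (hgrad v).trans ?_
          gcongr
      _ = V := by
          rw [hV, boundedConst, hb]; field_simp; ring
  have hosc : ∀ j v x y, (detector β (K (Function.update v j x)) -
      detector β (K (Function.update v j y))) ^ 2 ≤ D j (Function.update v j x) := fun j v x y => by
    have e : K (Function.update v j y) = K (Function.update v j x) +
        (clamp c y - clamp c x) • Pi.single j 1 := by
      funext i
      by_cases h : i = j
      · subst h; simp [hK]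
      · simp [hK, h]
    have hh : |clamp c y - clamp c x| ≤ 2 * c := by
      have h1 := abs_clamp_le hc.le x
      have h2 := abs_clamp_le hc.le y
      exact (abs_sub _ _).trans (by linarith)
    have := abs_detector_sub_le hβ hβ1 hn hc (hKb (Function.update v j x)) j hh
    rw [← e, zero_smul, add_zero] at this
    rw [← sq_abs, abs_sub_comm]
    exact pow_le_pow_left₀ (abs_nonneg _) this 2
  have hdet0 : Continuous fun v => detector β (K v) := (continuous_detector β).comp hKc
  have hB : ∀ v, |detector β (K v)| ≤ 2 * Real.pi * (1 + 2 * c ^ 2) := fun v => by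
    rw [abs_of_nonneg (detector_nonneg β _)]
    refine (detector_le β _).trans ?_
    have := energy_le_of_abs_le hn (hKb v)
    gcongr
  have hD0 : ∀ j v, 0 ≤ D j v := fun j v => sq_nonneg _
  have hupd : ∀ (v : Fin n ⊕ Fin n → ℝ) j, Continuous fun t => Function.update v j t := fun v j =>
    continuous_const.update j continuous_id
  have hDb : ∀ j v, |D j v| ≤ V := fun j v => by
    rw [abs_of_nonneg (hD0 j v)]
    exact (Finset.single_le_sum (f := fun j => D j v) (fun i _ => hD0 i v) (Finset.mem_univ j)).trans
      (hDV v)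
  have main := measure_pi_ge_le (ν := ν) (Ψ := fun v => detector β (K v)) hdet0.measurable hV0
    hB (fun j => (hDc j).measurable) hD0 hDV (fun j v l hl =>
      ent_exp_le_of_osc (hdet0.comp (hupd v j)).measurable (fun t => hB _)
        ((hDc j).comp (hupd v j)).measurable (fun t => hDb j _) (fun x y => hosc j v x y) hl) hr
  have e1 : ∫ v, detector β (K v) ∂μ = ∫ v, detector β v ∂μ :=
    integral_congr_ae (hKae.mono fun v hv => by simp only [hv])
  rw [e1] at main
  have e2 : μ.real {v | (∫ v, detector β v ∂μ) + r ≤ detector β v} =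
      μ.real {v | (∫ v, detector β v ∂μ) + r ≤ detector β (K v)} := by
    refine measureReal_congr ?_
    filter_upwards [hKae] with v hv
    refine propext ?_
    change v ∈ {v | _} ↔ v ∈ {v | _}
    simp only [Set.mem_ofPred_eq, hv]
  rw [e2]
  refine main.trans_eq ?_
  congr 1
  rw [hV]
  field_simp

/-! The case of a logarithmic Sobolev inequality -/

theorem hasDerivAt_energy (v : Fin n ⊕ Fin n → ℝ) (j : Fin n ⊕ Fin n) (t : ℝ) :
    HasDerivAt (fun t => energy (v + t • Pi.single j 1))
      (2 / n * (v + t • (Pi.single j 1 : Fin n ⊕ Fin n → ℝ)) j) t := by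
  have h : ∀ i, HasDerivAt (fun t : ℝ => ((v + t • (Pi.single j 1 : Fin n ⊕ Fin n → ℝ)) i) ^ 2)
      (if i = j then 2 * (v + t • (Pi.single j 1 : Fin n ⊕ Fin n → ℝ)) j else 0) t := fun i => by
    by_cases h : i = j
    · subst h
      simp only [Pi.add_apply, Pi.smul_apply, Pi.single_eq_same, smul_eq_mul, if_true]
      have := (hasDerivAt_line (v i) 1 t).fun_pow 2
      simpa using this
    · simp only [Pi.add_apply, Pi.smul_apply, Pi.single_eq_of_ne h, smul_zero, add_zero, if_neg h]
      exact hasDerivAt_const _ _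
  have := (HasDerivAt.fun_sum fun i (_ : i ∈ Finset.univ) => h i).const_mul (1 / (n : ℝ))
  refine this.congr_deriv ?_
  rw [Finset.sum_ite_eq' Finset.univ j, if_pos (Finset.mem_univ j)]
  ring

/-- The one-coordinate inequality with D = (C₀/4)G² gives the variance proxy C₀V/4, and the 4
cancels the one in the Chernoff exponent. -/
theorem LogSobolev.measure_pi_ge_le {ι : Type*} [Fintype ι] [DecidableEq ι] {ν : Measure ℝ}
    [IsProbabilityMeasure ν] {C₀ : ℝ} (hC₀ : 0 < C₀) (hν : LogSobolev ν C₀)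
    {Ψ : (ι → ℝ) → ℝ} (hΨ : Continuous Ψ) {B V : ℝ} (hV : 0 < V)
    (hB : ∀ v, |Ψ v| ≤ B) {G : ι → (ι → ℝ) → ℝ} (hG : ∀ j, Continuous (G j))
    (hd : ∀ v j (t : ℝ), HasDerivAt (fun t => Ψ (v + t • (Pi.single j 1 : ι → ℝ)))
      (G j (v + t • (Pi.single j 1 : ι → ℝ))) t)
    (hGV : ∀ v, ∑ j, G j v ^ 2 ≤ V) {r : ℝ} (hr : 0 < r) :
    (Measure.pi fun _ : ι => ν).real
      {v | (∫ v, Ψ v ∂(Measure.pi fun _ : ι => ν)) + r ≤ Ψ v} ≤ Real.exp (-r ^ 2 / (C₀ * V)) := by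
  have hupd : ∀ (v : ι → ℝ) j, Continuous fun t => Function.update v j t := fun v j =>
    continuous_const.update j continuous_id
  have hGb : ∀ j v, |G j v| ≤ Real.sqrt V := fun j v =>
    Real.abs_le_sqrt ((Finset.single_le_sum (f := fun j => G j v ^ 2) (fun i _ => sq_nonneg _)
      (Finset.mem_univ j)).trans (hGV v))
  have main := RandomTrig.measure_pi_ge_le (ν := ν) (Ψ := Ψ) hΨ.measurable (V := C₀ / 4 * V)
    (by positivity) hB (D := fun j v => C₀ / 4 * G j v ^ 2)
    (fun j => (by have := hG j; fun_prop : Continuous fun v => C₀ / 4 * G j v ^ 2).measurable)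
    (fun j v => by positivity)
    (fun v => by rw [← Finset.mul_sum]; exact mul_le_mul_of_nonneg_left (hGV v) (by positivity))
    (fun j v l _ => hν.ent_exp_le (u := fun t => Ψ (Function.update v j t))
      (u' := fun t => G j (Function.update v j t)) (fun t => by
        simpa only [← update_eq_add_smul] using hd (Function.update v j 0) j t)
      ((hG j).comp (hupd v j)) (fun t => hB _) (fun t => hGb j _) l) hr
  refine main.trans_eq ?_
  congr 1
  field_simp

/-- Coefficients may be unbounded and the squared gradient of the detector grows like the energy.
Division by 1 + energy keeps the functional within 2π and its gradient bounded everywhere. -/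
theorem detector_tail_of_logSobolev {ν : Measure ℝ} [IsProbabilityMeasure ν] {β C₀ r : ℝ}
    (hβ : 0 < β) (hβ1 : β ≤ 1) (hn : 0 < n) (hC₀ : 0 < C₀) (hν : LogSobolev ν C₀) (hr : 0 < r) :
    (Measure.pi fun _ : Fin n ⊕ Fin n => ν).real {v | (∫ v, detector β v / (1 + energy v)
      ∂(Measure.pi fun _ : Fin n ⊕ Fin n => ν)) + r ≤ detector β v / (1 + energy v)} ≤
      Real.exp (-r ^ 2 * (β ^ 4 * n) / (80 * Real.pi ^ 2 * C₀)) := by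
  have hn' : (0 : ℝ) < n := by exact_mod_cast hn
  have hE : ∀ v : Fin n ⊕ Fin n → ℝ, 0 < 1 + energy v := fun v => by
    have := energy_nonneg v; linarith
  have hEc := continuous_energy (n := n)
  have hDc := continuous_detector (n := n) β
  have hgc := fun j => continuous_detectorDeriv (n := n) β (Pi.single j 1)
  set G : Fin n ⊕ Fin n → (Fin n ⊕ Fin n → ℝ) → ℝ := fun j v =>
    (detectorDeriv β v (Pi.single j 1) * (1 + energy v) - detector β v * (2 / n * v j)) /
      (1 + energy v) ^ 2 with hG
  have main := hν.measure_pi_ge_le hC₀ (Ψ := fun v => detector β v / (1 + energy v))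
    (hDc.div (by fun_prop) fun v => (hE v).ne') (B := 2 * Real.pi)
    (V := 80 * Real.pi ^ 2 / (β ^ 4 * n)) (by positivity) (fun v => ?_) (G := G)
    (fun j => ?_) (fun v j t => ?_) (fun v => ?_) hr
  · refine main.trans_eq ?_
    congr 1
    field_simp
  · rw [abs_of_nonneg (div_nonneg (detector_nonneg β v) (hE v).le), div_le_iff₀ (hE v)]
    exact detector_le β v
  · have := hgc j
    exact Continuous.div (by fun_prop) (by fun_prop) fun v => pow_ne_zero _ (hE v).ne'
  · exact (hasDerivAt_detector β v _ t).div ((hasDerivAt_energy v j t).const_add 1) (hE _).ne'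
  · set Q := energy v with hQ
    have hQ0 : 0 ≤ Q := energy_nonneg v
    have h1 : ∀ j, G j v ^ 2 ≤ 2 / (1 + Q) ^ 2 * detectorDeriv β v (Pi.single j 1) ^ 2 +
        8 * detector β v ^ 2 / (n ^ 2 * (1 + Q) ^ 4) * v j ^ 2 := fun j => by
      have e : G j v = detectorDeriv β v (Pi.single j 1) / (1 + Q) -
          detector β v * (2 / n * v j) / (1 + Q) ^ 2 := by
        simp only [hG]; rw [← hQ]; field_simp
      have e2 : 2 / (1 + Q) ^ 2 * detectorDeriv β v (Pi.single j 1) ^ 2 +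
          8 * detector β v ^ 2 / (n ^ 2 * (1 + Q) ^ 4) * v j ^ 2 =
          2 * (detectorDeriv β v (Pi.single j 1) / (1 + Q)) ^ 2 +
          2 * (detector β v * (2 / n * v j) / (1 + Q) ^ 2) ^ 2 := by
        field_simp; ring
      rw [e, e2]
      nlinarith [sq_nonneg (detectorDeriv β v (Pi.single j 1) / (1 + Q) +
        detector β v * (2 / n * v j) / (1 + Q) ^ 2)]
    have hsum : ∑ j, v j ^ 2 = n * Q := by rw [hQ, energy]; field_simp
    have hb4 : β ^ 4 ≤ 1 := pow_le_one₀ hβ.le hβ1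
    calc ∑ j, G j v ^ 2 ≤ ∑ j, (2 / (1 + Q) ^ 2 * detectorDeriv β v (Pi.single j 1) ^ 2 +
          8 * detector β v ^ 2 / (n ^ 2 * (1 + Q) ^ 4) * v j ^ 2) := Finset.sum_le_sum fun j _ => h1 j
      _ = 2 / (1 + Q) ^ 2 * ∑ j, detectorDeriv β v (Pi.single j 1) ^ 2 +
          8 * detector β v ^ 2 / (n ^ 2 * (1 + Q) ^ 4) * (n * Q) := by
          rw [Finset.sum_add_distrib, ← Finset.mul_sum, ← Finset.mul_sum, hsum]
      _ ≤ 2 / (1 + Q) ^ 2 * (36 * Real.pi ^ 2 * (1 + Q) / (β ^ 4 * n)) +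
          8 * (2 * Real.pi * (1 + Q)) ^ 2 / (n ^ 2 * (1 + Q) ^ 4) * (n * Q) := by
          have h2 := detector_nonneg β v
          have h3 := detector_le β v
          gcongr
          exact sum_detectorDeriv_sq_le hβ hβ1 hn v
      -- The two factors split off are at most 1, the second because 4Q ≤ (1 + Q)²; hence 80 = 72 +
      -- 8.
      _ = 72 * Real.pi ^ 2 / (β ^ 4 * n) * (1 / (1 + Q)) +
          8 * Real.pi ^ 2 / (1 * n) * (4 * Q / (1 + Q) ^ 2) := by field_simp; ring
      _ ≤ 72 * Real.pi ^ 2 / (β ^ 4 * n) * 1 + 8 * Real.pi ^ 2 / (β ^ 4 * n) * 1 := by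
          gcongr
          · rw [div_le_one (by positivity)]; linarith
          · rw [div_le_one (by positivity)]; nlinarith [sq_nonneg (Q - 1)]
      _ = _ := by ring

/-- The bounded function q/(1 + q) equals 3/4 at q = 3, so the event is a deviation of at least 3/4
- 2/3 = 1/12, against a squared gradient of at most 4/n. -/
theorem energy_tail_of_logSobolev {ν : Measure ℝ} [IsProbabilityMeasure ν] {C₀ : ℝ}
    (hn : 0 < n) (hC₀ : 0 < C₀) (hν : LogSobolev ν C₀)
    (hm : ∫ v, energy v / (1 + energy v) ∂(Measure.pi fun _ : Fin n ⊕ Fin n => ν) ≤ 2 / 3) :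
    (Measure.pi fun _ : Fin n ⊕ Fin n => ν).real {v | 3 ≤ energy v} ≤
      Real.exp (-n / (576 * C₀)) := by
  have hn' : (0 : ℝ) < n := by exact_mod_cast hn
  have hE : ∀ v : Fin n ⊕ Fin n → ℝ, 0 < 1 + energy v := fun v => by
    have := energy_nonneg v; linarith
  have hEc := continuous_energy (n := n)
  have main := hν.measure_pi_ge_le hC₀ (Ψ := fun v : Fin n ⊕ Fin n → ℝ => energy v / (1 + energy v))
    (hEc.div (by fun_prop) fun v => (hE v).ne') (B := 1)
    (V := 4 / n) (by positivity) (fun v => ?_)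
    (G := fun j v => (2 / n * v j) / (1 + energy v) ^ 2)
    (fun j => ?_) (fun v j t => ?_) (fun v => ?_) (r := 1 / 12) (by norm_num)
  · refine (measureReal_mono ?_).trans (main.trans_eq ?_)
    · intro v hv
      simp only [Set.mem_ofPred_eq] at hv ⊢
      have : 3 / 4 ≤ energy v / (1 + energy v) := by
        rw [div_le_div_iff₀ (by norm_num) (hE v)]; linarith
      linarith
    · congr 1; field_simp; norm_num
  · rw [abs_of_nonneg (div_nonneg (energy_nonneg v) (hE v).le), div_le_one (hE v)]
    linarith
  · exact Continuous.div (by fun_prop) (by fun_prop) fun v => pow_ne_zero _ (hE v).ne'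
  · refine ((hasDerivAt_energy v j t).div ((hasDerivAt_energy v j t).const_add 1)
      (hE _).ne').congr_deriv ?_
    ring
  · set Q := energy v with hQ
    have hQ0 : 0 ≤ Q := energy_nonneg v
    have hsum : ∑ j, v j ^ 2 = n * Q := by rw [hQ, energy]; field_simp
    have e : ∑ j, (2 / n * v j / (1 + Q) ^ 2) ^ 2 = 4 / n * (Q / (1 + Q) ^ 4) := by
      have : ∀ j, (2 / n * v j / (1 + Q) ^ 2) ^ 2 = 4 / (n ^ 2 * (1 + Q) ^ 4) * v j ^ 2 := fun j => by
        field_simp; ring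
      simp_rw [this]
      rw [← Finset.mul_sum, hsum]; field_simp
    rw [e]
    refine mul_le_of_le_one_right (by positivity) ?_
    rw [div_le_one (by positivity)]
    have : 1 ≤ (1 + Q) ^ 3 := one_le_pow₀ (by linarith)
    nlinarith

end
/-! ### Characteristic functions -/

/-- A centred law of variance one whose absolute third moment is at most `B`. -/
structure StdLaw (ν : Measure ℝ) (B : ℝ) : Prop where
  mean : ∫ x, x ∂ν = 0
  sq_integrable : Integrable (fun x : ℝ => x ^ 2) ν
  sq : ∫ x, x ^ 2 ∂ν = 1
  cube_integrable : Integrable (fun x : ℝ => |x| ^ 3) ν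
  cube : ∫ x, |x| ^ 3 ∂ν ≤ B

theorem cos_le_cubic (y : ℝ) : Real.cos y ≤ 1 - y ^ 2 / 2 + |y| ^ 3 := by
  rcases le_or_gt |y| 1 with h | h
  · have h1 := (abs_le.1 (Real.cos_bound h)).2
    have : |y| ^ 4 ≤ |y| ^ 3 := pow_le_pow_of_le_one (abs_nonneg y) h (by norm_num)
    nlinarith [pow_nonneg (abs_nonneg y) 3]
  · have : |y| ^ 2 ≤ |y| ^ 3 := pow_le_pow_right₀ h.le (by norm_num)
    rw [← sq_abs y]
    nlinarith [Real.cos_le_one y, sq_nonneg |y|]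

theorem abs_sin_sub_self_le (y : ℝ) : |Real.sin y - y| ≤ 2 * |y| ^ 3 := by
  rcases le_or_gt |y| 1 with h | h
  · have h1 := Real.sin_bound h
    have : |y| ^ 5 ≤ |y| ^ 3 := pow_le_pow_of_le_one (abs_nonneg y) h (by norm_num)
    have e : Real.sin y - y = (Real.sin y - (y - y ^ 3 / 6)) + -(y ^ 3 / 6) := by ring
    have h2 : |-(y ^ 3 / 6)| = |y| ^ 3 / 6 := by rw [abs_neg, abs_div, abs_pow]; norm_num
    rw [e]
    refine (abs_add_le _ _).trans ?_
    rw [h2]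
    nlinarith [pow_nonneg (abs_nonneg y) 3]
  · have h1 : |y| ^ 1 ≤ |y| ^ 3 := pow_le_pow_right₀ h.le (by norm_num)
    rw [pow_one] at h1
    refine (abs_sub _ _).trans ?_
    linarith [Real.abs_sin_le_one y]

namespace StdLaw
variable {ν : Measure ℝ} [IsProbabilityMeasure ν] {B : ℝ}

theorem memLp (h : StdLaw ν B) : MemLp id 2 ν := by
  rw [memLp_two_iff_integrable_sq aestronglyMeasurable_id]
  exact h.sq_integrable

theorem integrable (h : StdLaw ν B) : Integrable (fun x : ℝ => x) ν :=
  h.memLp.integrable (by norm_num)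

theorem nonneg (h : StdLaw ν B) : 0 ≤ B :=
  (integral_nonneg fun x => by positivity).trans h.cube

/-- The real part is 1 - s²/2 and the imaginary part 0, by the vanishing mean, up to O(B|s|³). The
range of s reduces the cubic errors to small multiples of s², so the squared modulus is at most 1 -
s²/2. -/
theorem norm_charFun_le (h : StdLaw ν B) {s : ℝ} (hs : |s| ≤ 1 / (16 * (1 + B))) :
    ‖charFun ν s‖ ≤ Real.exp (-s ^ 2 / 4) := by
  have hB := h.nonneg
  have hs1 : |s| * (1 + B) ≤ 1 / 16 := by
    rw [le_div_iff₀ (by positivity)] at hs; linarith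
  have hsB : |s| * B ≤ 1 / 16 := by nlinarith [abs_nonneg s]
  have hsle : |s| ≤ 1 / 16 := by nlinarith [mul_nonneg (abs_nonneg s) hB]
  set E1 := ∫ x, Real.cos (s * x) ∂ν with hE1
  set E2 := ∫ x, Real.sin (s * x) ∂ν with hE2
  have ic : Integrable (fun x => Real.cos (s * x)) ν :=
    integrable_of_abs_le (by fun_prop) fun x => Real.abs_cos_le_one _
  have is : Integrable (fun x => Real.sin (s * x)) ν :=
    integrable_of_abs_le (by fun_prop) fun x => Real.abs_sin_le_one _
  have i2 : Integrable (fun x : ℝ => s ^ 2 / 2 * x ^ 2) ν := h.sq_integrable.const_mul _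
  have i3 : Integrable (fun x : ℝ => |s| ^ 3 * |x| ^ 3) ν := h.cube_integrable.const_mul _
  have hlow : 1 - s ^ 2 / 2 ≤ E1 := by
    have := integral_mono ((integrable_const (1 : ℝ)).sub i2) ic fun x => by
      have := Real.one_sub_sq_div_two_le_cos (x := s * x)
      have e : (s * x) ^ 2 / 2 = s ^ 2 / 2 * x ^ 2 := by ring
      rw [e] at this
      exact this
    rw [integral_sub' (integrable_const _) i2, integral_const_mul, h.sq] at this
    simpa using this
  have hup : E1 ≤ 1 - s ^ 2 / 2 + |s| ^ 3 * B := by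
    have := integral_mono ic (((integrable_const (1 : ℝ)).sub i2).add i3) fun x => by
      have := cos_le_cubic (s * x)
      have e : (s * x) ^ 2 / 2 = s ^ 2 / 2 * x ^ 2 := by ring
      rw [e, abs_mul, mul_pow] at this
      exact this
    rw [integral_add' ((integrable_const _).sub i2) i3, integral_sub' (integrable_const _) i2,
      integral_const_mul, integral_const_mul, h.sq] at this
    have h3 := mul_le_mul_of_nonneg_left h.cube (pow_nonneg (abs_nonneg s) 3)
    simp at this
    linarith
  have hsin : |E2| ≤ 2 * |s| ^ 3 * B := by
    have e : E2 = ∫ x, (Real.sin (s * x) - s * x) ∂ν := by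
      rw [integral_sub is (h.integrable.const_mul s), integral_const_mul, h.mean]; simp [hE2]
    rw [e]
    have := norm_integral_le_of_norm_le (f := fun x => Real.sin (s * x) - s * x)
      (i3.const_mul 2) (Filter.Eventually.of_forall fun x => by
        have := abs_sin_sub_self_le (s * x)
        rw [abs_mul, mul_pow] at this
        exact this)
    rw [integral_const_mul, integral_const_mul] at this
    have h3 := mul_le_mul_of_nonneg_left h.cube (pow_nonneg (abs_nonneg s) 3)
    rw [Real.norm_eq_abs] at this
    linarith
  have hnorm : ‖charFun ν s‖ ^ 2 = E1 ^ 2 + E2 ^ 2 := by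
    have ie : Integrable (fun x : ℝ => Complex.exp (s * x * Complex.I)) ν := by
      refine Integrable.of_bound (by fun_prop) 1 (Filter.Eventually.of_forall fun x => ?_)
      rw [← Complex.ofReal_mul, Complex.norm_exp_ofReal_mul_I]
    have er : (charFun ν s).re = E1 := by
      rw [charFun_apply_real, ← RCLike.re_eq_complex_re, ← integral_re ie]
      congr 1; funext x
      rw [RCLike.re_eq_complex_re, ← Complex.ofReal_mul, Complex.exp_ofReal_mul_I_re]
    have ei : (charFun ν s).im = E2 := by
      rw [charFun_apply_real, ← RCLike.im_eq_complex_im, ← integral_im ie]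
      congr 1; funext x
      rw [RCLike.im_eq_complex_im, ← Complex.ofReal_mul, Complex.exp_ofReal_mul_I_im]
    rw [← Complex.normSq_eq_norm_sq, Complex.normSq_apply, er, ei]; ring
  have hs3 : |s| ^ 3 * B ≤ s ^ 2 / 16 := by
    have : |s| ^ 3 * B = s ^ 2 * (|s| * B) := by rw [← sq_abs s]; ring
    rw [this]; nlinarith [sq_nonneg s]
  have hs2 : s ^ 2 ≤ 1 := by rw [← sq_abs]; nlinarith [abs_nonneg s]
  have hE1' : E1 ^ 2 ≤ (1 - 7 / 16 * s ^ 2) ^ 2 := by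
    refine pow_le_pow_left₀ (by linarith) (by linarith) 2
  have hE2' : E2 ^ 2 ≤ (s ^ 2 / 8) ^ 2 := by
    rw [← sq_abs E2]
    exact pow_le_pow_left₀ (abs_nonneg _) (by linarith) 2
  refine (sq_le_sq₀ (norm_nonneg _) (Real.exp_pos _).le).1 ?_
  rw [hnorm, ← Real.exp_nat_mul]
  have h5 := Real.add_one_le_exp (-s ^ 2 / 2)
  have e : ((2 : ℕ) : ℝ) * (-s ^ 2 / 4) = -s ^ 2 / 2 := by push_cast; ring
  rw [e]
  nlinarith [sq_nonneg s]

end StdLaw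

section
variable {ι : Type*} [Fintype ι] [DecidableEq ι] {ν : Measure ℝ} [IsProbabilityMeasure ν]

theorem iIndepFun_coord (ν : Measure ℝ) [IsProbabilityMeasure ν] :
    iIndepFun (fun (i : ι) (v : ι → ℝ) => v i) (Measure.pi fun _ : ι => ν) :=
  iIndepFun_pi (X := fun _ : ι => (id : ℝ → ℝ)) fun _ => aemeasurable_id

open Complex in
/-- Factorization of a Fourier transform along an independent block of coordinates. -/
theorem norm_integral_mul_exp_le (S : Finset ι) {g : (S → ℝ) → ℝ} (hg : Measurable g) (θ : ι → ℝ) :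
    ‖∫ v : ι → ℝ, (g (fun i => v i) : ℂ) * cexp ((∑ j, θ j * v j : ℝ) * I)
      ∂(Measure.pi fun _ : ι => ν)‖ ≤
      (∫ v : ι → ℝ, |g (fun i => v i)| ∂(Measure.pi fun _ : ι => ν)) *
        ∏ j ∈ Sᶜ, ‖charFun ν (θ j)‖ := by
  set μ := Measure.pi fun _ : ι => ν with hμ
  have hind := (iIndepFun_coord (ι := ι) ν).indepFun_finset S Sᶜ disjoint_compl_right
    (fun i => measurable_pi_apply i)
  have hind' := hind.comp
    (φ := fun w : S → ℝ => (g w : ℂ) * cexp ((∑ j : S, θ j * w j : ℝ) * I))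
    (ψ := fun w : (Sᶜ : Finset ι) → ℝ => cexp ((∑ j : (Sᶜ : Finset ι), θ j * w j : ℝ) * I))
    (by fun_prop) (by fun_prop)
  have hsplit : ∀ v : ι → ℝ, (g (fun i => v i) : ℂ) * cexp ((∑ j, θ j * v j : ℝ) * I) =
      ((g (fun i : S => v i) : ℂ) * cexp ((∑ j : S, θ j * v j : ℝ) * I)) *
      cexp ((∑ j : (Sᶜ : Finset ι), θ j * v j : ℝ) * I) := fun v => by
    rw [mul_assoc, ← Complex.exp_add, ← add_mul, ← Complex.ofReal_add,
      Finset.sum_coe_sort S (fun j => θ j * v j), Finset.sum_coe_sort Sᶜ (fun j => θ j * v j),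
      Finset.sum_add_sum_compl]
  have h2 : ∫ v : ι → ℝ, cexp ((∑ j : (Sᶜ : Finset ι), θ j * v j : ℝ) * I) ∂μ =
      ∏ j ∈ Sᶜ, charFun ν (θ j) := by
    have e : ∀ v : ι → ℝ, cexp ((∑ j : (Sᶜ : Finset ι), θ j * v j : ℝ) * I) =
        ∏ j, if j ∈ Sᶜ then cexp (θ j * v j * I) else 1 := fun v => by
      rw [Finset.sum_coe_sort Sᶜ (fun j => θ j * v j), Finset.prod_ite_mem, Finset.univ_inter,
        ← Complex.exp_sum, ← Finset.sum_mul]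
      push_cast; rfl
    simp_rw [e]
    rw [hμ, integral_fintype_prod_eq_prod (fun j (x : ℝ) =>
      if j ∈ Sᶜ then cexp (θ j * x * I) else 1)]
    have e' : ∏ j ∈ Sᶜ, charFun ν (θ j) = ∏ j, if j ∈ Sᶜ then charFun ν (θ j) else 1 := by
      rw [Finset.prod_ite_mem, Finset.univ_inter]
    rw [e']
    refine Finset.prod_congr rfl fun j _ => ?_
    by_cases h : j ∈ Sᶜ
    · simp only [if_pos h]; rw [charFun_apply_real]
    · simp only [if_neg h]; simp
  simp_rw [hsplit]
  have key := hind'.integral_fun_mul_eq_mul_integral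
    (Measurable.aestronglyMeasurable (by fun_prop)) (Measurable.aestronglyMeasurable (by fun_prop))
  simp only [Function.comp_def] at key
  rw [key, h2, norm_mul, norm_prod]
  refine mul_le_mul_of_nonneg_right ((norm_integral_le_integral_norm _).trans_eq ?_)
    (Finset.prod_nonneg fun _ _ => norm_nonneg _)
  congr 1; funext v
  rw [norm_mul, Complex.norm_exp_ofReal_mul_I, mul_one, Complex.norm_real, Real.norm_eq_abs]

theorem StdLaw.integral_coord_sq {B : ℝ} (h : StdLaw ν B) (j : ι) :
    Integrable (fun v : ι → ℝ => v j ^ 2) (Measure.pi fun _ : ι => ν) ∧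
      ∫ v, v j ^ 2 ∂(Measure.pi fun _ : ι => ν) = 1 := by
  have mp := measurePreserving_eval (fun _ : ι => ν) j
  constructor
  · exact (mp.integrable_comp h.sq_integrable.aestronglyMeasurable).2 h.sq_integrable
  · have := integral_map (μ := Measure.pi fun _ : ι => ν) mp.measurable.aemeasurable (f := fun x : ℝ => x ^ 2)
      (by fun_prop : Continuous fun x : ℝ => x ^ 2).aestronglyMeasurable
    rw [mp.map_eq, h.sq] at this
    exact this.symm

/-- The second moment of a linear form in independent standardized variables. -/
theorem StdLaw.integral_linear_sq {B : ℝ} (h : StdLaw ν B) (S : Finset ι) (c : ι → ℝ) :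
    Integrable (fun v : ι → ℝ => (∑ j ∈ S, v j * c j) ^ 2) (Measure.pi fun _ : ι => ν) ∧
      ∫ v, (∑ j ∈ S, v j * c j) ^ 2 ∂(Measure.pi fun _ : ι => ν) = ∑ j ∈ S, c j ^ 2 := by
  set μ := Measure.pi fun _ : ι => ν with hμ
  have mp := fun j => measurePreserving_eval (fun _ : ι => ν) j
  have hLp : ∀ j, MemLp (fun v : ι → ℝ => v j) 2 μ := fun j =>
    h.memLp.comp_measurePreserving (mp j)
  have hprod : ∀ i j, Integrable (fun v : ι → ℝ => v i * v j) μ := fun i j =>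
    (hLp i).integrable_mul (hLp j)
  have hmean : ∀ j, ∫ v : ι → ℝ, v j ∂μ = 0 := fun j => by
    have := integral_map (μ := μ) (mp j).measurable.aemeasurable (f := fun x : ℝ => x)
      aestronglyMeasurable_id
    rw [(mp j).map_eq, h.mean] at this
    exact this.symm
  have hcov : ∀ i j, ∫ v : ι → ℝ, v i * v j ∂μ = if i = j then 1 else 0 := fun i j => by
    split_ifs with hij
    · subst hij
      rw [← (h.integral_coord_sq (ι := ι) i).2]
      congr 1; funext v; ring
    · have := ((iIndepFun_coord (ι := ι) ν).indepFun hij).integral_fun_mul_eq_mul_integral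
        (measurable_pi_apply i).aestronglyMeasurable (measurable_pi_apply j).aestronglyMeasurable
      rw [this, hmean, zero_mul]
  have e : ∀ v : ι → ℝ, (∑ j ∈ S, v j * c j) ^ 2 =
      ∑ i ∈ S, ∑ j ∈ S, c i * c j * (v i * v j) := fun v => by
    rw [pow_two, Finset.sum_mul_sum]
    exact Finset.sum_congr rfl fun i _ => Finset.sum_congr rfl fun j _ => by ring
  simp_rw [e]
  have hi : ∀ i j, Integrable (fun v : ι → ℝ => c i * c j * (v i * v j)) μ := fun i j =>
    (hprod i j).const_mul _
  refine ⟨integrable_finsetSum _ fun i _ => integrable_finsetSum _ fun j _ => hi i j, ?_⟩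
  rw [integral_finsetSum _ fun i _ => integrable_finsetSum _ fun j _ => hi i j]
  refine Finset.sum_congr rfl fun i hiS => ?_
  rw [integral_finsetSum _ fun j _ => hi i j]
  simp_rw [integral_const_mul, hcov]
  simp [hiS, pow_two]

end
/-! ### Gaussian weights of linear forms and the expectation of the detector -/

section
variable {n : ℕ}

theorem sum_trigBasis_sq_le (hn : 0 < n) (p : ℕ) (S : Finset (Fin n ⊕ Fin n)) (x : ℝ) :
    ∑ j ∈ S, trigBasis p j x ^ 2 ≤ 2 := by
  have hn' : (0 : ℝ) < n := by exact_mod_cast hn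
  calc ∑ j ∈ S, trigBasis p j x ^ 2 ≤ ∑ j, trigBasis p j x ^ 2 :=
        Finset.sum_le_sum_of_subset_of_nonneg (Finset.subset_univ _) fun _ _ _ => sq_nonneg _
    _ ≤ ∑ _j : Fin n ⊕ Fin n, 1 / (n : ℝ) := Finset.sum_le_sum fun j _ => by
        rw [← sq_abs]
        refine (pow_le_pow_left₀ (abs_nonneg _) (abs_trigBasis_le p j x) 2).trans_eq ?_
        rw [div_pow, Real.sq_sqrt hn'.le, one_pow]
    _ = 2 := by
        rw [Finset.sum_const, Finset.card_univ, Fintype.card_sum, Fintype.card_fin, nsmul_eq_mul]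
        push_cast; field_simp; norm_num

/-- Decay of the joint characteristic function of the first two normalized derivatives, using only
a block of high frequencies. -/
theorem prod_norm_charFun_le {ν : Measure ℝ} [IsProbabilityMeasure ν] {B : ℝ} (h : StdLaw ν B)
    (hn : 0 < n) {A : Finset (Fin n)} (hA : ∀ k ∈ A, n ≤ 2 * ((k : ℕ) + 1)) (hcard : n ≤ 8 * A.card)
    {S : Finset (Fin n ⊕ Fin n)} (hS : ∀ k ∈ A, Sum.inl k ∉ S ∧ Sum.inr k ∉ S) {t s : ℝ}
    (hts : (|t| + |s|) / √n ≤ 1 / (16 * (1 + B))) (x : ℝ) :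
    ∏ j ∈ Sᶜ, ‖charFun ν (t * trigBasis 0 j x + s * trigBasis 1 j x)‖ ≤
      Real.exp (-(t ^ 2 + s ^ 2) / 128) := by
  have hn' : (0 : ℝ) < n := by exact_mod_cast hn
  have hcard' : (n : ℝ) ≤ 8 * A.card := by exact_mod_cast hcard
  set θ : Fin n ⊕ Fin n → ℝ := fun j => t * trigBasis 0 j x + s * trigBasis 1 j x with hθ
  have hθs : ∀ j, |θ j| ≤ 1 / (16 * (1 + B)) := fun j => by
    refine le_trans ?_ hts
    refine (abs_add_le _ _).trans ?_
    rw [abs_mul, abs_mul, add_div, div_eq_mul_one_div |t|, div_eq_mul_one_div |s|]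
    exact add_le_add (mul_le_mul_of_nonneg_left (abs_trigBasis_le _ _ _) (abs_nonneg _))
      (mul_le_mul_of_nonneg_left (abs_trigBasis_le _ _ _) (abs_nonneg _))
  have h1 : ∏ j ∈ Sᶜ, ‖charFun ν (θ j)‖ ≤ ∏ j ∈ Sᶜ, Real.exp (-(θ j) ^ 2 / 4) :=
    Finset.prod_le_prod (fun _ _ => norm_nonneg _) fun j _ => h.norm_charFun_le (hθs j)
  refine h1.trans ?_
  rw [← Real.exp_sum, Real.exp_le_exp]
  have hsub : A.disjSum A ⊆ Sᶜ := fun j hj => by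
    rw [Finset.mem_compl]
    rcases Finset.mem_disjSum.1 hj with ⟨k, hk, rfl⟩ | ⟨k, hk, rfl⟩
    exacts [(hS k hk).1, (hS k hk).2]
  have h2 : ∑ j ∈ A.disjSum A, θ j ^ 2 ≤ ∑ j ∈ Sᶜ, θ j ^ 2 :=
    Finset.sum_le_sum_of_subset_of_nonneg hsub fun _ _ _ => sq_nonneg _
  -- At least n/8 frequencies with ratio at least 1/2 each contribute (t² + s²)/(4n).
  have h3 : (t ^ 2 + s ^ 2) / 32 ≤ ∑ j ∈ A.disjSum A, θ j ^ 2 := by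
    rw [Finset.sum_disjSum, ← Finset.sum_add_distrib]
    calc (t ^ 2 + s ^ 2) / 32 ≤ ∑ _k ∈ A, 1 / (n : ℝ) * ((t ^ 2 + s ^ 2) / 4) := by
          rw [Finset.sum_const, nsmul_eq_mul]
          have : 1 / 8 ≤ A.card * (1 / (n : ℝ)) := by
            rw [mul_one_div, le_div_iff₀ hn']; linarith
          nlinarith [mul_le_mul_of_nonneg_right this (by positivity : 0 ≤ (t ^ 2 + s ^ 2) / 4)]
      _ ≤ _ := Finset.sum_le_sum fun k hk => by
          rw [hθ]
          simp only
          rw [trigBasis_quadratic k x t s]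
          refine mul_le_mul_of_nonneg_left ?_ (by positivity)
          have hk' : (n : ℝ) ≤ 2 * ((k : ℕ) + 1) := by exact_mod_cast hA k hk
          have hr : 1 / 2 ≤ (((k : ℕ) + 1 : ℝ) / n) := by
            rw [le_div_iff₀ hn']; linarith
          have hr2 : 1 / 4 ≤ (((k : ℕ) + 1 : ℝ) / n) ^ 2 := by nlinarith
          nlinarith [mul_le_mul_of_nonneg_right hr2 (sq_nonneg s), sq_nonneg t]
  have e : ∑ j ∈ Sᶜ, -(θ j) ^ 2 / 4 = -(∑ j ∈ Sᶜ, θ j ^ 2) / 4 := by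
    rw [← Finset.sum_neg_distrib, Finset.sum_div]
  rw [e]
  linarith

end

/-! ### Gaussian integrals -/

/-- The standard normal law on the plane. -/
noncomputable def stdGaussian₂ : Measure (ℝ × ℝ) := (gaussianReal 0 1).prod (gaussianReal 0 1)

instance : IsProbabilityMeasure stdGaussian₂ := by unfold stdGaussian₂; infer_instance

theorem gauss_eq_integral (a : ℝ) :
    (gauss a : ℂ) = ∫ t : ℝ, Complex.exp ((t * a : ℝ) * Complex.I) ∂(gaussianReal 0 1) := by
  have := charFun_gaussianReal (μ := 0) (v := 1) a
  rw [charFun_apply_real] at this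
  have e : ∀ t : ℝ, ((t * a : ℝ) : ℂ) * Complex.I = a * t * Complex.I := fun t => by
    push_cast; ring
  simp_rw [e]
  rw [this, gauss]
  push_cast
  congr 1
  simp; ring

theorem gauss_mul_gauss_eq_integral (a b : ℝ) :
    ((gauss a * gauss b : ℝ) : ℂ) =
      ∫ p : ℝ × ℝ, Complex.exp ((p.1 * a + p.2 * b : ℝ) * Complex.I) ∂stdGaussian₂ := by
  rw [Complex.ofReal_mul, gauss_eq_integral, gauss_eq_integral, stdGaussian₂, ← integral_prod_mul]
  congr 1; funext p
  rw [← Complex.exp_add, ← add_mul]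
  push_cast; rfl

/-- The normal density is at most 1, so only the width b of the exponential counts. Widths β² and β
together give the factor β³. -/
theorem integral_exp_gaussianReal_le {b : ℝ} (hb : 0 < b) :
    ∫ t, Real.exp (-(t / b) ^ 2 / 128) ∂(gaussianReal 0 1) ≤ b * √(128 * Real.pi) := by
  rw [integral_gaussianReal_eq_integral_smul one_ne_zero]
  have hc : 0 < 1 / (128 * b ^ 2) := by positivity
  have e : ∀ t : ℝ, Real.exp (-(t / b) ^ 2 / 128) = Real.exp (-(1 / (128 * b ^ 2)) * t ^ 2) :=
    fun t => by congr 1; field_simp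
  have hpdf : ∀ t, gaussianPDFReal 0 1 t ≤ 1 := fun t => by
    rw [gaussianPDFReal_def]
    refine mul_le_one₀ (inv_le_one_of_one_le₀ ?_) (Real.exp_pos _).le
      (Real.exp_le_one_iff.2 ?_)
    · rw [Real.one_le_sqrt]
      have := Real.pi_gt_three
      simp; linarith
    · refine div_nonpos_of_nonpos_of_nonneg ?_ ?_
      · have := sq_nonneg (t - 0); linarith
      · positivity
  calc ∫ t, gaussianPDFReal 0 1 t • Real.exp (-(t / b) ^ 2 / 128)
      ≤ ∫ t, Real.exp (-(1 / (128 * b ^ 2)) * t ^ 2) := by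
        refine integral_mono_of_nonneg (Filter.Eventually.of_forall fun t => ?_)
          (integrable_exp_neg_mul_sq hc) (Filter.Eventually.of_forall fun t => ?_)
        · exact mul_nonneg (gaussianPDFReal_nonneg _ _ _) (Real.exp_pos _).le
        · simp only [smul_eq_mul, e]
          exact mul_le_of_le_one_left (Real.exp_pos _).le (hpdf t)
    _ = b * √(128 * Real.pi) := by
        rw [integral_gaussian]
        have : Real.pi / (1 / (128 * b ^ 2)) = b ^ 2 * (128 * Real.pi) := by field_simp
        rw [this, Real.sqrt_mul (sq_nonneg b), Real.sqrt_sq hb.le]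

/-- The eighth moment of the `ℓ¹` norm of a standard normal vector in the plane. -/
noncomputable def gaussMoment : ℝ := ∫ p : ℝ × ℝ, (|p.1| + |p.2|) ^ 8 ∂stdGaussian₂

theorem gaussMoment_nonneg : 0 ≤ gaussMoment := integral_nonneg fun p => by positivity

theorem integrable_gaussMoment :
    Integrable (fun p : ℝ × ℝ => (|p.1| + |p.2|) ^ 8) stdGaussian₂ := by
  have h8 : Integrable (fun t : ℝ => |t| ^ 8) (gaussianReal 0 1) :=
    (memLp_id_gaussianReal (μ := 0) (v := 1) 8).integrable_norm_pow (p := 8) (by norm_num)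
  have hi : Integrable (fun p : ℝ × ℝ => 2 ^ 7 * (|p.1| ^ 8 + |p.2| ^ 8)) stdGaussian₂ :=
    ((h8.comp_fst _).add (h8.comp_snd _)).const_mul _
  refine hi.mono' (by fun_prop) (Filter.Eventually.of_forall fun p => ?_)
  rw [Real.norm_eq_abs, abs_of_nonneg (by positivity)]
  exact add_pow_le (abs_nonneg _) (abs_nonneg _) 8

/-- The bound for the probability that the first two normalized derivatives of a random
trigonometric polynomial are at most `β ^ 2` and `β`. -/
noncomputable def smallBall (B β : ℝ) (n : ℕ) : ℝ :=
  128 * Real.pi * β ^ 3 + gaussMoment * (16 * (1 + B) / (β ^ 2 * √n)) ^ 8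

/-! ### A weighted small-ball estimate by Fourier representation -/

section
variable {n : ℕ} {ν : Measure ℝ} [IsProbabilityMeasure ν] {B β : ℝ}

theorem integral_exp_mul_exp_le (hβ : 0 < β) :
    Integrable (fun p : ℝ × ℝ => Real.exp (-(p.1 / β ^ 2) ^ 2 / 128) *
      Real.exp (-(p.2 / β) ^ 2 / 128)) stdGaussian₂ ∧
    ∫ p : ℝ × ℝ, Real.exp (-(p.1 / β ^ 2) ^ 2 / 128) * Real.exp (-(p.2 / β) ^ 2 / 128)
      ∂stdGaussian₂ ≤ 128 * Real.pi * β ^ 3 := by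
  have hi : ∀ b : ℝ, Integrable (fun t : ℝ => Real.exp (-(t / b) ^ 2 / 128)) (gaussianReal 0 1) :=
    fun b => integrable_of_abs_le (C := 1) (by fun_prop) fun t => by
      rw [Real.abs_exp, Real.exp_le_one_iff]
      have := sq_nonneg (t / b); linarith
  refine ⟨(hi _).mul_prod (hi _), ?_⟩
  rw [stdGaussian₂, integral_prod_mul (fun t => Real.exp (-(t / β ^ 2) ^ 2 / 128))
    (fun t => Real.exp (-(t / β) ^ 2 / 128))]
  refine (mul_le_mul (integral_exp_gaussianReal_le (pow_pos hβ 2))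
    (integral_exp_gaussianReal_le hβ) (integral_nonneg fun _ => (Real.exp_pos _).le)
    (by positivity)).trans_eq ?_
  have := Real.mul_self_sqrt (by positivity : 0 ≤ 128 * Real.pi)
  linear_combination β ^ 3 * this

/-- Written as characteristic functions, the cut-offs turn the expectation into an average over p of
a Fourier transform of the law of v weighted by g. Since g sees only the coordinates in `S`, the
block `A` stays independent of it and provides all the decay. -/
theorem integral_mul_gauss_mul_gauss_le (h : StdLaw ν B) (hβ : 0 < β) (hβ1 : β ≤ 1) (hn : 0 < n)
    {A : Finset (Fin n)} (hA : ∀ k ∈ A, n ≤ 2 * ((k : ℕ) + 1)) (hcard : n ≤ 8 * A.card)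
    {S : Finset (Fin n ⊕ Fin n)} (hS : ∀ k ∈ A, Sum.inl k ∉ S ∧ Sum.inr k ∉ S)
    {g : (S → ℝ) → ℝ} (hg : Measurable g) (hg0 : ∀ w, 0 ≤ g w)
    (hgi : Integrable (fun v : Fin n ⊕ Fin n → ℝ => g fun i => v i) (Measure.pi fun _ => ν))
    {M : ℝ} (hM : ∫ v : Fin n ⊕ Fin n → ℝ, g (fun i => v i) ∂(Measure.pi fun _ => ν) ≤ M)
    (x : ℝ) :
    ∫ v : Fin n ⊕ Fin n → ℝ, g (fun i => v i) *
      (gauss (trigDeriv 0 v x / β ^ 2) * gauss (trigDeriv 1 v x / β)) ∂(Measure.pi fun _ => ν) ≤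
      M * smallBall B β n := by
  set μ : Measure (Fin n ⊕ Fin n → ℝ) := Measure.pi fun _ => ν with hμ
  have hn' : (0 : ℝ) < n := by exact_mod_cast hn
  have hsn : 0 < √(n : ℝ) := Real.sqrt_pos.2 hn'
  have hB := h.nonneg
  have hM0 : 0 ≤ M := (integral_nonneg fun v => hg0 _).trans hM
  set θ : ℝ × ℝ → Fin n ⊕ Fin n → ℝ := fun p j =>
    p.1 / β ^ 2 * trigBasis 0 j x + p.2 / β * trigBasis 1 j x with hθ
  have hsum : ∀ (p : ℝ × ℝ) (v : Fin n ⊕ Fin n → ℝ),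
      p.1 * (trigDeriv 0 v x / β ^ 2) + p.2 * (trigDeriv 1 v x / β) = ∑ j, θ p j * v j :=
    fun p v => by
      simp only [hθ, trigDeriv]
      rw [Finset.sum_div, Finset.sum_div, Finset.mul_sum, Finset.mul_sum, ← Finset.sum_add_distrib]
      exact Finset.sum_congr rfl fun j _ => by ring
  set F : (Fin n ⊕ Fin n → ℝ) → ℝ × ℝ → ℂ := fun v p =>
    (g (fun i => v i) : ℂ) * Complex.exp ((∑ j, θ p j * v j : ℝ) * Complex.I) with hF
  have hgm : Measurable fun v : Fin n ⊕ Fin n → ℝ => g fun i => v i := by fun_prop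
  have hFi : Integrable (Function.uncurry F) (μ.prod stdGaussian₂) := by
    have h1 : Integrable (fun q : (Fin n ⊕ Fin n → ℝ) × (ℝ × ℝ) => g fun i => q.1 i)
      (μ.prod stdGaussian₂) := hgi.comp_fst _
    refine h1.mono ?_ (Filter.Eventually.of_forall fun q => ?_)
    · refine Measurable.aestronglyMeasurable ?_
      simp only [hF, hθ, Function.uncurry_def]
      fun_prop
    · simp only [Function.uncurry_def, hF]
      rw [norm_mul, Complex.norm_exp_ofReal_mul_I, mul_one, Complex.norm_real]
  have key : ((∫ v, g (fun i => v i) *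
      (gauss (trigDeriv 0 v x / β ^ 2) * gauss (trigDeriv 1 v x / β)) ∂μ : ℝ) : ℂ) =
      ∫ p, ∫ v, F v p ∂μ ∂stdGaussian₂ := by
    rw [← integral_integral_swap hFi, ← integral_complex_ofReal]
    congr 1; funext v
    rw [Complex.ofReal_mul, gauss_mul_gauss_eq_integral, ← integral_const_mul]
    simp_rw [hsum]
    rfl
  obtain ⟨hi1, hi2⟩ := integral_exp_mul_exp_le hβ
  set D : ℝ := 16 * (1 + B) / (β ^ 2 * √n) with hD
  have hD0 : 0 < D := by positivity
  have hbound : ∀ p : ℝ × ℝ, ‖∫ v, F v p ∂μ‖ ≤ M * (Real.exp (-(p.1 / β ^ 2) ^ 2 / 128) *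
      Real.exp (-(p.2 / β) ^ 2 / 128) + D ^ 8 * (|p.1| + |p.2|) ^ 8) := fun p => by
    refine (norm_integral_mul_exp_le S hg (θ p)).trans ?_
    have e : ∫ v : Fin n ⊕ Fin n → ℝ, |g fun i => v i| ∂μ = ∫ v, g (fun i => v i) ∂μ := by
      congr 1; funext v; exact abs_of_nonneg (hg0 _)
    rw [e]
    refine mul_le_mul hM ?_ (Finset.prod_nonneg fun _ _ => norm_nonneg _) hM0
    -- Near 0 the characteristic functions decay. Beyond, their product is only bounded by 1, but
    -- D(|p₁| + |p₂|) ≥ 1 there, so its eighth power dominates.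
    rcases le_or_gt ((|p.1 / β ^ 2| + |p.2 / β|) / √n) (1 / (16 * (1 + B))) with hp | hp
    · have := prod_norm_charFun_le h hn hA hcard hS hp x
      rw [← Real.exp_add]
      refine this.trans ?_
      rw [show -((p.1 / β ^ 2) ^ 2 + (p.2 / β) ^ 2) / 128 =
        -(p.1 / β ^ 2) ^ 2 / 128 + -(p.2 / β) ^ 2 / 128 by ring]
      exact le_add_of_nonneg_right (by positivity)
    · have h1 : ∏ j ∈ Sᶜ, ‖charFun ν (θ p j)‖ ≤ 1 :=
        Finset.prod_le_one (fun _ _ => norm_nonneg _) fun j _ => norm_charFun_le_one _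
      have h2 : 1 ≤ D * (|p.1| + |p.2|) := by
        have h3 : |p.1 / β ^ 2| + |p.2 / β| ≤ (|p.1| + |p.2|) / β ^ 2 := by
          have := div_add_div_add_le hβ hβ1 p.1 p.2 0
          simpa using this
        have h4 : 1 / (16 * (1 + B)) ≤ (|p.1| + |p.2|) / β ^ 2 / √n :=
          hp.le.trans (div_le_div_of_nonneg_right h3 hsn.le)
        rw [div_le_iff₀ (by positivity)] at h4
        refine h4.trans_eq ?_
        rw [hD]; field_simp
      have h3 : 1 ≤ D ^ 8 * (|p.1| + |p.2|) ^ 8 := by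
        rw [← mul_pow]; exact one_le_pow₀ h2
      have := Real.exp_pos (-(p.1 / β ^ 2) ^ 2 / 128)
      have := Real.exp_pos (-(p.2 / β) ^ 2 / 128)
      have : 0 < Real.exp (-(p.1 / β ^ 2) ^ 2 / 128) * Real.exp (-(p.2 / β) ^ 2 / 128) := by
        positivity
      linarith
  have hfin := norm_integral_le_of_norm_le
    ((hi1.add (integrable_gaussMoment.const_mul (D ^ 8))).const_mul M)
    (Filter.Eventually.of_forall hbound)
  rw [← key, Complex.norm_real, integral_const_mul, integral_add' hi1
    (integrable_gaussMoment.const_mul (D ^ 8)), integral_const_mul] at hfin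
  refine (le_abs_self _).trans (hfin.trans ?_)
  refine mul_le_mul_of_nonneg_left ?_ hM0
  unfold smallBall
  rw [mul_comm gaussMoment]
  exact add_le_add_left hi2 _

end
-- Expectations of the detector and of the energy
section
variable {n : ℕ} {ν : Measure ℝ} [IsProbabilityMeasure ν] {B β : ℝ}

theorem sub_le_card_filter_fin {a b n : ℕ} (hb : b ≤ n) {p : Fin n → Prop} [DecidablePred p]
    (hp : ∀ k : Fin n, a ≤ k → (k : ℕ) < b → p k) : b - a ≤ (Finset.univ.filter p).card := by
  rw [← Nat.card_Ico a b]
  refine Finset.card_le_card_of_surjOn (fun k : Fin n => (k : ℕ)) fun m hm => ?_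
  have hm' := Finset.mem_Ico.1 (Finset.mem_coe.1 hm)
  exact ⟨⟨m, by omega⟩, by simpa using hp ⟨m, by omega⟩ hm'.1 hm'.2, rfl⟩

theorem StdLaw.integral_quadratic_mul_gauss_le (h : StdLaw ν B) (hβ : 0 < β) (hβ1 : β ≤ 1)
    (hn : 0 < n) {A : Finset (Fin n)} (hA : ∀ k ∈ A, n ≤ 2 * ((k : ℕ) + 1))
    (hcard : n ≤ 8 * A.card) {S : Finset (Fin n ⊕ Fin n)}
    (hS : ∀ k ∈ A, Sum.inl k ∉ S ∧ Sum.inr k ∉ S) {a : ℝ} (ha : 0 ≤ a) (x : ℝ) :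
    Integrable (fun v : Fin n ⊕ Fin n → ℝ => (a + 2 * (∑ j ∈ S, v j * trigBasis 2 j x) ^ 2) *
      (gauss (trigDeriv 0 v x / β ^ 2) * gauss (trigDeriv 1 v x / β))) (Measure.pi fun _ => ν) ∧
    ∫ v : Fin n ⊕ Fin n → ℝ, (a + 2 * (∑ j ∈ S, v j * trigBasis 2 j x) ^ 2) *
      (gauss (trigDeriv 0 v x / β ^ 2) * gauss (trigDeriv 1 v x / β)) ∂(Measure.pi fun _ => ν) ≤
      (a + 4) * smallBall B β n := by
  obtain ⟨hi, he⟩ := h.integral_linear_sq S fun j => trigBasis 2 j x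
  set μ : Measure (Fin n ⊕ Fin n → ℝ) := Measure.pi fun _ => ν with hμ
  have hi' : Integrable (fun v : Fin n ⊕ Fin n → ℝ =>
      a + 2 * (∑ j ∈ S, v j * trigBasis 2 j x) ^ 2) μ := (integrable_const a).add (hi.const_mul 2)
  have he' : ∫ v, (a + 2 * (∑ j ∈ S, v j * trigBasis 2 j x) ^ 2) ∂μ ≤ a + 4 := by
    rw [integral_add (integrable_const a) (hi.const_mul 2), integral_const_mul, he]
    have := sum_trigBasis_sq_le hn 2 S x
    simp
    linarith
  constructor
  · refine hi'.mono (Continuous.aestronglyMeasurable (by fun_prop))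
      (Filter.Eventually.of_forall fun v => ?_)
    rw [norm_mul]
    refine mul_le_of_le_one_right (norm_nonneg _) ?_
    rw [Real.norm_eq_abs, abs_of_pos (mul_pos (gauss_pos _) (gauss_pos _))]
    exact mul_le_one₀ (gauss_le_one _) (gauss_pos _).le (gauss_le_one _)
  · have := integral_mul_gauss_mul_gauss_le h hβ hβ1 hn hA hcard hS
      (g := fun w => a + 2 * (∑ i : S, w i * trigBasis 2 (i : Fin n ⊕ Fin n) x) ^ 2)
      (by fun_prop) (fun w => by positivity)
    have e : ∀ v : Fin n ⊕ Fin n → ℝ, ∑ i : S, v i * trigBasis 2 (i : Fin n ⊕ Fin n) x =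
        ∑ j ∈ S, v j * trigBasis 2 j x := fun v =>
      Finset.sum_coe_sort S fun j => v j * trigBasis 2 j x
    simp only [e] at this
    exact this hi' he' x

theorem density_le_add (v : Fin n ⊕ Fin n → ℝ) (S : Finset (Fin n ⊕ Fin n)) (x : ℝ) :
    density β v x ≤ (1 + 2 * (∑ j ∈ S, v j * trigBasis 2 j x) ^ 2) *
        (gauss (trigDeriv 0 v x / β ^ 2) * gauss (trigDeriv 1 v x / β)) +
      (0 + 2 * (∑ j ∈ Sᶜ, v j * trigBasis 2 j x) ^ 2) *
        (gauss (trigDeriv 0 v x / β ^ 2) * gauss (trigDeriv 1 v x / β)) := by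
  rw [← add_mul, density, mul_comm]
  refine mul_le_mul_of_nonneg_right ?_ (mul_pos (gauss_pos _) (gauss_pos _)).le
  refine (japanese_le _).trans ?_
  have e : trigDeriv 2 v x = ∑ j ∈ S, v j * trigBasis 2 j x + ∑ j ∈ Sᶜ, v j * trigBasis 2 j x :=
    (Finset.sum_add_sum_compl _ _).symm
  rw [e]
  nlinarith [sq_nonneg (∑ j ∈ S, v j * trigBasis 2 j x - ∑ j ∈ Sᶜ, v j * trigBasis 2 j x)]

/-- The weight depends on all the coefficients, so the second derivative is split in two. The part
with frequencies in [n/2, 3n/4] uses the decay from (3n/4, n], and the part with the other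
frequencies uses the decay from [n/2, 3n/4]. Each block has at least n/8 members, and 9 = (1 + 4) +
(0 + 4). -/
theorem StdLaw.integral_density_le (h : StdLaw ν B) (hβ : 0 < β) (hβ1 : β ≤ 1) (hn : 2 ≤ n)
    (x : ℝ) :
    ∫ v : Fin n ⊕ Fin n → ℝ, density β v x ∂(Measure.pi fun _ => ν) ≤ 9 * smallBall B β n := by
  classical
  have hn0 : 0 < n := by omega
  let q : Fin n → Prop := fun k => n ≤ 2 * ((k : ℕ) + 1) ∧ 4 * ((k : ℕ) + 1) ≤ 3 * n
  let A₁ : Finset (Fin n) := Finset.univ.filter q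
  let A₂ : Finset (Fin n) := Finset.univ.filter fun k => 3 * n < 4 * ((k : ℕ) + 1)
  let S : Finset (Fin n ⊕ Fin n) := Finset.univ.filter fun j => ¬ q (Sum.elim id id j)
  have hc1 : n ≤ 8 * A₁.card := by
    have := sub_le_card_filter_fin (a := (n - 1) / 2) (b := 3 * n / 4) (n := n) (by omega) (p := q)
      fun k h1 h2 => ⟨by omega, by omega⟩
    have : 3 * n / 4 - (n - 1) / 2 ≤ A₁.card := this
    omega
  have hc2 : n ≤ 8 * A₂.card := by
    have := sub_le_card_filter_fin (a := 3 * n / 4) (b := n) (n := n) le_rfl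
      (p := fun k => 3 * n < 4 * ((k : ℕ) + 1)) fun k h1 h2 => by omega
    have : n - 3 * n / 4 ≤ A₂.card := this
    omega
  have hS1 : ∀ k ∈ A₁, Sum.inl k ∉ S ∧ Sum.inr k ∉ S := fun k hk => by
    have : q k := (Finset.mem_filter.1 hk).2
    simp [S, this]
  have hS2 : ∀ k ∈ A₂, Sum.inl k ∉ Sᶜ ∧ Sum.inr k ∉ Sᶜ := fun k hk => by
    have hk' := (Finset.mem_filter.1 hk).2
    have : ¬ q k := fun hq => by have := hq.2; omega
    simp [S, this]
  obtain ⟨i1, b1⟩ := h.integral_quadratic_mul_gauss_le hβ hβ1 hn0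
    (fun k hk => (Finset.mem_filter.1 hk).2.1) hc1 hS1 zero_le_one x
  obtain ⟨i2, b2⟩ := h.integral_quadratic_mul_gauss_le hβ hβ1 hn0
    (fun k hk => by have := (Finset.mem_filter.1 hk).2; omega) hc2 hS2 le_rfl x
  have := integral_mono_of_nonneg (μ := Measure.pi fun _ : Fin n ⊕ Fin n => ν)
    (Filter.Eventually.of_forall fun v => (density_pos β v x).le) (i1.add i2)
    (Filter.Eventually.of_forall fun v => density_le_add v S x)
  rw [integral_add' i1 i2] at this
  linarith

theorem density_le_sum_sq (hn : 0 < n) (v : Fin n ⊕ Fin n → ℝ) (x : ℝ) :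
    density β v x ≤ 1 + 2 * ∑ j, v j ^ 2 := by
  refine (density_le β v x).trans ((japanese_le _).trans ?_)
  have h1 := Finset.sum_mul_sq_le_sq_mul_sq Finset.univ v fun j => trigBasis 2 j x
  have h2 := sum_trigBasis_sq_le hn 2 Finset.univ x
  have h3 : 0 ≤ ∑ j, v j ^ 2 := Finset.sum_nonneg fun j _ => sq_nonneg _
  have h4 : trigDeriv 2 v x ^ 2 = (∑ j, v j * trigBasis 2 j x) ^ 2 := rfl
  rw [h4]
  nlinarith [mul_le_mul_of_nonneg_left h2 h3]

theorem StdLaw.integrable_sum_sq (h : StdLaw ν B) :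
    Integrable (fun v : Fin n ⊕ Fin n → ℝ => ∑ j, v j ^ 2) (Measure.pi fun _ => ν) :=
  integrable_finsetSum _ fun j _ => (h.integral_coord_sq j).1

theorem StdLaw.integral_detector_le (h : StdLaw ν B) (hβ : 0 < β) (hβ1 : β ≤ 1) (hn : 2 ≤ n) :
    Integrable (detector (n := n) β) (Measure.pi fun _ => ν) ∧
    ∫ v : Fin n ⊕ Fin n → ℝ, detector β v ∂(Measure.pi fun _ => ν) ≤
      18 * Real.pi * smallBall B β n := by
  have hn0 : 0 < n := by omega
  set μ : Measure (Fin n ⊕ Fin n → ℝ) := Measure.pi fun _ => ν with hμ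
  set lam : Measure ℝ := volume.restrict (Set.Ioc 0 (2 * Real.pi)) with hlam
  have : IsFiniteMeasure lam := by rw [hlam]; infer_instance
  have hi : Integrable (Function.uncurry fun (v : Fin n ⊕ Fin n → ℝ) x => density β v x)
      (μ.prod lam) := by
    have h1 : Integrable (fun v : Fin n ⊕ Fin n → ℝ => 1 + 2 * ∑ j, v j ^ 2) μ :=
      (integrable_const 1).add (h.integrable_sum_sq.const_mul 2)
    refine (h1.comp_fst lam).mono' (continuous_density β).aestronglyMeasurable
      (Filter.Eventually.of_forall fun q => ?_)
    rw [Function.uncurry_def, Real.norm_eq_abs, abs_of_pos (density_pos _ _ _)]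
    exact density_le_sum_sq hn0 _ _
  have e : ∀ v : Fin n ⊕ Fin n → ℝ, detector β v = ∫ x, density β v x ∂lam := fun v => by
    rw [detector, intervalIntegral.integral_of_le Real.two_pi_pos.le]
  constructor
  · have : detector (n := n) β = fun v => ∫ x, density β v x ∂lam := funext e
    rw [this]
    exact hi.integral_prod_left
  · simp_rw [e]
    rw [integral_integral_swap hi]
    have := integral_mono_of_nonneg (μ := lam)
      (Filter.Eventually.of_forall fun x => integral_nonneg fun v => (density_pos β v x).le)
      (integrable_const (9 * smallBall B β n))
      (Filter.Eventually.of_forall fun x => h.integral_density_le (n := n) hβ hβ1 hn x)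
    refine this.trans_eq ?_
    rw [integral_const, hlam, measureReal_restrict_apply_univ, Real.volume_real_Ioc_of_le
      Real.two_pi_pos.le, smul_eq_mul]
    ring

/-- The concave function q/(1 + q) lies below its tangent q/9 + 4/9 at q = 2, the mean of the
energy. -/
theorem StdLaw.integral_energy_div_le (h : StdLaw ν B) (hn : 0 < n) :
    ∫ v : Fin n ⊕ Fin n → ℝ, energy v / (1 + energy v) ∂(Measure.pi fun _ => ν) ≤ 2 / 3 := by
  have hn' : (0 : ℝ) < n := by exact_mod_cast hn
  set μ : Measure (Fin n ⊕ Fin n → ℝ) := Measure.pi fun _ => ν with hμ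
  have hE : Integrable (energy (n := n)) μ := h.integrable_sum_sq.const_mul _
  have hEe : ∫ v, energy v ∂μ = 2 := by
    simp only [energy]
    rw [integral_const_mul, integral_finsetSum _ fun j _ => (h.integral_coord_sq j).1,
      Finset.sum_congr rfl fun j _ => (h.integral_coord_sq j).2]
    simp
    field_simp; norm_num
  have hi : Integrable (fun v : Fin n ⊕ Fin n → ℝ => 1 / 9 * energy v + 4 / 9) μ :=
    (hE.const_mul _).add (integrable_const _)
  have := integral_mono_of_nonneg (μ := μ) (f := fun v => energy v / (1 + energy v))
    (Filter.Eventually.of_forall fun v => div_nonneg (energy_nonneg v)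
      (by have := energy_nonneg v; linarith)) hi (Filter.Eventually.of_forall fun v => by
      have h0 := energy_nonneg v
      simp only
      rw [div_le_iff₀ (by linarith)]
      nlinarith [sq_nonneg (energy v - 2)])
  refine this.trans_eq ?_
  rw [integral_add (hE.const_mul _) (integrable_const _), integral_const_mul, hEe]
  simp; norm_num

end
/-! ### Constants and the choice of scale -/

theorem StdLaw.of_variance {ν : Measure ℝ} [IsProbabilityMeasure ν] {C₀ : ℝ} (hC₀ : 0 < C₀)
    (hm : ∫ x, x ∂ν = 0) (hv : Var[id; ν] = 1)
    (h : (∀ᵐ x ∂ν, |x| ≤ C₀) ∨ LogSobolev ν C₀) :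
    StdLaw ν (C₀ ^ 3 + 6 * Real.exp (2 + C₀ / 4)) := by
  have hLp : MemLp id 2 ν := by
    rw [← evariance_lt_top_iff_memLp aestronglyMeasurable_id, lt_top_iff_ne_top]
    -- An infinite variance is recorded as 0, so the value 1 excludes it.
    intro ht
    rw [variance, ht] at hv
    simp at hv
  have hi : Integrable (fun x : ℝ => x ^ 2) ν :=
    (memLp_two_iff_integrable_sq aestronglyMeasurable_id).1 hLp
  have h1 : ∫ x, x ^ 2 ∂ν = 1 := by
    rw [variance_eq_integral aemeasurable_id] at hv
    simpa [hm] using hv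
  have h6 : 0 < 6 * Real.exp (2 + C₀ / 4) := by positivity
  have h3 : 0 < C₀ ^ 3 := by positivity
  have hc : Integrable (fun x : ℝ => |x| ^ 3) ν ∧
      ∫ x, |x| ^ 3 ∂ν ≤ C₀ ^ 3 + 6 * Real.exp (2 + C₀ / 4) := by
    rcases h with h | h
    · have hb : ∀ᵐ x ∂ν, |x| ^ 3 ≤ C₀ ^ 3 := h.mono fun x hx =>
        pow_le_pow_left₀ (abs_nonneg x) hx 3
      have hi3 : Integrable (fun x : ℝ => |x| ^ 3) ν :=
        Integrable.of_bound (by fun_prop) (C₀ ^ 3) (hb.mono fun x hx => by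
          rwa [Real.norm_eq_abs, abs_of_nonneg (by positivity)])
      refine ⟨hi3, ?_⟩
      have := integral_mono_ae hi3 (integrable_const (C₀ ^ 3)) hb
      simp at this
      linarith
    · obtain ⟨a, b⟩ := h.integrable_abs_cube hC₀ hi h1
      exact ⟨a, b.trans (by linarith)⟩
  exact ⟨hm, hi, h1, hc.1, hc.2⟩

/-- The contribution of one unstable interval to the detector, up to scaling. -/
noncomputable def detectConst : ℝ := Real.exp (-13 / 2) / 12

theorem detectConst_pos : 0 < detectConst := by unfold detectConst; positivity

/-- The ratio of the scale of the detector to `√δ`. -/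
noncomputable def scaleConst : ℝ := √(detectConst / (36864 * Real.pi ^ 2))

theorem scaleConst_pos : 0 < scaleConst :=
  Real.sqrt_pos.2 (div_pos detectConst_pos (by positivity))

/-- As 36864 = 16 · 18 · 128, the main term of the mean is exactly a sixteenth of the threshold. -/
theorem scaleConst_sq : 36864 * Real.pi ^ 2 * scaleConst ^ 2 = detectConst := by
  rw [scaleConst, Real.sq_sqrt (div_pos detectConst_pos (by positivity)).le]
  field_simp

/-- The value which the detector exceeds at exceptional polynomials, for `δ = η ^ 4`. -/
noncomputable def threshold (η : ℝ) : ℝ := detectConst * (scaleConst * η ^ 6)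

theorem threshold_pos {η : ℝ} (hη : 0 < η) : 0 < threshold η := by
  have := detectConst_pos
  have := scaleConst_pos
  unfold threshold; positivity

section
variable {n : ℕ} {ν : Measure ℝ} [IsProbabilityMeasure ν] {B C₀ η : ℝ}

/-- A sixteenth for the main term and another for the error. As nη¹⁰ ≥ 1, the eighth power makes the
error O(η⁸), which is small against the threshold of order η⁶. -/
theorem StdLaw.integral_detector_le_threshold (h : StdLaw ν B) (hn : 2 ≤ n) (hη : 0 < η)
    (hs : scaleConst * η ^ 2 ≤ 1) (hnη : 1 ≤ n * η ^ 10)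
    (hη2 : 288 * Real.pi * gaussMoment * (16 * (1 + B)) ^ 8 * η ^ 2 ≤
      detectConst * scaleConst ^ 17) :
    ∫ v : Fin n ⊕ Fin n → ℝ, detector (scaleConst * η ^ 2) v ∂(Measure.pi fun _ => ν) ≤
      threshold η / 8 := by
  have hκ := detectConst_pos
  have hε := scaleConst_pos
  have hsq := scaleConst_sq
  have hg := gaussMoment_nonneg
  have hB := h.nonneg
  refine (h.integral_detector_le (mul_pos hε (pow_pos hη 2)) hs hn).2.trans ?_
  have hn' : (0 : ℝ) < n := by exact_mod_cast (by omega : 0 < n)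
  set ε := scaleConst
  set κ := detectConst
  set W := 16 * (1 + B) with hW
  have hW0 : 0 < W := by positivity
  have hpow : ((ε * η ^ 2) ^ 2 * √n) ^ 8 = ε ^ 16 * η ^ 32 * n ^ 4 := by
    have : √(n : ℝ) ^ 8 = n ^ 4 := by
      rw [show (8 : ℕ) = 2 * 4 from rfl, pow_mul, Real.sq_sqrt hn'.le]
    rw [mul_pow, this]; ring
  have h1 : (W / ((ε * η ^ 2) ^ 2 * √n)) ^ 8 ≤ W ^ 8 * η ^ 8 / ε ^ 16 := by
    rw [div_pow, hpow, div_le_div_iff₀ (by positivity) (by positivity)]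
    have h4 : 1 ≤ (n * η ^ 10) ^ 4 := one_le_pow₀ hnη
    calc W ^ 8 * ε ^ 16 = W ^ 8 * ε ^ 16 * 1 := by ring
      _ ≤ W ^ 8 * ε ^ 16 * (n * η ^ 10) ^ 4 := by gcongr
      _ = W ^ 8 * η ^ 8 * (ε ^ 16 * η ^ 32 * n ^ 4) := by ring
  have h2 : 288 * Real.pi * (gaussMoment * (W ^ 8 * η ^ 8 / ε ^ 16)) ≤ κ * (ε * η ^ 6) := by
    rw [show 288 * Real.pi * (gaussMoment * (W ^ 8 * η ^ 8 / ε ^ 16)) =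
      288 * Real.pi * gaussMoment * W ^ 8 * η ^ 2 * η ^ 6 / ε ^ 16 by ring,
      div_le_iff₀ (by positivity)]
    calc _ ≤ κ * ε ^ 17 * η ^ 6 := by gcongr
      _ = _ := by ring
  have h3 : gaussMoment * (W / ((ε * η ^ 2) ^ 2 * √n)) ^ 8 ≤
      gaussMoment * (W ^ 8 * η ^ 8 / ε ^ 16) := mul_le_mul_of_nonneg_left h1 hg
  have h4 : 18 * Real.pi * (128 * Real.pi * (ε * η ^ 2) ^ 3) = κ * (ε * η ^ 6) / 16 := by
    rw [← hsq]; ring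
  have h5 := mul_le_mul_of_nonneg_left h3 (by positivity : 0 ≤ 18 * Real.pi)
  rw [smallBall, threshold, mul_add, h4]
  linarith

/-- The tail of the detector in the range where Markov's inequality suffices. -/
theorem StdLaw.detector_tail_of_le (h : StdLaw ν B) (hn : 2 ≤ n) (hη : 0 < η)
    (hs : scaleConst * η ^ 2 ≤ 1)
    (hm : ∫ v : Fin n ⊕ Fin n → ℝ, detector (scaleConst * η ^ 2) v ∂(Measure.pi fun _ => ν) ≤
      threshold η / 8) (hu : η ^ 32 * n ≤ 1) :
    (Measure.pi fun _ : Fin n ⊕ Fin n => ν).real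
      {v | threshold η ≤ detector (scaleConst * η ^ 2) v} ≤ Real.exp (-(η ^ 32 * n) / 2) := by
  have hs0 := threshold_pos hη
  have hi := (h.integral_detector_le (n := n) (mul_pos scaleConst_pos (pow_pos hη 2)) hs hn).1
  have h1 := mul_meas_ge_le_integral_of_nonneg
    (Filter.Eventually.of_forall fun v => detector_nonneg (scaleConst * η ^ 2) v) hi (threshold η)
  have h2 := h1.trans hm
  have h3 : (Measure.pi fun _ : Fin n ⊕ Fin n => ν).real
      {v | threshold η ≤ detector (scaleConst * η ^ 2) v} ≤ 1 / 8 :=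
    le_of_mul_le_mul_left (by linarith) hs0
  -- For an exponent u/2 with u ≤ 1 the target is at least 1/2, above the 1/8 from Markov.
  have h4 := Real.add_one_le_exp (-(η ^ 32 * n) / 2)
  linarith

/-- A deviation of order η⁶ against a variance proxy of order 1/(η¹⁶n) gives an exponent of order
η²⁸n. The spare η⁴ absorbs the constants. -/
theorem detector_tail_bounded (hn : 0 < n) (hη : 0 < η) (hs : scaleConst * η ^ 2 ≤ 1)
    (hC₀ : 0 < C₀) (hν : ∀ᵐ x ∂ν, |x| ≤ C₀)
    (hm : ∫ v : Fin n ⊕ Fin n → ℝ, detector (scaleConst * η ^ 2) v ∂(Measure.pi fun _ => ν) ≤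
      threshold η / 8)
    (hη4 : 8 * boundedConst C₀ * η ^ 4 ≤ detectConst ^ 2 * scaleConst ^ 10) :
    (Measure.pi fun _ : Fin n ⊕ Fin n => ν).real
      {v | threshold η ≤ detector (scaleConst * η ^ 2) v} ≤ Real.exp (-(η ^ 32 * n) / 2) := by
  have hs0 := threshold_pos hη
  have hb := boundedConst_pos hC₀
  have hε := scaleConst_pos
  refine (measureReal_mono fun v hv => ?_).trans
    ((detector_tail_of_bounded (mul_pos hε (pow_pos hη 2)) hs hn hC₀ hν
      (half_pos hs0)).trans (Real.exp_le_exp.2 ?_))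
  · have hv' : threshold η ≤ detector (scaleConst * η ^ 2) v := hv
    change _ ≤ detector (scaleConst * η ^ 2) v
    linarith
  · rw [div_le_div_iff₀ (by positivity) (by positivity), threshold]
    have h1 : 0 ≤ η ^ 28 * (n : ℝ) := by positivity
    have := mul_le_mul_of_nonneg_right hη4 h1
    nlinarith

theorem detector_tail_logSobolev (h : StdLaw ν B) (hn : 2 ≤ n) (hη : 0 < η)
    (hs : scaleConst * η ^ 2 ≤ 1) (hC₀ : 0 < C₀) (hν : LogSobolev ν C₀)
    (hm : ∫ v : Fin n ⊕ Fin n → ℝ, detector (scaleConst * η ^ 2) v ∂(Measure.pi fun _ => ν) ≤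
      threshold η / 8)
    (hη12 : 10240 * Real.pi ^ 2 * C₀ * η ^ 12 ≤ detectConst ^ 2 * scaleConst ^ 6)
    (hη32 : 1152 * C₀ * η ^ 32 ≤ 1) (hu : 1 ≤ η ^ 32 * n) :
    (Measure.pi fun _ : Fin n ⊕ Fin n => ν).real
      {v | threshold η ≤ detector (scaleConst * η ^ 2) v} ≤ Real.exp (-(η ^ 32 * n) / 2) := by
  have hn0 : 0 < n := by omega
  have hn' : (0 : ℝ) < n := by exact_mod_cast hn0
  have hs0 := threshold_pos hη
  have hε := scaleConst_pos
  set β := scaleConst * η ^ 2 with hβ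
  have hβ0 : 0 < β := mul_pos hε (pow_pos hη 2)
  set μ := Measure.pi fun _ : Fin n ⊕ Fin n => ν with hμ
  have hi := (h.integral_detector_le (n := n) hβ0 hs hn).1
  have hm' : ∫ v, detector β v / (1 + energy v) ∂μ ≤ threshold η / 8 := by
    refine le_trans (integral_mono_of_nonneg (Filter.Eventually.of_forall fun v => ?_) hi
      (Filter.Eventually.of_forall fun v => ?_)) hm
    · have := energy_nonneg v
      exact div_nonneg (detector_nonneg β v) (by linarith)
    · have := energy_nonneg v
      exact div_le_self (detector_nonneg β v) (by linarith)
  have t1 := detector_tail_of_logSobolev hβ0 hs hn0 hC₀ hν (r := threshold η / 8) (by positivity)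
  have t2 := energy_tail_of_logSobolev hn0 hC₀ hν (h.integral_energy_div_le hn0)
  -- Here the variance proxy has order 1/(η⁸n), so the exponent has order η²⁰n and η¹² is to spare.
  have e1 : Real.exp (-(threshold η / 8) ^ 2 * (β ^ 4 * n) / (80 * Real.pi ^ 2 * C₀)) ≤
      Real.exp (-(2 * (η ^ 32 * n))) := by
    rw [Real.exp_le_exp, div_le_iff₀ (by positivity), threshold, hβ]
    have h1 : 0 ≤ η ^ 20 * (n : ℝ) := by positivity
    have := mul_le_mul_of_nonneg_right hη12 h1
    nlinarith
  have e2 : Real.exp (-n / (576 * C₀)) ≤ Real.exp (-(2 * (η ^ 32 * n))) := by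
    rw [Real.exp_le_exp, div_le_iff₀ (by positivity)]
    nlinarith [mul_le_mul_of_nonneg_right hη32 hn'.le]
  have hsub : {v : Fin n ⊕ Fin n → ℝ | threshold η ≤ detector β v} ⊆
      {v | (∫ v, detector β v / (1 + energy v) ∂μ) + threshold η / 8 ≤
        detector β v / (1 + energy v)} ∪ {v | 3 ≤ energy v} := fun v hv => by
    have hv' : threshold η ≤ detector β v := hv
    rcases le_or_gt 3 (energy v) with hE | hE
    · exact Or.inr hE
    -- Energy below 3 divides by less than 4: the quotient is at least threshold/4, which is mean
    -- plus deviation.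
    · left
      have := energy_nonneg v
      change _ ≤ detector β v / (1 + energy v)
      rw [le_div_iff₀ (by linarith)]
      nlinarith
  have t3 : μ.real {v | threshold η ≤ detector β v} ≤ 2 * Real.exp (-(2 * (η ^ 32 * n))) := by
    refine (measureReal_mono hsub).trans ((measureReal_union_le _ _).trans ?_)
    linarith
  refine t3.trans ?_
  -- The prefactor 2 from the union bound is absorbed, because η³²n ≥ 1.
  have e3 : Real.exp (-(η ^ 32 * n) / 2) =
      Real.exp (3 / 2 * (η ^ 32 * n)) * Real.exp (-(2 * (η ^ 32 * n))) := by
    rw [← Real.exp_add]; congr 1; ring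
  rw [e3]
  refine mul_le_mul_of_nonneg_right ?_ (Real.exp_pos _).le
  have := Real.add_one_le_exp (3 / 2 * (η ^ 32 * n))
  linarith

open Filter Topology in
theorem eventually_mul_pow_le (a : ℝ) {b : ℝ} (hb : 0 < b) {k : ℕ} (hk : k ≠ 0) :
    ∀ᶠ η in 𝓝[>] (0 : ℝ), a * η ^ k ≤ b := by
  have h : Tendsto (fun η : ℝ => a * η ^ k) (𝓝 0) (𝓝 (a * 0 ^ k)) :=
    Continuous.tendsto (by fun_prop) 0
  rw [zero_pow hk, mul_zero] at h
  exact ((h.eventually_lt_const hb).filter_mono nhdsWithin_le_nhds).mono fun _ h => h.le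

open Filter Topology in
/-- The tail of the detector, at all sufficiently small scales. -/
theorem eventually_detector_tail (hC₀ : 0 < C₀) :
    ∀ᶠ η : ℝ in 𝓝[>] 0, ∀ (ν : Measure ℝ) [IsProbabilityMeasure ν],
      (∫ x, x ∂ν) = 0 → Var[id; ν] = 1 → ((∀ᵐ x ∂ν, |x| ≤ C₀) ∨ LogSobolev ν C₀) →
      ∀ n : ℕ, 2 ≤ n → 1 ≤ (n : ℝ) * η ^ 10 →
        (Measure.pi fun _ : Fin n ⊕ Fin n => ν).real
          {v | threshold η ≤ detector (scaleConst * η ^ 2) v} ≤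
            Real.exp (-(η ^ 32 * n) / 2) := by
  have hκ := detectConst_pos
  have hε := scaleConst_pos
  filter_upwards [self_mem_nhdsWithin,
    eventually_mul_pow_le scaleConst one_pos (two_ne_zero),
    eventually_mul_pow_le (288 * Real.pi * gaussMoment *
      (16 * (1 + (C₀ ^ 3 + 6 * Real.exp (2 + C₀ / 4)))) ^ 8)
      (by positivity : 0 < detectConst * scaleConst ^ 17) (two_ne_zero),
    eventually_mul_pow_le (8 * boundedConst C₀)
      (by positivity : 0 < detectConst ^ 2 * scaleConst ^ 10) (four_ne_zero),
    eventually_mul_pow_le (10240 * Real.pi ^ 2 * C₀)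
      (by positivity : 0 < detectConst ^ 2 * scaleConst ^ 6) (k := 12) (by norm_num),
    eventually_mul_pow_le (1152 * C₀) one_pos (k := 32) (by norm_num)]
    with η hη h1 h2 h3 h4 h5 ν _ hm hv hν n hn hnη
  have hstd := StdLaw.of_variance hC₀ hm hv hν
  have hmean := hstd.integral_detector_le_threshold hn hη h1 hnη h2
  rcases le_total (η ^ 32 * n) 1 with hu | hu
  · exact hstd.detector_tail_of_le hn hη h1 hmean hu
  · rcases hν with hν | hν
    · exact detector_tail_bounded (by omega) hη h1 hC₀ hν hmean h3
    · exact detector_tail_logSobolev hstd hn hη h1 hC₀ hν hmean h4 h5 hu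

end

theorem map_eq_pi_of_iIndepFun {ι Ω : Type*} [Fintype ι] [MeasurableSpace Ω] {P : Measure Ω}
    [IsProbabilityMeasure P] {ν : Measure ℝ} {X : ι → Ω → ℝ} (hX : ∀ j, HasLaw (X j) ν P)
    (hi : iIndepFun X P) : P.map (fun ω j => X j ω) = Measure.pi fun _ => ν := by
  rw [(iIndepFun_iff_map_fun_eq_pi_map fun j => (hX j).aemeasurable).1 hi]
  congr 1; funext j
  exact (hX j).map_eq

end RandomTrig

/-! ### Proof of the theorem -/

open RandomTrig in
theorem theorem4p1 :
    ∃ R₀ : ℝ, 0 < R₀ ∧ ∃ c : ℝ, 0 < c ∧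
      ∀ C₀ : ℝ, 0 < C₀ → ∀ K : ℝ, 1 ≤ K →
      ∃ δ₀ : ℝ, 0 < δ₀ ∧ ∃ N₀ : ℕ,
      -- the law of the coefficients: mean zero, variance one, bounded or log-Sobolev
      ∀ (ν : Measure ℝ) [IsProbabilityMeasure ν],
        (∫ x, x ∂ν) = 0 → Var[id; ν] = 1 →
        ((∀ᵐ x ∂ν, |x| ≤ C₀) ∨ LogSobolev ν C₀) →
      ∀ (n : ℕ), N₀ ≤ n →
      -- the 2n independent coefficients with that law
      ∀ (Ω : Type*) [MeasurableSpace Ω] (P : Measure Ω) [IsProbabilityMeasure P]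
        (X : Fin n ⊕ Fin n → Ω → ℝ),
        (∀ j, HasLaw (X j) ν P) → iIndepFun X P →
      -- the intervals
      ∀ (R : ℝ), R₀ ≤ R → ∀ (N : ℕ) (y : Fin N → ℝ), IsCover n R y →
      -- the parameters
      ∀ (α β δ : ℝ), (n : ℝ) ^ (-(2 / 5) : ℝ) < δ → δ ≤ δ₀ →
        Comparable K α (δ ^ (3 / 2 : ℝ)) → Comparable K β (δ ^ (3 / 4 : ℝ)) →
        P.real {ω | (fun j => X j ω) ∈ exceptionalSet n R α β δ y}
          ≤ Real.exp (-c * δ ^ 8 * n) := by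
  have hε := scaleConst_pos
  -- R₀ = 1 is what the multiplicity argument uses; c = 1/2 is the constant in the detector tail.
  refine ⟨1, one_pos, 1 / 2, by norm_num, fun C₀ hC₀ K hK => ?_⟩
  have hev : ∀ᶠ η : ℝ in nhdsWithin 0 (Set.Ioi 0), (K * η ^ 2 ≤ scaleConst ^ 2 ∧
      K * η ^ 1 ≤ scaleConst ∧ scaleConst * η ^ 2 ≤ 1 / 2) ∧ _ :=
    ((eventually_mul_pow_le K (pow_pos hε 2) two_ne_zero).and
      ((eventually_mul_pow_le K hε one_ne_zero).and
        (eventually_mul_pow_le scaleConst (by norm_num : (0 : ℝ) < 1 / 2) two_ne_zero))).and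
      (eventually_detector_tail hC₀)
  obtain ⟨η₀, hη₀, hsub⟩ := mem_nhdsGT_iff_exists_Ioc_subset.1 hev
  have hη₀' : 0 < η₀ := hη₀
  refine ⟨η₀ ^ 4, pow_pos hη₀' 4, 2, ?_⟩
  intro ν _ hm hv hν n hn Ω _ P _ X hX hind R hR N y hy α β δ hδn hδ hα hβ
  have hn' : (0 : ℝ) < n := by exact_mod_cast (by omega : 0 < n)
  have hδ0 : 0 < δ := (Real.rpow_nonneg hn'.le _).trans_lt hδn
  -- With δ = η⁴ all the powers of δ become integer powers of η.
  set η : ℝ := δ ^ (1 / 4 : ℝ) with hη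
  have hη0 : 0 < η := Real.rpow_pos_of_pos hδ0 _
  have hpow : ∀ (k : ℕ) (r : ℝ), 1 / 4 * (k : ℝ) = r → δ ^ r = η ^ k := fun k r hr => by
    rw [hη, ← Real.rpow_natCast, ← Real.rpow_mul hδ0.le, hr]
  have h1 : δ = η ^ 4 := by rw [← hpow 4 1 (by norm_num), Real.rpow_one]
  have h32 : δ ^ (3 / 2 : ℝ) = η ^ 6 := hpow 6 _ (by norm_num)
  have h34 : δ ^ (3 / 4 : ℝ) = η ^ 3 := hpow 3 _ (by norm_num)
  have hηle : η ≤ η₀ := by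
    rw [h1] at hδ
    exact le_of_pow_le_pow_left₀ four_ne_zero hη₀'.le hδ
  -- The lower bound on δ, raised to the power 5/2.
  have hnη : 1 ≤ (n : ℝ) * η ^ 10 := by
    have h := Real.rpow_le_rpow (Real.rpow_nonneg hn'.le _) hδn.le (by norm_num : (0 : ℝ) ≤ 5 / 2)
    rw [← Real.rpow_mul hn'.le, hpow 10 (5 / 2) (by norm_num),
      (by norm_num : (-(2 / 5) * (5 / 2) : ℝ) = -1), Real.rpow_neg_one] at h
    have := mul_le_mul_of_nonneg_left h hn'.le
    rwa [mul_inv_cancel₀ hn'.ne'] at this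
  obtain ⟨⟨hK1, hK2, hs⟩, htail⟩ := hsub ⟨hη0, hηle⟩
  -- α is at most Kη⁶ and the squared scale is ε²η⁴, so the constant K is absorbed by η²; for β,
  -- likewise, by one factor η.
  have hα' : α ≤ (scaleConst * η ^ 2) ^ 2 := by
    have := hα.1
    rw [h32] at this
    nlinarith [mul_le_mul_of_nonneg_right hK1 (pow_pos hη0 4).le]
  have hβ' : β ≤ scaleConst * η ^ 2 := by
    have := hβ.1
    rw [h34] at this
    nlinarith [mul_le_mul_of_nonneg_right hK2 (pow_pos hη0 2).le]
  have hXm : AEMeasurable (fun ω j => X j ω) P := aemeasurable_pi_lambda _ fun j => (hX j).aemeasurable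
  set E : Set (Fin n ⊕ Fin n → ℝ) := {v | threshold η ≤ detector (scaleConst * η ^ 2) v} with hE
  have hEm : MeasurableSet E := measurableSet_le measurable_const (continuous_detector _).measurable
  calc P.real {ω | (fun j => X j ω) ∈ exceptionalSet n R α β δ y}
      ≤ P.real ((fun ω j => X j ω) ⁻¹' E) := measureReal_mono fun ω hω => by
        have := le_detector_of_isExceptional (by omega) hR hy (by positivity) hs hα' hβ' hω
        refine le_trans (le_of_eq ?_) this
        rw [threshold, detectConst, h1]; ring
    _ = (Measure.pi fun _ : Fin n ⊕ Fin n => ν).real E := by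
        rw [← map_eq_pi_of_iIndepFun hX hind, map_measureReal_apply_of_aemeasurable hXm hEm]
    _ ≤ Real.exp (-(η ^ 32 * n) / 2) := htail ν hm hv hν n hn hnη
    _ = Real.exp (-(1 / 2) * δ ^ 8 * n) := by
        rw [h1]; congr 1; ring
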